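/- Let $k$ be a field of characteristic zero and $R=k[x_0,x_1,x_2,x_3]$. Let $F=\ell_1\cdots\ell_m$ ($m\ge 1$) be a product of pairwise linearly independent linear forms, so that $F$ defines an arrangement of $m$ distinct planes in $\mathbb P^3$. For a form $G$ let $J_G=\langle \partial G/\partial x_0,\dots,\partial G/\partial x_3\rangle$ be its Jacobian ideal; let $\overline C_G$ be the subscheme of $\mathbb P^3$ defined by the intersection $\overline{J_G}$ of the height two primary ideals in a minimal primary decomposition of $J_G$, and let $C_G^{red}$ be the subscheme defined by $\sqrt{J_G}$. Write $I_C\subseteq R$ for the saturated homogeneous ideal of a subscheme $C\subseteq\mathbb P^3$, and $M(C)=\bigoplus_{t\in\mathbb Z}H^1(\mathbb P^3,\mathcal I_C(t))$ for its Hartshorne–Rao module; $N(-1)$ denotes the graded module with $N(-1)_t=N_{t-1}$. Call $C$ arithmetically Cohen–Macaulay (ACM) if $R/I_C$ is a Cohen–Macaulay ring. Two subschemes $C,C'$ are linked if there is a regular sequence of two forms $f,g\in I_C\cap I_{C'}$ with $(f,g):I_C=I_{C'}$ and $(f,g):I_{C'}=I_C$; they are in the same even liaison class if they are joined by a chain of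 an even number of links. Let $L$ be a linear form that does not vanish on any component of $C_F^{red}$; if $m=1$ (in which case $C_F^{red}$ is empty) assume moreover that $L$ and $F$ are linearly independent. Then: (i) $M(\overline C_{LF})\cong M(\overline C_F)(-1)$ and $M(C_{LF}^{red})\cong M(C_F^{red})(-1)$ as graded $R$-modules. (ii) $I_{\overline C_{LF}}=L\cdot I_{\overline C_F}+(F)$ and $I_{C_{LF}^{red}}=L\cdot I_{C_F^{red}}+(F)$. (iii) $\overline C_{LF}$ is ACM if and only if $\overline C_F$ is ACM, and $C_{LF}^{red}$ is ACM if and only if $C_F^{red}$ is ACM. Moreover $\overline C_{LF}$ is in the same even liaison class as $\overline C_F$, and $C_{LF}^{red}$ is in the same even liaison class as $C_F^{red}$. (The empty subscheme, with saturated ideal $R$, is allowed; it counts as ACM.) -/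

import Mathlib

noncomputable section

namespace ArrCurve

open MvPolynomial

/-- The homogeneous coordinate ring `k[x₀, x₁, x₂, x₃]` of projective 3-space. -/
abbrev CoordRing (k : Type*) [Field k] : Type _ := MvPolynomial (Fin 4) k

/-- The function field `k(x₀, x₁, x₂, x₃)` of the affine cone. -/
abbrev Frac (k : Type*) [Field k] : Type _ := FractionRing (CoordRing k)

section Ideals

variable {k : Type*} [Field k]

/-- The Jacobian ideal of `F`, generated by the partial derivatives of `F`. -/
def jacobianIdeal (F : CoordRing k) : Ideal (CoordRing k) :=
  Ideal.span (Set.range fun i : Fin 4 => pderiv i F)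

/-- The irrelevant maximal ideal `(x₀, x₁, x₂, x₃)`. -/
def irrelevantIdeal (k : Type*) [Field k] : Ideal (CoordRing k) :=
  Ideal.span (Set.range (X : Fin 4 → CoordRing k))

/-- The saturation `⋃ₙ (I : 𝔪ⁿ)` of an ideal with respect to the irrelevant ideal `𝔪`. For
homogeneous `I` this is the saturated homogeneous ideal of the closed subscheme of projective
3-space defined by `I`. -/
def saturation (I : Ideal (CoordRing k)) : Ideal (CoordRing k) where
  carrier := {f | ∃ n : ℕ, ∀ g ∈ irrelevantIdeal k ^ n, g * f ∈ I}
  zero_mem' := ⟨0, fun g _ => by simp⟩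
  add_mem' := by
    rintro f₁ f₂ ⟨n₁, h₁⟩ ⟨n₂, h₂⟩
    refine ⟨n₁ + n₂, fun g hg => ?_⟩
    rw [mul_add]
    exact I.add_mem (h₁ g (Ideal.pow_le_pow_right (Nat.le_add_right _ _) hg))
      (h₂ g (Ideal.pow_le_pow_right (Nat.le_add_left _ _) hg))
  smul_mem' := by
    rintro c f ⟨n, h⟩
    refine ⟨n, fun g hg => ?_⟩
    rw [smul_eq_mul, mul_left_comm]
    exact I.mul_mem_left c (h g hg)

/-- The top-dimensional part of an ideal `J` of height at least two: the intersection of the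
primary ideals of height two in a minimal primary decomposition of `J`. If `J` has height at least
two then these components are isolated, hence the same in every such decomposition; the empty
intersection is the unit ideal. -/
def topDimPart (J : Ideal (CoordRing k)) : Ideal (CoordRing k) :=
  sInf {q | ∃ t : Finset (Ideal (CoordRing k)),
    Submodule.IsMinimalPrimaryDecomposition J t ∧ q ∈ t ∧ q.radical.height = 2}

/-- The saturated homogeneous ideal of the curve `C̄_F`, the scheme defined by the top-dimensional
part of the Jacobian ideal of `F`. -/
def topCurveIdeal (F : CoordRing k) : Ideal (CoordRing k) :=
  saturation (topDimPart (jacobianIdeal F))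

/-- The saturated homogeneous ideal of the curve `C_F^red`, the scheme defined by the radical of
the Jacobian ideal of `F`. -/
def redCurveIdeal (F : CoordRing k) : Ideal (CoordRing k) :=
  saturation (jacobianIdeal F).radical

end Ideals

section HartshorneRao

variable {k : Type*} [Field k]

/-- The localization `I_u` of the ideal `I` at the powers of `u`, inside the function field. For
`u` a product of variables and `I` homogeneous, its part of degree `t` is the module of sections of
the twisted ideal sheaf `𝓘(t)` over the open set `D₊(u)`. -/
def idealAway (I : Ideal (CoordRing k)) (u : CoordRing k) : Submodule (CoordRing k) (Frac k) where
  carrier := {f | ∃ n : ℕ, ∃ g ∈ I, u ^ n • f = algebraMap (CoordRing k) (Frac k) g}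
  zero_mem' := ⟨0, 0, I.zero_mem, by simp⟩
  add_mem' := by
    rintro f₁ f₂ ⟨n₁, g₁, hg₁, h₁⟩ ⟨n₂, g₂, hg₂, h₂⟩
    refine ⟨n₁ + n₂, u ^ n₂ * g₁ + u ^ n₁ * g₂,
      I.add_mem (I.mul_mem_left _ hg₁) (I.mul_mem_left _ hg₂), ?_⟩
    rw [map_add, map_mul, map_mul, ← h₁, ← h₂, smul_add, ← Algebra.smul_def, ← Algebra.smul_def,
      smul_smul, smul_smul, pow_add, mul_comm (u ^ n₁)]
  smul_mem' := by
    rintro c f ⟨n, g, hg, h⟩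
    refine ⟨n, c * g, I.mul_mem_left _ hg, ?_⟩
    rw [smul_comm, h, map_mul, Algebra.smul_def]

theorem idealAway_le_mul (I : Ideal (CoordRing k)) (u v : CoordRing k) :
    idealAway I u ≤ idealAway I (u * v) := by
  rintro f ⟨n, g, hg, h⟩
  refine ⟨n, v ^ n * g, I.mul_mem_left _ hg, ?_⟩
  rw [map_mul, ← h, ← Algebra.smul_def, smul_smul, mul_pow, mul_comm]

/-- Čech 1-cocycles of `⨁ₜ 𝓘(t)` for the standard affine cover `D₊(x₀), …, D₊(x₃)`. -/
def cocycles (I : Ideal (CoordRing k)) : Submodule (CoordRing k) (Fin 4 → Fin 4 → Frac k) where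
  carrier := {c | (∀ i j, c i j ∈ idealAway I (X i * X j)) ∧
    ∀ i j l, c j l - c i l + c i j = 0}
  zero_mem' := ⟨fun _ _ => Submodule.zero_mem _, fun _ _ _ => by simp⟩
  add_mem' := by
    rintro c d ⟨hc, hc'⟩ ⟨hd, hd'⟩
    refine ⟨fun i j => Submodule.add_mem _ (hc i j) (hd i j), fun i j l => ?_⟩
    have h := congrArg₂ (· + ·) (hc' i j l) (hd' i j l)
    simp only [add_zero] at h
    rw [← h]
    simp only [Pi.add_apply]
    ring
  smul_mem' := by
    rintro a c ⟨hc, hc'⟩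
    refine ⟨fun i j => Submodule.smul_mem _ a (hc i j), fun i j l => ?_⟩
    simp only [Pi.smul_apply]
    rw [← smul_sub, ← smul_add, hc', smul_zero]

/-- Čech 1-coboundaries of `⨁ₜ 𝓘(t)` for the standard affine cover. -/
def coboundaries (I : Ideal (CoordRing k)) : Submodule (CoordRing k) (Fin 4 → Fin 4 → Frac k) where
  carrier := {c | ∃ b : Fin 4 → Frac k, (∀ i, b i ∈ idealAway I (X i)) ∧
    ∀ i j, c i j = b j - b i}
  zero_mem' := ⟨0, fun _ => Submodule.zero_mem _, fun _ _ => by simp⟩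
  add_mem' := by
    rintro c d ⟨b, hb, hc⟩ ⟨b', hb', hd⟩
    refine ⟨b + b', fun i => Submodule.add_mem _ (hb i) (hb' i), fun i j => ?_⟩
    simp only [Pi.add_apply, hc, hd]
    ring
  smul_mem' := by
    rintro a c ⟨b, hb, hc⟩
    refine ⟨a • b, fun i => Submodule.smul_mem _ a (hb i), fun i j => ?_⟩
    simp only [Pi.smul_apply, hc, smul_sub]

theorem coboundaries_le_cocycles (I : Ideal (CoordRing k)) : coboundaries I ≤ cocycles I := by
  rintro c ⟨b, hb, hc⟩
  refine ⟨fun i j => ?_, fun i j l => ?_⟩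
  · rw [hc]
    refine Submodule.sub_mem _ ?_ (idealAway_le_mul I _ _ (hb i))
    rw [mul_comm]
    exact idealAway_le_mul I _ _ (hb j)
  · rw [hc, hc, hc]
    ring

/-- The Hartshorne–Rao module `M(C) = ⨁ₜ H¹(ℙ³, 𝓘_C(t))` of the subscheme `C` with homogeneous
ideal `I`: the first Čech cohomology of `⨁ₜ 𝓘_C(t)` for the standard affine cover. -/
abbrev HRModule (I : Ideal (CoordRing k)) : Type _ :=
  cocycles I ⧸ (coboundaries I).submoduleOf (cocycles I)

/-- Elements of the function field that are homogeneous of degree `t`, i.e. quotients `p / q` of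
homogeneous polynomials with `deg p - deg q = t`. -/
def fracDegree (k : Type*) [Field k] (t : ℤ) : Submodule k (Frac k) where
  carrier := {f | ∃ (p q : CoordRing k) (a b : ℕ), p.IsHomogeneous a ∧ q.IsHomogeneous b ∧ q ≠ 0 ∧
    f = algebraMap (CoordRing k) (Frac k) p / algebraMap (CoordRing k) (Frac k) q ∧ (a : ℤ) - b = t}
  zero_mem' := by
    refine ⟨0, X 0 ^ (-t).toNat, t.toNat, (-t).toNat, isHomogeneous_zero _ _ _, ?_,
      pow_ne_zero _ (X_ne_zero _), by simp, by omega⟩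
    simpa using (isHomogeneous_X k (0 : Fin 4)).pow (-t).toNat
  add_mem' := by
    rintro f₁ f₂ ⟨p₁, q₁, a₁, b₁, hp₁, hq₁, h₁, rfl, e₁⟩ ⟨p₂, q₂, a₂, b₂, hp₂, hq₂, h₂, rfl, e₂⟩
    refine ⟨p₁ * q₂ + q₁ * p₂, q₁ * q₂, a₁ + b₂, b₁ + b₂, (hp₁.mul hq₂).add ?_, hq₁.mul hq₂,
      mul_ne_zero h₁ h₂, ?_, by push_cast; omega⟩
    · have h : a₁ + b₂ = b₁ + a₂ := by omega
      rw [h]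
      exact hq₁.mul hp₂
    · have i₁ : algebraMap (CoordRing k) (Frac k) q₁ ≠ 0 := by simpa using h₁
      have i₂ : algebraMap (CoordRing k) (Frac k) q₂ ≠ 0 := by simpa using h₂
      rw [div_add_div _ _ i₁ i₂, map_add, map_mul, map_mul, map_mul]
  smul_mem' := by
    rintro c f ⟨p, q, a, b, hp, hq, h, rfl, e⟩
    refine ⟨C c * p, q, a, b, ?_, hq, h, ?_, e⟩
    · simpa using (isHomogeneous_C (Fin 4) c).mul hp
    · rw [map_mul, mul_div_assoc, ← Algebra.smul_def, ← algebraMap_eq, algebraMap_smul]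

/-- The Čech 1-cocycles all of whose entries are homogeneous of degree `t`. -/
def cocyclesDegree (I : Ideal (CoordRing k)) (t : ℤ) : Submodule k (cocycles I) where
  carrier := {c | ∀ i j, c.1 i j ∈ fracDegree k t}
  zero_mem' := fun _ _ => Submodule.zero_mem _
  add_mem' := fun hc hd i j => Submodule.add_mem _ (hc i j) (hd i j)
  smul_mem' := fun a _ hc i j => Submodule.smul_mem _ a (hc i j)

/-- The degree `t` part `H¹(ℙ³, 𝓘_C(t))` of the Hartshorne–Rao module. -/
def HRDegree (I : Ideal (CoordRing k)) (t : ℤ) : Submodule k (HRModule I) :=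
  (cocyclesDegree I t).map
    (((coboundaries I).submoduleOf (cocycles I)).mkQ.restrictScalars k)

/-- `M(C) ≅ M(C')(d)` as graded modules, for the subschemes `C`, `C'` with homogeneous ideals
`I`, `I'`. Here `N(d)` is the shifted module with `N(d)ₜ = N_{t + d}`. -/
def HRShiftIso (I I' : Ideal (CoordRing k)) (d : ℤ) : Prop :=
  ∃ e : HRModule I ≃ₗ[CoordRing k] HRModule I', ∀ (t : ℤ) (m : HRModule I),
    m ∈ HRDegree I t ↔ e m ∈ HRDegree I' (t + d)

end HartshorneRao

section CohenMacaulay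

/-- A (Noetherian) local ring is Cohen–Macaulay if its maximal ideal contains a regular sequence
whose length is the Krull dimension of the ring. -/
def IsCMLocalRing (A : Type*) [CommRing A] [IsLocalRing A] : Prop :=
  ∃ rs : List A, (∀ r ∈ rs, r ∈ IsLocalRing.maximalIdeal A) ∧
    RingTheory.Sequence.IsRegular A rs ∧ (rs.length : WithBot ℕ∞) = ringKrullDim A

/-- A (Noetherian) ring is Cohen–Macaulay if its localizations at all maximal ideals are. -/
def IsCMRing (A : Type*) [CommRing A] : Prop :=
  ∀ (P : Ideal A) [P.IsMaximal], IsCMLocalRing (Localization.AtPrime P)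

/-- The subscheme with saturated homogeneous ideal `I` is arithmetically Cohen–Macaulay. -/
def IsACM {k : Type*} [Field k] (I : Ideal (CoordRing k)) : Prop := IsCMRing (CoordRing k ⧸ I)

end CohenMacaulay

section Liaison

variable {k : Type*} [Field k]

attribute [local instance] MvPolynomial.gradedAlgebra

/-- The subschemes with homogeneous ideals `I` and `I'` are (directly) linked by a complete
intersection of codimension two, with ideal `(f, g)`: this means `(f, g) ⊆ I ∩ I'`,
`(f, g) : I = I'` and `(f, g) : I' = I`. -/
def IsLinked (I I' : Ideal (CoordRing k)) : Prop :=
  I.IsHomogeneous (homogeneousSubmodule (Fin 4) k) ∧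
  I'.IsHomogeneous (homogeneousSubmodule (Fin 4) k) ∧
  ∃ (f g : CoordRing k) (a b : ℕ), f.IsHomogeneous a ∧ g.IsHomogeneous b ∧
    RingTheory.Sequence.IsRegular (CoordRing k) [f, g] ∧
    Ideal.span {f, g} ≤ I ⊓ I' ∧
    (Ideal.span {f, g}).colon (I : Set (CoordRing k)) = I' ∧
    (Ideal.span {f, g}).colon (I' : Set (CoordRing k)) = I

/-- Membership in the same even liaison class: the two subschemes are connected by a chain of an
even number of direct links. -/
def IsEvenlyLinked (I I' : Ideal (CoordRing k)) : Prop :=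
  Relation.ReflTransGen (Relation.Comp IsLinked IsLinked) I I'

end Liaison

end ArrCurve

end

/-! Along a line `ℓ i = ℓ j = 0` of the arrangement `L` is a unit, so the Jacobian ideals of `F` and
`L F` agree there; along a line `L = ℓ i = 0` the plane `ℓ i = 0` is the only one of `F`, and the
Jacobian ideal of `L F` is locally `(L, ℓ i)`. Hence both curve ideals satisfy
`I(L F) = I(F) ∩ (L, F) = L I(F) + (F)`, the last step because `F ∈ I(F)`: this is a basic double
link. If `G` is the derivative of `F` in a general direction, then `(F, G)` links `C_F` to a
residual curve, which `(F, G L)` links to `C_{L F}`.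

Multiplication by `L` induces `M(C_F)(-1) ≅ M(C_{L F})` because `H¹` and `H²` of `𝒪(t)` vanish; the
Čech complex of `R` is contracted by projections onto Laurent monomials. Cohen–Macaulayness is
compared along `0 → (R / I(F))(-1) → R / I(L F) → R / (L, F) → 0`, depth two meaning that a section
over the punctured spectrum extends uniquely. -/

namespace ArrCurve

open MvPolynomial

section LinearForms

variable {σ k : Type*} [Field k]

theorem sum_coeff_smul_X_eq [Fintype σ] {p : MvPolynomial σ k} (hp : p.IsHomogeneous 1) :
    ∑ i, coeff (Finsupp.single i 1) p • X i = p := by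
  classical
  have hspan : p ∈ homogeneousSubmodule σ k 1 := hp
  rw [homogeneousSubmodule_one_eq_span_X, Submodule.mem_span_range_iff_exists_fun] at hspan
  obtain ⟨c, rfl⟩ := hspan
  refine Finset.sum_congr rfl fun i _ => ?_
  congr 1
  simp [coeff_sum, coeff_X, Finsupp.single_left_inj]

theorem homogeneousComponent_one_mul {f a : MvPolynomial σ k} (ha : a.IsHomogeneous 1) :
    homogeneousComponent 1 (f * a) = C (coeff 0 f) * a := by
  classical
  ext d
  rw [coeff_homogeneousComponent, coeff_C_mul]
  split_ifs with hd
  · obtain ⟨i, rfl⟩ := (Finsupp.sum_eq_one_iff d).1 hd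
    rw [coeff_mul, Finsupp.antidiagonal_single]
    simp [Finset.Nat.antidiagonal_succ, ha.coeff_eq_zero (d := 0) (by simp)]
  · rw [ha.coeff_eq_zero hd, mul_zero]

theorem exists_eq_of_mem_span_pair {a b l : MvPolynomial σ k} (ha : a.IsHomogeneous 1)
    (hb : b.IsHomogeneous 1) (hl : l.IsHomogeneous 1) (h : l ∈ Ideal.span {a, b}) :
    ∃ α β : k, C α * a + C β * b = l := by
  obtain ⟨f, g, rfl⟩ := Ideal.mem_span_pair.1 h
  refine ⟨coeff 0 f, coeff 0 g, ?_⟩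
  rw [← homogeneousComponent_one_mul ha, ← homogeneousComponent_one_mul hb, ← map_add,
    homogeneousComponent_of_mem hl, if_pos rfl]

theorem prime_of_isHomogeneous_one {a : MvPolynomial σ k} (ha : a.IsHomogeneous 1) (ha₀ : a ≠ 0) :
    Prime a := by
  refine (irreducible_of_totalDegree_eq_one (ha.totalDegree ha₀) fun x hx => ?_).prime
  obtain ⟨d, hd⟩ := ne_zero_iff.1 ha₀
  obtain ⟨y, hy⟩ := hx d
  exact isUnit_iff_ne_zero.2 fun hx₀ => hd (by rw [hy, hx₀, zero_mul])

theorem linearIndependent_pair_iff_not_dvd {a b : MvPolynomial σ k} (ha : a.IsHomogeneous 1)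
    (hb : b.IsHomogeneous 1) (ha₀ : a ≠ 0) : LinearIndependent k ![a, b] ↔ ¬ a ∣ b := by
  rw [LinearIndependent.pair_iff' ha₀, ← not_iff_not, not_forall_not, not_not]
  refine ⟨?_, fun h => ?_⟩
  · rintro ⟨α, rfl⟩
    exact ⟨C α, by rw [smul_eq_C_mul, mul_comm]⟩
  · have hmem : b ∈ Ideal.span {a, a} := by simpa using Ideal.mem_span_singleton.2 h
    obtain ⟨α, β, rfl⟩ := exists_eq_of_mem_span_pair ha ha hb hmem
    exact ⟨α + β, by rw [smul_eq_C_mul, C_add, add_mul]⟩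

theorem ker_killCompl {τ : Type*} {f : τ → σ} (hf : Function.Injective f) :
    RingHom.ker (killCompl hf : MvPolynomial σ k →ₐ[k] MvPolynomial τ k) =
      Ideal.span (X '' (Set.range f)ᶜ) := by
  classical
  set I : Ideal (MvPolynomial σ k) := Ideal.span (X '' (Set.range f)ᶜ)
  refine le_antisymm (fun p hp => ?_) (Ideal.span_le.2 ?_)
  · have hmk : (Ideal.Quotient.mkₐ k I).comp ((rename f).comp (killCompl hf)) =
        Ideal.Quotient.mkₐ k I := by
      refine algHom_ext fun i => ?_
      by_cases hi : i ∈ Set.range f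
      · obtain ⟨j, rfl⟩ := hi
        have hj := killCompl_rename_app hf (X j : MvPolynomial τ k)
        rw [rename_X] at hj
        simp [hj]
      · have hX : (X i : MvPolynomial σ k) ∈ I := Ideal.subset_span ⟨i, hi, rfl⟩
        have hX₀ : killCompl hf (X i : MvPolynomial σ k) = 0 := by
          rw [killCompl, aeval_X, dif_neg hi]
        simp [hX₀, Ideal.Quotient.eq_zero_iff_mem.2 hX]
    have hp' := AlgHom.congr_fun hmk p
    rw [RingHom.mem_ker] at hp
    exact Ideal.Quotient.eq_zero_iff_mem.1 (by simpa [hp] using hp'.symm)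
  · rintro _ ⟨i, hi, rfl⟩
    have hi' : ¬ ∃ j, f j = i := hi
    simp [killCompl, hi']

theorem exists_algEquiv_apply_X [Fintype σ] {κ : Type*} (b : Module.Basis κ k (σ → k)) :
    ∃ e : MvPolynomial κ k ≃ₐ[k] MvPolynomial σ k, ∀ i, e (X i) = ∑ j, b i j • X j := by
  classical
  refine ⟨(SymmetricAlgebra.equivMvPolynomial b).symm.trans
    (SymmetricAlgebra.equivMvPolynomial (Pi.basisFun k σ)), fun i => ?_⟩
  rw [AlgEquiv.trans_apply, SymmetricAlgebra.equivMvPolynomial_symm_X]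
  conv_lhs => rw [← (Pi.basisFun k σ).sum_repr (b i)]
  simp only [map_sum, map_smul, SymmetricAlgebra.equivMvPolynomial_ι_apply, Pi.basisFun_repr]

theorem exists_algEquiv_X_inl_eq [Finite σ] {ι : Type*} [Finite ι] {l : ι → MvPolynomial σ k}
    (hl : ∀ i, (l i).IsHomogeneous 1) (hind : LinearIndependent k l) :
    ∃ (n : ℕ) (e : MvPolynomial (ι ⊕ Fin n) k ≃ₐ[k] MvPolynomial σ k),
      Nat.card σ = Nat.card ι + n ∧ ∀ i, e (X (Sum.inl i)) = l i := by
  cases nonempty_fintype σ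
  have hcoeff : LinearIndependent k fun i (j : σ) => coeff (Finsupp.single j 1) (l i) := by
    refine LinearIndependent.of_comp (Fintype.linearCombination k (X : σ → MvPolynomial σ k)) ?_
    convert hind using 1
    exact funext fun i => sum_coeff_smul_X_eq (hl i)
  let b := Module.Basis.sumExtend hcoeff
  have : Finite (ι ⊕ Module.Basis.sumExtendIndex hcoeff) := Module.Finite.finite_basis b
  have : Finite (Module.Basis.sumExtendIndex hcoeff) := Finite.sum_right ι
  obtain ⟨n, ⟨f⟩⟩ := Finite.exists_equiv_fin (Module.Basis.sumExtendIndex hcoeff)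
  let b' := b.reindex ((Equiv.refl ι).sumCongr f)
  obtain ⟨e, he⟩ := exists_algEquiv_apply_X b'
  refine ⟨n, e, ?_, fun i => ?_⟩
  · rw [← Module.finrank_eq_nat_card_basis (Pi.basisFun k σ),
      Module.finrank_eq_nat_card_basis b', Nat.card_sum, Nat.card_fin]
  · have hb : b' (Sum.inl i) = fun j => coeff (Finsupp.single j 1) (l i) := by
      simp [b', b, Module.Basis.sumExtend]
      rfl
    rw [he, hb, sum_coeff_smul_X_eq (hl i)]

theorem exists_surjective_ker_eq_span_range [Finite σ] {ι : Type*} [Finite ι]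
    {l : ι → MvPolynomial σ k} (hl : ∀ i, (l i).IsHomogeneous 1) (hind : LinearIndependent k l) :
    ∃ (n : ℕ) (ψ : MvPolynomial σ k →ₐ[k] MvPolynomial (Fin n) k),
      Nat.card σ = Nat.card ι + n ∧ Function.Surjective ψ ∧
      RingHom.ker ψ = Ideal.span (Set.range l) := by
  obtain ⟨n, e, hn, he⟩ := exists_algEquiv_X_inl_eq hl hind
  have hinr : Function.Injective (Sum.inr : Fin n → ι ⊕ Fin n) := Sum.inr_injective
  refine ⟨n, (killCompl hinr).comp e.symm, hn, ?_, ?_⟩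
  · exact (Function.LeftInverse.surjective (killCompl_rename_app hinr)).comp e.symm.surjective
  · have hspan : (Ideal.span (X '' (Set.range (Sum.inr : Fin n → ι ⊕ Fin n))ᶜ)).map e =
        Ideal.span (Set.range l) := by
      rw [Set.compl_range_inr, ← Set.range_comp, Ideal.map_span, ← Set.range_comp]
      exact congrArg (Ideal.span <| Set.range ·) (funext he)
    ext p
    rw [← hspan, ← ker_killCompl hinr, Ideal.mem_map_of_equiv]
    exact ⟨fun hp => ⟨e.symm p, hp, e.apply_symm_apply p⟩, fun ⟨q, hq, hqp⟩ => by
      rw [← hqp]; simpa [RingHom.mem_ker] using hq⟩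

theorem isPrime_span_range [Finite σ] {ι : Type*} [Finite ι]
    {l : ι → MvPolynomial σ k} (hl : ∀ i, (l i).IsHomogeneous 1) (hind : LinearIndependent k l) :
    (Ideal.span (Set.range l)).IsPrime := by
  obtain ⟨_, ψ, -, -, hker⟩ := exists_surjective_ker_eq_span_range hl hind
  rw [← hker]
  exact RingHom.ker_isPrime _

variable {a b : MvPolynomial σ k}

theorem isPrime_span_pair [Finite σ] (ha : a.IsHomogeneous 1) (hb : b.IsHomogeneous 1)
    (hab : LinearIndependent k ![a, b]) : (Ideal.span {a, b}).IsPrime := by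
  simpa only [Matrix.range_cons_cons_empty] using
    isPrime_span_range (by simp [ha, hb]) hab

theorem height_span_pair [Finite σ] (ha : a.IsHomogeneous 1) (hb : b.IsHomogeneous 1)
    (hab : LinearIndependent k ![a, b]) : (Ideal.span {a, b}).height = 2 := by
  have hprime := isPrime_span_pair ha hb hab
  have ha₀ : a ≠ 0 := hab.ne_zero 0
  refine le_antisymm ?_ ?_
  · calc (Ideal.span {a, b}).height ≤ ((Ideal.span {a, b}).spanFinrank : ℕ∞) :=
        Ideal.height_le_spanFinrank _ hprime.ne_top
      _ ≤ ({a, b} : Set (MvPolynomial σ k)).ncard := by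
        exact_mod_cast Submodule.spanFinrank_span_le_ncard_of_finite (Set.toFinite {a, b})
      _ ≤ 2 := by
        exact_mod_cast (Set.ncard_insert_le a {b}).trans (by rw [Set.ncard_singleton])
  · have : (Ideal.span {a}).IsPrime :=
      (Ideal.span_singleton_prime ha₀).2 (prime_of_isHomogeneous_one ha ha₀)
    have hbot : (⊥ : Ideal (MvPolynomial σ k)) < Ideal.span {a} := by
      simpa [bot_lt_iff_ne_bot] using ha₀
    have hlt : Ideal.span {a} < Ideal.span {a, b} := by
      refine lt_of_le_not_ge (Ideal.span_mono (by simp)) fun hle => ?_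
      exact (linearIndependent_pair_iff_not_dvd ha hb ha₀).1 hab
        (Ideal.mem_span_singleton.1 (hle (Ideal.subset_span (by simp))))
    calc (2 : ℕ∞) ≤ (⊥ : Ideal (MvPolynomial σ k)).height + 1 + 1 := by
          rw [Ideal.height_bot]; norm_num
      _ ≤ (Ideal.span {a}).height + 1 := by
          gcongr; exact Ideal.height_add_one_le_of_lt_of_isPrime hbot
      _ ≤ _ := Ideal.height_add_one_le_of_lt_of_isPrime hlt

end LinearForms

section UniqueExtension

open RingTheory.Sequence

variable {R : Type*} [CommRing R] {M M₁ M₂ M₃ : Type*} [AddCommGroup M] [Module R M]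
  [AddCommGroup M₁] [Module R M₁] [AddCommGroup M₂] [Module R M₂] [AddCommGroup M₃] [Module R M₃]

/-- The linear map sending `u : M` to multiplication by `u` on the ideal `𝔞`. -/
def homothety (𝔞 : Ideal R) (M : Type*) [AddCommGroup M] [Module R M] : M →ₗ[R] 𝔞 →ₗ[R] M :=
  ((LinearMap.lsmul R M).comp 𝔞.subtype).flip

theorem homothety_apply {𝔞 : Ideal R} (u : M) (a : 𝔞) : homothety 𝔞 M u a = (a : R) • u := rfl

/-- Every linear map `𝔞 → M` is multiplication by a unique element of `M`, that is,
`Hom(R/𝔞, M) = Ext¹(R/𝔞, M) = 0`: the cohomological form of "`𝔞` has grade at least two on `M`". -/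
def HasUniqueExtension (𝔞 : Ideal R) (M : Type*) [AddCommGroup M] [Module R M] : Prop :=
  Function.Bijective (homothety 𝔞 M)

theorem exists_comp_eq_of_range_le {f : M₁ →ₗ[R] M₂} {h : M₃ →ₗ[R] M₂}
    (hf : Function.Injective f) (hle : LinearMap.range h ≤ LinearMap.range f) :
    ∃ h' : M₃ →ₗ[R] M₁, f ∘ₗ h' = h := by
  refine ⟨(LinearEquiv.ofInjective f hf).symm.toLinearMap ∘ₗ
    h.codRestrict _ fun c => hle ⟨c, rfl⟩, LinearMap.ext fun c => ?_⟩
  exact congrArg Subtype.val ((LinearEquiv.ofInjective f hf).apply_symm_apply ⟨h c, hle ⟨c, rfl⟩⟩)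

theorem exact_compRight {f : M₁ →ₗ[R] M₂} {g : M₂ →ₗ[R] M₃} (hf : Function.Injective f)
    (hfg : Function.Exact f g) :
    Function.Exact (f.compRight R : (M →ₗ[R] M₁) →ₗ[R] M →ₗ[R] M₂) (g.compRight R) := by
  refine fun h => ⟨fun hgh => ?_, ?_⟩
  · refine exists_comp_eq_of_range_le hf ?_
    rintro _ ⟨c, rfl⟩
    exact (hfg _).1 (LinearMap.congr_fun hgh c)
  · rintro ⟨h, rfl⟩
    exact LinearMap.ext fun c => hfg.apply_apply_eq_zero (h c)

theorem compRight_homothety {𝔞 : Ideal R} (f : M₁ →ₗ[R] M₂) (u : M₁) :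
    f.compRight R (homothety 𝔞 M₁ u) = homothety 𝔞 M₂ (f u) :=
  LinearMap.ext fun a => map_smul f (a : R) u

theorem hasUniqueExtension_iff_of_exact {𝔞 : Ideal R} {f : M₁ →ₗ[R] M₂} {g : M₂ →ₗ[R] M₃}
    (hf : Function.Injective f) (hg : Function.Surjective g) (hfg : Function.Exact f g)
    (h₃ : HasUniqueExtension 𝔞 M₃) :
    HasUniqueExtension 𝔞 M₁ ↔ HasUniqueExtension 𝔞 M₂ := by
  have hf' : Function.Injective (f.compRight R : (𝔞 →ₗ[R] M₁) →ₗ[R] 𝔞 →ₗ[R] M₂) :=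
    fun φ ψ h => LinearMap.ext fun a => hf (LinearMap.congr_fun h a)
  have hfg' := exact_compRight (M := 𝔞) hf hfg
  refine ⟨fun h₁ => ⟨?_, fun φ => ?_⟩, fun h₂ =>
    LinearMap.bijective_of_bijective_of_injective_of_left_exact f g _ _ _ _ _
      (LinearMap.ext (compRight_homothety f)) (LinearMap.ext (compRight_homothety g))
      hfg hfg' h₂ h₃.1 hf hf'⟩
  · refine (injective_iff_map_eq_zero _).2 fun u hu => ?_
    obtain ⟨v, rfl⟩ := (hfg u).1 (h₃.1 (by rw [← compRight_homothety, hu, map_zero, map_zero]))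
    rw [← compRight_homothety] at hu
    rw [(map_eq_zero_iff _ h₁.1).1 ((map_eq_zero_iff _ hf').1 hu), map_zero]
  · obtain ⟨w, hw⟩ := h₃.2 (g.compRight R φ)
    obtain ⟨u, rfl⟩ := hg w
    obtain ⟨ψ, hψ⟩ := (hfg' (φ - homothety 𝔞 M₂ u)).1 (by
      rw [map_sub, compRight_homothety, hw, sub_self])
    obtain ⟨v, rfl⟩ := h₁.2 ψ
    exact ⟨f v + u, by rw [map_add, ← compRight_homothety, hψ, sub_add_cancel]⟩

theorem injective_homothety_iff {𝔞 : Ideal R} :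
    Function.Injective (homothety 𝔞 M) ↔ ∀ u : M, (∀ a ∈ 𝔞, a • u = 0) → u = 0 := by
  simp only [injective_iff_map_eq_zero, LinearMap.ext_iff, homothety_apply, Subtype.forall,
    LinearMap.zero_apply]

theorem smul_eq_homothety_apply {𝔞 : Ideal R} (φ : 𝔞 →ₗ[R] M) (b : 𝔞) :
    (b : R) • φ = homothety 𝔞 M (φ b) := by
  ext a
  rw [LinearMap.smul_apply, homothety_apply, ← map_smul, ← map_smul]
  exact congrArg φ (Subtype.ext (mul_comm _ _))

theorem hasUniqueExtension_of_sup_annihilator_eq_top {𝔞 : Ideal R}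
    (h : 𝔞 ⊔ Module.annihilator R M = ⊤) : HasUniqueExtension 𝔞 M := by
  obtain ⟨b, hb, c, hc, hbc⟩ := Submodule.mem_sup.1 ((Ideal.eq_top_iff_one _).1 h)
  have hone (u : M) : b • u = u := by
    conv_rhs => rw [← one_smul R u, ← hbc, add_smul, Module.mem_annihilator.1 hc u, add_zero]
  refine ⟨injective_homothety_iff.2 fun u hu => by rw [← hone u, hu b hb], fun φ => ?_⟩
  refine ⟨φ ⟨b, hb⟩, ?_⟩
  rw [← smul_eq_homothety_apply]
  exact LinearMap.ext fun a => hone (φ a)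

theorem hasUniqueExtension_iff_of_isSMulRegular {𝔞 : Ideal R} {x : R} (hx : x ∈ 𝔞)
    (hreg : IsSMulRegular M x) :
    HasUniqueExtension 𝔞 M ↔ ∀ v : M, (∀ a ∈ 𝔞, ∃ w : M, x • w = a • v) → ∃ u, x • u = v := by
  refine ⟨fun h v hv => ?_, fun h => ⟨injective_homothety_iff.2 fun u hu => ?_, fun φ => ?_⟩⟩
  · obtain ⟨φ, hφ⟩ := exists_comp_eq_of_range_le (f := LinearMap.lsmul R M x)
      (h := homothety 𝔞 M v) hreg (by rintro _ ⟨a, rfl⟩; exact hv a a.2)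
    obtain ⟨u, rfl⟩ := h.2 φ
    refine ⟨u, h.1 ?_⟩
    rw [map_smul, ← hφ]
    rfl
  · exact hreg.right_eq_zero_of_smul (hu x hx)
  · obtain ⟨u, hu⟩ := h (φ ⟨x, hx⟩) fun a ha =>
      ⟨φ ⟨a, ha⟩, LinearMap.congr_fun (smul_eq_homothety_apply φ ⟨x, hx⟩) ⟨a, ha⟩⟩
    refine ⟨u, LinearMap.ext fun a => hreg ?_⟩
    change x • (a : R) • u = x • φ a
    rw [smul_comm, hu]
    exact (LinearMap.congr_fun (smul_eq_homothety_apply φ ⟨x, hx⟩) a).symm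

theorem injective_homothety_iff_exists_isSMulRegular [IsNoetherianRing R] [Module.Finite R M]
    {𝔞 : Ideal R} : Function.Injective (homothety 𝔞 M) ↔ ∃ x ∈ 𝔞, IsSMulRegular M x := by
  rw [← Ideal.annihilator_quotient (I := 𝔞), ← IsSMulRegular.subsingleton_linearMap_iff,
    injective_homothety_iff, Ideal.annihilator_quotient]
  refine ⟨fun h => ⟨fun φ ψ => ?_⟩, fun h u hu => ?_⟩
  · have hφψ : (φ - ψ) (Submodule.Quotient.mk 1) = 0 := h _ fun a ha => by
      rw [← map_smul, ← Submodule.Quotient.mk_smul, smul_eq_mul, mul_one,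
        (Submodule.Quotient.mk_eq_zero 𝔞).2 ha, map_zero]
    refine sub_eq_zero.1 (Submodule.linearMap_qext _ (LinearMap.ext_ring ?_))
    simpa using hφψ
  · have hzero := LinearMap.congr_fun (h.elim
      (Submodule.liftQ 𝔞 (LinearMap.toSpanSingleton R M u) fun a ha => by simpa using hu a ha) 0)
      (Submodule.Quotient.mk 1)
    rwa [Submodule.liftQ_apply, LinearMap.toSpanSingleton_apply, one_smul] at hzero

theorem hasUniqueExtension_of_isWeaklyRegular {𝔞 : Ideal R} {x y : R} (hx : x ∈ 𝔞) (hy : y ∈ 𝔞)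
    (h : IsWeaklyRegular M [x, y]) : HasUniqueExtension 𝔞 M := by
  rw [isWeaklyRegular_cons_iff, isWeaklyRegular_singleton_iff,
    isSMulRegular_quotient_iff_mem_of_smul_mem] at h
  refine (hasUniqueExtension_iff_of_isSMulRegular hx h.1).2 fun v hv => ?_
  simp only [Submodule.mem_smul_pointwise_iff_exists, Submodule.mem_top, true_and] at h
  exact h.2 v (hv y hy)

theorem hasUniqueExtension_iff_exists_isWeaklyRegular [IsNoetherianRing R] [Module.Finite R M]
    {𝔞 : Ideal R} :
    HasUniqueExtension 𝔞 M ↔ ∃ x ∈ 𝔞, ∃ y ∈ 𝔞, IsWeaklyRegular M [x, y] := by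
  refine ⟨fun h => ?_, fun ⟨x, hx, y, hy, hxy⟩ => hasUniqueExtension_of_isWeaklyRegular hx hy hxy⟩
  obtain ⟨x, hx, hreg⟩ := injective_homothety_iff_exists_isSMulRegular.1 h.1
  have hinj : Function.Injective (homothety 𝔞 (QuotSMulTop x M)) := by
    refine injective_homothety_iff.2 fun u hu => ?_
    obtain ⟨v, rfl⟩ := Submodule.Quotient.mk_surjective _ u
    simp only [← Submodule.Quotient.mk_smul, Submodule.Quotient.mk_eq_zero,
      Submodule.mem_smul_pointwise_iff_exists, Submodule.mem_top, true_and] at hu ⊢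
    exact (hasUniqueExtension_iff_of_isSMulRegular hx hreg).1 h v hu
  obtain ⟨y, hy, hreg'⟩ := injective_homothety_iff_exists_isSMulRegular.1 hinj
  refine ⟨x, hx, y, hy, ?_⟩
  rw [isWeaklyRegular_cons_iff, isWeaklyRegular_singleton_iff]
  exact ⟨hreg, hreg'⟩

theorem HasUniqueExtension.of_map {S : Type*} [CommRing S] [Algebra R S] [Module S M]
    [IsScalarTower R S M] {𝔞 : Ideal R} {x : R} (hx : x ∈ 𝔞) (hreg : IsSMulRegular M x)
    (h : HasUniqueExtension (𝔞.map (algebraMap R S)) M) : HasUniqueExtension 𝔞 M := by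
  refine (hasUniqueExtension_iff_of_isSMulRegular hx hreg).2 fun v hv => ?_
  have hreg' : IsSMulRegular M (algebraMap R S x) := by
    rwa [isSMulRegular_algebraMap_iff]
  have := (hasUniqueExtension_iff_of_isSMulRegular (Ideal.mem_map_of_mem _ hx) hreg').1 h v
  simp only [algebraMap_smul] at this
  refine this fun a ha => ?_
  induction ha using Submodule.span_induction with
  | mem a ha =>
    obtain ⟨a, ha, rfl⟩ := ha
    simpa using hv a ha
  | zero => exact ⟨0, by simp⟩
  | add a b _ _ ha hb =>
    obtain ⟨w, hw⟩ := ha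
    obtain ⟨w', hw'⟩ := hb
    exact ⟨w + w', by rw [smul_add, add_smul, hw, hw']⟩
  | smul c a _ ha =>
    obtain ⟨w, hw⟩ := ha
    exact ⟨c • w, by rw [smul_comm, hw, smul_assoc]⟩

theorem hasUniqueExtension_comap_iff {S : Type*} [CommRing S] [Algebra R S] [Module S M]
    [IsScalarTower R S M] [IsNoetherianRing R] [Module.Finite R M]
    (hRS : Function.Surjective (algebraMap R S)) {P : Ideal S} :
    HasUniqueExtension (P.comap (algebraMap R S)) M ↔ HasUniqueExtension P M := by
  have : IsNoetherianRing S := isNoetherianRing_of_surjective R S _ hRS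
  have : Module.Finite S M := Module.Finite.of_restrictScalars_finite R S M
  have hpair (x y : R) : IsWeaklyRegular M [algebraMap R S x, algebraMap R S y] ↔
      IsWeaklyRegular M [x, y] := isWeaklyRegular_map_algebraMap_iff S M [x, y]
  simp only [hasUniqueExtension_iff_exists_isWeaklyRegular, hRS.exists, hpair, Ideal.mem_comap]

/-- The kernel and the cokernel of the homothety map are killed by `𝔪`, so they vanish as soon as
their localizations at `𝔪` do. -/
theorem HasUniqueExtension.of_isLocalizedModule {𝔪 : Ideal R} [h𝔪 : 𝔪.IsMaximal] (hfg : 𝔪.FG)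
    (f : M₁ →ₗ[R] M₂) [IsLocalizedModule 𝔪.primeCompl f] (h : HasUniqueExtension 𝔪 M₂) :
    HasUniqueExtension 𝔪 M₁ := by
  have eq_top {J : Ideal R} {s : R} (hJ : 𝔪 ≤ J) (hs : s ∈ 𝔪.primeCompl) (hsJ : s ∈ J) : J = ⊤ :=
    h𝔪.out.2 J (lt_of_le_of_ne hJ fun heq => hs (heq ▸ hsJ))
  refine ⟨injective_homothety_iff.2 fun u hu => ?_, fun φ => ?_⟩
  · have hfu : f u = f 0 := by
      rw [map_zero]
      exact injective_homothety_iff.1 h.1 _ fun a ha => by rw [← map_smul, hu a ha, map_zero]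
    obtain ⟨s, hs⟩ := IsLocalizedModule.exists_of_eq (S := 𝔪.primeCompl) hfu
    have htop := eq_top (J := LinearMap.ker (LinearMap.toSpanSingleton R M₁ u)) hu s.2
      (by simpa [Submonoid.smul_def] using hs)
    simpa using (Ideal.eq_top_iff_one _).1 htop
  · have : Module.Finite R 𝔪 := Module.Finite.iff_fg.2 hfg
    obtain ⟨w, hw⟩ := h.2 (f ∘ₗ φ)
    obtain ⟨⟨u, s⟩, hsu⟩ := IsLocalizedModule.surj 𝔪.primeCompl f w
    have hcomp : f ∘ₗ ((s : R) • φ) = f ∘ₗ homothety 𝔪 M₁ u := by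
      rw [LinearMap.comp_smul, ← hw, ← map_smul]
      ext a
      change (a : R) • s • w = f ((a : R) • u)
      rw [hsu, map_smul]
    obtain ⟨t, ht⟩ :=
      Module.Finite.exists_smul_of_comp_eq_of_isLocalizedModule 𝔪.primeCompl f _ _ hcomp
    have htop := eq_top (J := (LinearMap.range (homothety 𝔪 M₁)).comap
        (LinearMap.toSpanSingleton R _ φ)) (s := t * s)
      (fun b hb => ⟨φ ⟨b, hb⟩, (smul_eq_homothety_apply φ ⟨b, hb⟩).symm⟩)
      (mul_mem t.2 s.2) ⟨(t : R) • u, by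
        rw [map_smul, LinearMap.toSpanSingleton_apply, mul_smul]; exact ht.symm⟩
    simpa using (Ideal.eq_top_iff_one _).1 htop

theorem isCMRing_iff_hasUniqueExtension [IsNoetherianRing R]
    (hdim : ∀ (P : Ideal R) [P.IsMaximal], ringKrullDim (Localization.AtPrime P) = 2) :
    IsCMRing R ↔ ∀ (P : Ideal R), P.IsMaximal → HasUniqueExtension P R := by
  refine forall_congr' fun P => forall_congr' fun hP =>
    ⟨fun ⟨rs, hrs, hreg, hlen⟩ => ?_, fun h => ?_⟩
  · rw [hdim P] at hlen
    obtain ⟨x, y, rfl⟩ := List.length_eq_two.1 (by exact_mod_cast hlen)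
    have hS : HasUniqueExtension (P.map (algebraMap R (Localization.AtPrime P)))
        (Localization.AtPrime P) := by
      rw [Localization.AtPrime.map_eq_maximalIdeal]
      exact hasUniqueExtension_of_isWeaklyRegular (hrs x (by simp)) (hrs y (by simp))
        hreg.toIsWeaklyRegular
    obtain ⟨a, s, rfl⟩ := IsLocalization.exists_mk'_eq P.primeCompl x
    have ha : a ∈ P := (IsLocalization.AtPrime.mk'_mem_maximal_iff _ P a s).1 (hrs _ (by simp))
    have hareg : IsSMulRegular (Localization.AtPrime P) a := by
      have hx : IsSMulRegular (Localization.AtPrime P) (IsLocalization.mk' _ a s) :=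
        ((isWeaklyRegular_cons_iff _ _ _).1 hreg.toIsWeaklyRegular).1
      rw [← isSMulRegular_algebraMap_iff (A := Localization.AtPrime P),
        ← IsLocalization.mk'_spec' _ a s]
      exact (IsLocalization.map_units _ s).isSMulRegular _ |>.mul hx
    exact (hS.of_map ha hareg).of_isLocalizedModule (IsNoetherian.noetherian P)
      (Algebra.linearMap R (Localization.AtPrime P))
  · obtain ⟨x, hx, y, hy, hreg⟩ := hasUniqueExtension_iff_exists_isWeaklyRegular.1 h
    have hP' : ∀ r ∈ [x, y], r ∈ P := by simp [hx, hy]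
    refine ⟨_, ?_, hreg.isRegular_of_isLocalization_of_mem (Localization.AtPrime P) P hP', ?_⟩
    · simpa only [List.forall_mem_map, IsLocalization.AtPrime.to_map_mem_maximal_iff _ P] using hP'
    · rw [hdim P]
      rfl

theorem forall_hasUniqueExtension_quotient_iff [IsNoetherianRing R] {I : Ideal R} :
    (∀ 𝔪 : Ideal R, 𝔪.IsMaximal → HasUniqueExtension 𝔪 (R ⧸ I)) ↔
      ∀ P : Ideal (R ⧸ I), P.IsMaximal → HasUniqueExtension P (R ⧸ I) := by
  have hmk : Function.Surjective (algebraMap R (R ⧸ I)) := Ideal.Quotient.mk_surjective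
  refine ⟨fun h P hP => (hasUniqueExtension_comap_iff hmk).1
    (h _ (Ideal.comap_isMaximal_of_surjective _ hmk)), fun h 𝔪 h𝔪 => ?_⟩
  by_cases hI : I ≤ 𝔪
  · have hcomap : (𝔪.map (algebraMap R (R ⧸ I))).comap (algebraMap R (R ⧸ I)) = 𝔪 := by
      rw [Ideal.comap_map_of_surjective' _ hmk, Ideal.Quotient.algebraMap_eq, Ideal.mk_ker,
        sup_eq_left.2 hI]
    have := h _ ((Ideal.map_eq_top_or_isMaximal_of_surjective _ hmk h𝔪).resolve_left fun htop =>
      h𝔪.ne_top (by rw [← hcomap, htop, Ideal.comap_top]))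
    rwa [← hasUniqueExtension_comap_iff hmk, hcomap] at this
  · refine hasUniqueExtension_of_sup_annihilator_eq_top ?_
    rw [Ideal.annihilator_quotient]
    exact h𝔪.out.2 _ (lt_of_le_not_ge le_sup_left fun hle => hI (le_sup_right.trans hle))

end UniqueExtension

section Dimension

variable {k : Type*} [Field k]

theorem hasUniqueExtension_of_one_lt_height {A : Type*} [CommRing A] [IsDomain A]
    [IsNoetherianRing A] [UniqueFactorizationMonoid A] {p : Ideal A} [hp : p.IsPrime]
    (h : 1 < p.height) : HasUniqueExtension p A := by
  have hp₀ : p ≠ ⊥ := by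
    rintro rfl
    simp at h
  obtain ⟨x, hx, hxprime⟩ := hp.exists_mem_prime_of_ne_bot hp₀
  have hspan := (Ideal.span_singleton_prime hxprime.ne_zero).2 hxprime
  obtain ⟨y, hy, hyx⟩ : ∃ y ∈ p, y ∉ Ideal.span {x} := by
    refine Set.not_subset.1 fun hle => h.not_ge ((Ideal.height_mono hle).trans ?_)
    refine Ideal.height_le_one_of_isPrincipal_of_mem_minimalPrimes (Ideal.span {x}) _ ?_
    rw [Ideal.minimalPrimes_eq_subsingleton_self]
    rfl
  refine hasUniqueExtension_of_isWeaklyRegular hx hy ?_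
  rw [RingTheory.Sequence.isWeaklyRegular_cons_iff,
    RingTheory.Sequence.isWeaklyRegular_singleton_iff,
    isSMulRegular_quotient_iff_mem_of_smul_mem]
  refine ⟨(IsRegular.of_ne_zero hxprime.ne_zero).left.isSMulRegular, fun z hz => ?_⟩
  simp only [Submodule.mem_smul_pointwise_iff_exists, Submodule.mem_top, true_and, smul_eq_mul,
    eq_comm (a := x * _)] at hz ⊢
  exact (hxprime.dvd_or_dvd hz).resolve_left fun hd => hyx (Ideal.mem_span_singleton.2 hd)

theorem height_eq_of_isMaximal (n : ℕ) (P : Ideal (MvPolynomial (Fin n) k)) [hP : P.IsMaximal] :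
    P.height = n := by
  induction n with
  | zero =>
    have hle := P.height_le_ringKrullDim_of_isPrime
    rw [ringKrullDim_of_isNoetherianRing, ringKrullDim_eq_zero_of_field, zero_add,
      Nat.card_fin] at hle
    exact le_antisymm (WithBot.coe_le_coe.1 hle) zero_le
  | succ n ih =>
    set e := (finSuccEquiv k n).toRingEquiv
    set Q := P.comap e.symm
    have hQ : Q.IsMaximal := Ideal.comap_isMaximal_of_surjective _ e.symm.surjective
    have hcomap := Polynomial.isMaximal_comap_C_of_isJacobsonRing Q
    have : Q.LiesOver (Q.comap Polynomial.C) := ⟨rfl⟩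
    calc P.height = Q.height := (e.symm.height_comap P).symm
      _ = (Q.comap Polynomial.C).height + 1 := Polynomial.height_eq_height_add_one _ _
      _ = _ := by rw [ih]; push_cast; rfl

theorem height_ker_add_height_le_height_comap {A B : Type*} [CommRing A] [CommRing B]
    [IsNoetherianRing B] {f : A →+* B} (hf : Function.Surjective f) (P : Ideal B) [hP : P.IsPrime] :
    (RingHom.ker f).height + P.height ≤ (P.comap f).height := by
  obtain ⟨n, hn⟩ := ENat.ne_top_iff_exists.1 (P.height_ne_top hP.ne_top)
  rw [← hn]
  replace hn := hn.le
  induction n generalizing P with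
  | zero => simpa using Ideal.height_mono (Ideal.ker_le_comap f)
  | succ n ih =>
    have hlt : ¬ P.height ≤ n := fun h => by
      have := hn.trans h
      norm_cast at this
      omega
    simp only [Ideal.height_le_iff, not_forall, not_lt] at hlt
    obtain ⟨Q, hQ, hQP, hnQ⟩ := hlt
    have hcomap : Q.comap f < P.comap f :=
      (Ideal.orderEmbeddingOfSurjective f hf).strictMono hQP
    calc _ = (RingHom.ker f).height + n + 1 := by push_cast; ring
      _ ≤ (Q.comap f).height + 1 := by gcongr; exact ih Q hnQ
      _ ≤ _ := Ideal.height_add_one_le_of_lt_of_isPrime hcomap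

theorem two_le_height_map_quotientMk {n : ℕ} (hn : 4 ≤ n) {a b : MvPolynomial (Fin n) k}
    {𝔪 : Ideal (MvPolynomial (Fin n) k)} [h𝔪 : 𝔪.IsMaximal] (hle : Ideal.span {a, b} ≤ 𝔪) :
    2 ≤ (𝔪.map (Ideal.Quotient.mk (Ideal.span {a, b}))).height := by
  have hrank : (Ideal.span {a, b}).spanFinrank ≤ 2 :=
    (Submodule.spanFinrank_span_le_ncard_of_finite (Set.toFinite _)).trans
      ((Set.ncard_insert_le _ _).trans (by rw [Set.ncard_singleton]))
  have hheight := Ideal.height_le_height_add_spanFinrank_of_le hle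
  rw [height_eq_of_isMaximal] at hheight
  refine (ENat.add_le_add_iff_right (by decide : (2 : ℕ∞) ≠ ⊤)).1 ?_
  calc (2 + 2 : ℕ∞) ≤ n := by exact_mod_cast hn
    _ ≤ _ := hheight
    _ ≤ _ := by gcongr; exact_mod_cast hrank

theorem hasUniqueExtension_quotient_span_pair {n : ℕ} (hn : 4 ≤ n) {a b : MvPolynomial (Fin n) k}
    (ha : a.IsHomogeneous 1) (hb : b.IsHomogeneous 1) (hab : LinearIndependent k ![a, b])
    {𝔪 : Ideal (MvPolynomial (Fin n) k)} (h𝔪 : 𝔪.IsMaximal) :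
    HasUniqueExtension 𝔪 (MvPolynomial (Fin n) k ⧸ Ideal.span {a, b}) := by
  revert 𝔪
  rw [forall_hasUniqueExtension_quotient_iff]
  intro P hP
  have := isPrime_span_pair ha hb hab
  have : UniqueFactorizationMonoid (MvPolynomial (Fin n) k ⧸ Ideal.span {a, b}) := by
    obtain ⟨d, ψ, -, hψ, hker⟩ :=
      exists_surjective_ker_eq_span_range (l := ![a, b]) (by simp [ha, hb]) hab
    rw [Matrix.range_cons_cons_empty] at hker
    exact ((Ideal.quotEquivOfEq hker.symm).trans
      (RingHom.quotientKerEquivOfSurjective hψ)).symm.toMulEquiv.uniqueFactorizationMonoid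
      inferInstance
  have hmk := Ideal.Quotient.mk_surjective (I := Ideal.span {a, b})
  have hmax := Ideal.comap_isMaximal_of_surjective (K := P) _ hmk
  refine hasUniqueExtension_of_one_lt_height (lt_of_lt_of_le (by norm_num : (1 : ℕ∞) < 2) ?_)
  rw [← Ideal.map_comap_of_surjective _ hmk P]
  exact two_le_height_map_quotientMk hn (by
    conv_lhs => rw [← Ideal.mk_ker (I := Ideal.span {a, b})]
    exact Ideal.ker_le_comap _)

/-- The ideal `I` defines a union of lines in projective 3-space: its minimal primes are generated
by two independent linear forms. Embedded components are allowed. -/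
def IsLineArrangementIdeal (I : Ideal (CoordRing k)) : Prop :=
  ∀ p ∈ I.minimalPrimes, ∃ a b : CoordRing k, a.IsHomogeneous 1 ∧ b.IsHomogeneous 1 ∧
    LinearIndependent k ![a, b] ∧ p = Ideal.span {a, b}

theorem IsLineArrangementIdeal.two_le_height {I : Ideal (CoordRing k)}
    (hI : IsLineArrangementIdeal I) : 2 ≤ I.height := by
  rw [Ideal.height_eq_inf_minimalPrimes]
  refine le_iInf₂ fun p hp => ?_
  obtain ⟨a, b, ha, hb, hab, rfl⟩ := hI p hp
  exact (height_span_pair ha hb hab).ge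

theorem IsLineArrangementIdeal.height_eq_two {I : Ideal (CoordRing k)}
    (hI : IsLineArrangementIdeal I) (P : Ideal (CoordRing k ⧸ I)) [hP : P.IsMaximal] :
    P.height = 2 := by
  have hmk := Ideal.Quotient.mk_surjective (I := I)
  have hmax := Ideal.comap_isMaximal_of_surjective (K := P) _ hmk
  have hIP : I ≤ P.comap (Ideal.Quotient.mk I) := by
    conv_lhs => rw [← Ideal.mk_ker (I := I)]
    exact Ideal.ker_le_comap _
  refine le_antisymm ?_ ?_
  · have hadd : 2 + P.height ≤ 4 := calc
      2 + P.height ≤ (RingHom.ker (Ideal.Quotient.mk I)).height + P.height := by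
        rw [Ideal.mk_ker]
        gcongr
        exact hI.two_le_height
      _ ≤ _ := height_ker_add_height_le_height_comap hmk P
      _ = 4 := height_eq_of_isMaximal 4 _
    exact (ENat.add_le_add_iff_left (by decide : (2 : ℕ∞) ≠ ⊤)).1 hadd
  · obtain ⟨p, hp, hpP⟩ := Ideal.exists_minimalPrimes_le hIP
    obtain ⟨a, b, -, -, -, rfl⟩ := hI p hp
    set f := Ideal.Quotient.factor hp.1.2
    have hf : Function.Surjective f := Ideal.Quotient.factor_surjective hp.1.2
    have hker : RingHom.ker f ≤ P := by
      rw [Ideal.Quotient.factor_ker, Ideal.map_le_iff_le_comap]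
      exact hpP
    have := Ideal.map_isPrime_of_surjective hf hker
    calc 2 ≤ ((P.comap (Ideal.Quotient.mk I)).map (Ideal.Quotient.mk (Ideal.span {a, b}))).height :=
        two_le_height_map_quotientMk le_rfl hpP
      _ = (P.map f).height := by
        rw [← Ideal.Quotient.factor_comp_mk hp.1.2, ← Ideal.map_map,
          Ideal.map_comap_of_surjective _ hmk]
      _ ≤ (RingHom.ker f).height + (P.map f).height := le_add_self
      _ ≤ ((P.map f).comap f).height := height_ker_add_height_le_height_comap hf _
      _ = P.height := by rw [Ideal.comap_map_of_surjective' _ hf, sup_eq_left.2 hker]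

theorem IsLineArrangementIdeal.isACM_iff {I : Ideal (CoordRing k)}
    (hI : IsLineArrangementIdeal I) :
    IsACM I ↔ ∀ 𝔪 : Ideal (CoordRing k), 𝔪.IsMaximal → HasUniqueExtension 𝔪 (CoordRing k ⧸ I) :=
  (isCMRing_iff_hasUniqueExtension fun P _ => by
    rw [IsLocalization.AtPrime.ringKrullDim_eq_height P (Localization.AtPrime P), hI.height_eq_two]
    rfl).trans forall_hasUniqueExtension_quotient_iff.symm

end Dimension

section TopDimPart

variable {R : Type*} [CommRing R] {J q : Ideal R} {t : Finset (Ideal R)}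

theorem inf_erase_not_le_radical [DecidableEq (Ideal R)]
    (ht : Submodule.IsMinimalPrimaryDecomposition J t) (hq : q ∈ t)
    (hmin : q.radical ∈ J.minimalPrimes) : ¬ (t.erase q).inf id ≤ q.radical := by
  intro hle
  obtain ⟨q', hq', hle'⟩ := hmin.1.1.inf_le'.1 hle
  obtain ⟨hne, hq't⟩ := Finset.mem_erase.1 hq'
  have hJ : J ≤ q'.radical := (ht.inf_eq ▸ Finset.inf_le hq't : J ≤ q').trans Ideal.le_radical
  have hrad : q'.radical ≤ q.radical := hmin.1.1.radical_le_iff.2 hle'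
  have heq : q'.radical = q.radical :=
    hrad.antisymm (hmin.2 ⟨Ideal.isPrime_radical (ht.primary hq't), hJ⟩ hrad)
  exact ht.distinct hq't hq hne (by simpa using heq)

theorem mem_iff_exists_notMem_radical_mul_mem (ht : Submodule.IsMinimalPrimaryDecomposition J t)
    (hq : q ∈ t) (hmin : q.radical ∈ J.minimalPrimes) (f : R) :
    f ∈ q ↔ ∃ s ∉ q.radical, s * f ∈ J := by
  classical
  constructor
  · intro hf
    obtain ⟨s, hs, hs'⟩ := SetLike.not_le_iff_exists.1 (inf_erase_not_le_radical ht hq hmin)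
    refine ⟨s, hs', ?_⟩
    rw [← ht.inf_eq, ← Finset.insert_erase hq, Finset.inf_insert]
    exact ⟨q.mul_mem_left s hf, Ideal.mul_mem_right f _ hs⟩
  · rintro ⟨s, hs, hsf⟩
    have hfs : f * s ∈ q := mul_comm s f ▸ (ht.inf_eq ▸ Finset.inf_le hq : J ≤ q) hsf
    exact ((Ideal.isPrimary_iff.1 (ht.primary hq)).2 hfs).resolve_right hs

variable {k : Type*} [Field k]

theorem mem_topDimPart_iff {J : Ideal (CoordRing k)} (hJ : 2 ≤ J.height) (f : CoordRing k) :
    f ∈ topDimPart J ↔ ∀ P : Ideal (CoordRing k), P.IsPrime → J ≤ P → P.height = 2 →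
      ∃ s ∉ P, s * f ∈ J := by
  have hmin : ∀ P : Ideal (CoordRing k), P.IsPrime → J ≤ P → P.height = 2 →
      P ∈ J.minimalPrimes := by
    intro P hP hJP hP2
    obtain ⟨p, hp, hpP⟩ := Ideal.exists_minimalPrimes_le hJP
    have := hp.1.1
    rwa [← Ideal.eq_of_le_of_height_le _ hpP (hP2.le.trans (hJ.trans (Ideal.height_mono hp.1.2)))]
  rw [topDimPart, Submodule.mem_sInf]
  constructor
  · intro h P hP hJP hP2
    obtain ⟨t, ht⟩ := Submodule.IsLasker.exists_isMinimalPrimaryDecomposition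
      (Submodule.isLasker (CoordRing k) (CoordRing k)) J
    obtain ⟨q, hq, rfl⟩ :=
      Ideal.IsMinimalPrimaryDecomposition.minimalPrimes_subset_image_radical ht (hmin P hP hJP hP2)
    exact (mem_iff_exists_notMem_radical_mul_mem ht hq (hmin _ hP hJP hP2) f).1
      (h q ⟨t, ht, hq, hP2⟩)
  · rintro h (q : Ideal (CoordRing k)) ⟨t, ht, hq, hq2⟩
    have hprime : q.radical.IsPrime := Ideal.isPrime_radical (ht.primary hq)
    have hle : J ≤ q.radical :=
      (ht.inf_eq ▸ Finset.inf_le hq : J ≤ q).trans Ideal.le_radical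
    exact (mem_iff_exists_notMem_radical_mul_mem ht hq (hmin _ hprime hle hq2) f).2
      (h _ hprime hle hq2)

end TopDimPart

section Saturation

variable {k : Type*} [Field k] {I p : Ideal (CoordRing k)}

theorem le_saturation (I : Ideal (CoordRing k)) : I ≤ saturation I :=
  fun _ hf => ⟨0, fun g _ => I.mul_mem_left g hf⟩

theorem exists_notMem_mul_mem_of_mem_saturation [hp : p.IsPrime] (hp' : ¬ irrelevantIdeal k ≤ p)
    {f : CoordRing k} (hf : f ∈ saturation I) : ∃ s ∉ p, s * f ∈ I := by
  obtain ⟨n, hn⟩ := hf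
  obtain ⟨s, hs, hsp⟩ := SetLike.not_le_iff_exists.1 (mt hp.le_of_pow_le hp' : ¬ _ ^ n ≤ p)
  exact ⟨s, hsp, hn s hs⟩

theorem ker_constantCoeff_le_irrelevantIdeal :
    RingHom.ker (constantCoeff : CoordRing k →+* k) ≤ irrelevantIdeal k := by
  intro f hf
  have hmem : f ∈ idealOfVars (Fin 4) k ^ 1 :=
    (mem_pow_idealOfVars_iff' _ f).2 fun d hd => by
      rw [(Finsupp.degree_eq_zero_iff d).1 (Nat.lt_one_iff.1 hd)]
      exact hf
  rwa [pow_one] at hmem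

theorem not_irrelevantIdeal_le (hp : p.height < 4) : ¬ irrelevantIdeal k ≤ p := by
  have : (RingHom.ker (constantCoeff : CoordRing k →+* k)).IsMaximal :=
    RingHom.ker_isMaximal_of_surjective _ fun c => ⟨C c, constantCoeff_C _ c⟩
  intro hle
  refine hp.not_ge ?_
  rw [← Nat.cast_ofNat,
    ← height_eq_of_isMaximal 4 (RingHom.ker (constantCoeff : CoordRing k →+* k))]
  exact Ideal.height_mono (ker_constantCoeff_le_irrelevantIdeal.trans hle)

end Saturation

section DirectionalDerivative

variable {σ k : Type*} [Field k]

/-- The derivative in the direction of the vector `v`. -/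
noncomputable def dirDeriv (v : σ → k) : Derivation k (MvPolynomial σ k) (MvPolynomial σ k) :=
  mkDerivation k fun i => C (v i)

theorem dirDeriv_eq_sum [Fintype σ] (v : σ → k) (F : MvPolynomial σ k) :
    dirDeriv v F = ∑ i, C (v i) * pderiv i F := by
  classical
  induction F using MvPolynomial.induction_on with
  | C c => simp
  | add p q hp hq => simp only [map_add, hp, hq, mul_add, Finset.sum_add_distrib]
  | mul_X p j hp =>
    have hX : ∑ i, C (v i) * pderiv i (X j : MvPolynomial σ k) = C (v j) := by
      simp [pderiv_X, Pi.single_apply]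
    calc dirDeriv v (p * X j) = p * C (v j) + X j * dirDeriv v p := by
          rw [Derivation.leibniz, smul_eq_mul, smul_eq_mul, dirDeriv, mkDerivation_X]
      _ = ∑ i, C (v i) * pderiv i (p * X j) := by
          simp only [hp, ← hX, Finset.mul_sum, ← Finset.sum_add_distrib, Derivation.leibniz,
            smul_eq_mul]
          exact Finset.sum_congr rfl fun i _ => by ring

theorem dirDeriv_of_isHomogeneous_one [Finite σ] (v : σ → k) {a : MvPolynomial σ k}
    (ha : a.IsHomogeneous 1) : dirDeriv v a = C (eval v a) := by
  cases nonempty_fintype σ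
  rw [← sum_coeff_smul_X_eq ha]
  simp [dirDeriv, smul_eq_C_mul]

theorem eval_of_isHomogeneous_one [Fintype σ] {a : MvPolynomial σ k} (ha : a.IsHomogeneous 1)
    (v : σ → k) : eval v a = ∑ i, coeff (Finsupp.single i 1) a * v i := by
  conv_lhs => rw [← sum_coeff_smul_X_eq ha]
  simp [smul_eq_C_mul]

theorem exists_eval_eq_zero_of_not_dvd [Finite σ] {a b : MvPolynomial σ k}
    (ha : a.IsHomogeneous 1) (hb : b.IsHomogeneous 1) (hab : ¬ a ∣ b) :
    ∃ v : σ → k, eval v a = 0 ∧ eval v b ≠ 0 := by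
  classical
  cases nonempty_fintype σ
  set α : σ → k := fun i => coeff (Finsupp.single i 1) a
  set β : σ → k := fun i => coeff (Finsupp.single i 1) b
  have hsum : ∑ i, α i • X i = a ∧ ∑ i, β i • X i = b :=
    ⟨sum_coeff_smul_X_eq ha, sum_coeff_smul_X_eq hb⟩
  by_contra! h
  have heval : ∀ v : σ → k, ∑ i, α i * v i = 0 → ∑ i, β i * v i = 0 := fun v => by
    rw [← eval_of_isHomogeneous_one ha, ← eval_of_isHomogeneous_one hb]
    exact h v
  refine hab ?_
  by_cases hα : α = 0
  · have hβ : β = 0 := funext fun i => by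
      simpa [Pi.single_apply] using heval (Pi.single i 1) (by simp [hα])
    exact ⟨0, by rw [mul_zero, ← hsum.2, hβ]; simp⟩
  · obtain ⟨i, hi⟩ : ∃ i, α i ≠ 0 := Function.ne_iff.1 hα
    have hprop : ∀ j, β j = β i / α i * α j := fun j => by
      have hij := heval (α i • Pi.single j 1 - α j • Pi.single i 1)
      simp only [Pi.sub_apply, Pi.smul_apply, smul_eq_mul, mul_sub, Finset.sum_sub_distrib,
        Pi.single_apply, mul_ite, mul_one, mul_zero, Finset.sum_ite_eq', Finset.mem_univ,
        if_true] at hij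
      rw [div_mul_eq_mul_div, eq_div_iff hi]
      linear_combination hij (by ring)
    refine ⟨C (β i / α i), ?_⟩
    rw [← hsum.1, ← hsum.2, mul_comm, ← smul_eq_C_mul, Finset.smul_sum]
    exact Finset.sum_congr rfl fun j _ => by rw [hprop, smul_smul]

end DirectionalDerivative

section Jacobian

variable {k : Type*} [Field k] {F L : CoordRing k}

theorem jacobianIdeal_le_iff {I : Ideal (CoordRing k)} :
    jacobianIdeal F ≤ I ↔ ∀ i, pderiv i F ∈ I := by
  rw [jacobianIdeal, Ideal.span_le, Set.range_subset_iff]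
  rfl

theorem pderiv_mem_jacobianIdeal (F : CoordRing k) (i : Fin 4) : pderiv i F ∈ jacobianIdeal F :=
  jacobianIdeal_le_iff.1 le_rfl i

theorem dirDeriv_mem_jacobianIdeal (v : Fin 4 → k) (F : CoordRing k) :
    dirDeriv v F ∈ jacobianIdeal F := by
  rw [dirDeriv_eq_sum]
  exact Ideal.sum_mem _ fun i _ => Ideal.mul_mem_left _ _ (pderiv_mem_jacobianIdeal F i)

theorem self_mem_jacobianIdeal [CharZero k] {n : ℕ} (hF : F.IsHomogeneous n) (hn : n ≠ 0) :
    F ∈ jacobianIdeal F := by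
  have hunit : IsUnit (n : CoordRing k) := by
    rw [← C_eq_coe_nat]
    exact (isUnit_iff_ne_zero.2 (Nat.cast_ne_zero.2 hn)).map C
  refine (Ideal.unit_mul_mem_iff_mem _ hunit).1 ?_
  rw [← nsmul_eq_mul, ← hF.sum_X_mul_pderiv]
  exact Ideal.sum_mem _ fun i _ => Ideal.mul_mem_left _ _ (pderiv_mem_jacobianIdeal F i)

theorem jacobianIdeal_mul_le (hF : F ∈ jacobianIdeal F) (L : CoordRing k) :
    jacobianIdeal (L * F) ≤ jacobianIdeal F := by
  rw [jacobianIdeal_le_iff]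
  intro i
  rw [Derivation.leibniz, smul_eq_mul, smul_eq_mul]
  exact Ideal.add_mem _ (Ideal.mul_mem_left _ _ (pderiv_mem_jacobianIdeal F i))
    (Ideal.mul_mem_right _ _ hF)

theorem sq_mul_mem_jacobianIdeal (hF : L * F ∈ jacobianIdeal (L * F)) {f : CoordRing k}
    (hf : f ∈ jacobianIdeal F) : L ^ 2 * f ∈ jacobianIdeal (L * F) := by
  have hle : jacobianIdeal F ≤ (jacobianIdeal (L * F)).colon {L ^ 2} := by
    rw [jacobianIdeal_le_iff]
    intro i
    have hleibniz : pderiv i F * L ^ 2 = L * pderiv i (L * F) - pderiv i L * (L * F) := by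
      rw [Derivation.leibniz, smul_eq_mul, smul_eq_mul]
      ring
    rw [Submodule.mem_colon_singleton, smul_eq_mul, hleibniz]
    exact Ideal.sub_mem _ (Ideal.mul_mem_left _ _ (pderiv_mem_jacobianIdeal _ i))
      (Ideal.mul_mem_left _ _ hF)
  simpa only [smul_eq_mul, mul_comm f] using Submodule.mem_colon_singleton.1 (hle hf)

theorem mem_jacobianIdeal_mul_of_not_dvd {a b : CoordRing k} (ha : a.IsHomogeneous 1)
    (hb : b.IsHomogeneous 1) (hab : ¬ a ∣ b) : a ∈ jacobianIdeal (a * b) := by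
  obtain ⟨v, hva, hvb⟩ := exists_eval_eq_zero_of_not_dvd ha hb hab
  refine (Ideal.mul_unit_mem_iff_mem _ ((isUnit_iff_ne_zero.2 hvb).map C)).1 ?_
  simpa [dirDeriv_of_isHomogeneous_one, ha, hb, hva] using dirDeriv_mem_jacobianIdeal v (a * b)

theorem span_pair_le_jacobianIdeal {a b : CoordRing k} (ha : a.IsHomogeneous 1)
    (hb : b.IsHomogeneous 1) (hab : LinearIndependent k ![a, b]) :
    Ideal.span {a, b} ≤ jacobianIdeal (a * b) := by
  rw [Ideal.span_le, Set.pair_subset_iff]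
  refine ⟨mem_jacobianIdeal_mul_of_not_dvd ha hb
    ((linearIndependent_pair_iff_not_dvd ha hb (hab.ne_zero 0)).1 hab), ?_⟩
  rw [mul_comm]
  exact mem_jacobianIdeal_mul_of_not_dvd hb ha
    ((linearIndependent_pair_iff_not_dvd hb ha (hab.ne_zero 1)).1
      (LinearIndependent.pair_symm_iff.1 hab))

end Jacobian

section Arrangement

variable {k : Type*} [Field k] {ι : Type*}

/-- The planes `ℓ i = 0` are distinct: the `ℓ i` are nonzero and pairwise linearly independent
linear forms. -/
structure IsArrangement (ℓ : ι → CoordRing k) : Prop where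
  isHomogeneous : ∀ i, (ℓ i).IsHomogeneous 1
  ne_zero : ∀ i, ℓ i ≠ 0
  linearIndependent : Pairwise fun i j => LinearIndependent k ![ℓ i, ℓ j]

namespace IsArrangement

variable {ℓ : ι → CoordRing k} {i j : ι}

theorem isPrime_span (h : IsArrangement ℓ) (hij : i ≠ j) : (Ideal.span {ℓ i, ℓ j}).IsPrime :=
  isPrime_span_pair (h.isHomogeneous i) (h.isHomogeneous j) (h.linearIndependent hij)

theorem height_span (h : IsArrangement ℓ) (hij : i ≠ j) : (Ideal.span {ℓ i, ℓ j}).height = 2 :=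
  height_span_pair (h.isHomogeneous i) (h.isHomogeneous j) (h.linearIndependent hij)

theorem not_irrelevantIdeal_le_span (h : IsArrangement ℓ) (hij : i ≠ j) :
    ¬ irrelevantIdeal k ≤ Ideal.span {ℓ i, ℓ j} :=
  not_irrelevantIdeal_le (by rw [h.height_span hij]; norm_num)

theorem not_dvd (h : IsArrangement ℓ) (hij : i ≠ j) : ¬ ℓ i ∣ ℓ j :=
  (linearIndependent_pair_iff_not_dvd (h.isHomogeneous i) (h.isHomogeneous j) (h.ne_zero i)).1
    (h.linearIndependent hij)

variable [Fintype ι]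

theorem isHomogeneous_prod (h : IsArrangement ℓ) :
    (∏ i, ℓ i).IsHomogeneous (Fintype.card ι) := by
  simpa using IsHomogeneous.prod Finset.univ ℓ (fun _ => 1) fun i _ => h.isHomogeneous i

theorem prod_mem_jacobianIdeal [CharZero k] [Nonempty ι] (h : IsArrangement ℓ) :
    ∏ i, ℓ i ∈ jacobianIdeal (∏ i, ℓ i) :=
  self_mem_jacobianIdeal h.isHomogeneous_prod Fintype.card_ne_zero

end IsArrangement

variable [Fintype ι] {ℓ : ι → CoordRing k} {i j : ι}

theorem prod_eq_mul_mul_prod_erase_erase [DecidableEq ι] {M : Type*} [CommMonoid M] (ℓ : ι → M)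
    (hij : i ≠ j) :
    ∏ l, ℓ l = (∏ l ∈ (Finset.univ.erase i).erase j, ℓ l) * (ℓ i * ℓ j) := by
  rw [← Finset.mul_prod_erase Finset.univ ℓ (Finset.mem_univ i), ← Finset.mul_prod_erase _ ℓ
    (Finset.mem_erase.2 ⟨hij.symm, Finset.mem_univ j⟩), ← mul_assoc, mul_comm]

theorem jacobianIdeal_prod_le_span (hij : i ≠ j) :
    jacobianIdeal (∏ i, ℓ i) ≤ Ideal.span {ℓ i, ℓ j} := by
  classical
  have hi : ℓ i ∈ Ideal.span {ℓ i, ℓ j} := Ideal.subset_span (by simp)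
  have hj : ℓ j ∈ Ideal.span {ℓ i, ℓ j} := Ideal.subset_span (by simp)
  rw [jacobianIdeal_le_iff]
  intro q
  rw [prod_eq_mul_mul_prod_erase_erase ℓ hij, Derivation.leibniz, Derivation.leibniz]
  simp only [smul_eq_mul]
  exact Ideal.add_mem _ (Ideal.mul_mem_left _ _ (Ideal.add_mem _ (Ideal.mul_mem_right _ _ hi)
    (Ideal.mul_mem_right _ _ hj))) (Ideal.mul_mem_right _ _ (Ideal.mul_mem_right _ _ hi))

namespace IsArrangement

section

variable [CharZero k] [Nonempty ι]

theorem exists_span_le (h : IsArrangement ℓ) {p : Ideal (CoordRing k)} (hp : p.IsPrime)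
    (hle : jacobianIdeal (∏ i, ℓ i) ≤ p) : ∃ i j, i ≠ j ∧ Ideal.span {ℓ i, ℓ j} ≤ p := by
  classical
  obtain ⟨i, -, hi⟩ := hp.prod_mem_iff.1 (hle h.prod_mem_jacobianIdeal)
  obtain ⟨v, -, hv⟩ := exists_eval_eq_zero_of_not_dvd (isHomogeneous_zero _ _ _)
    (h.isHomogeneous i) (mt zero_dvd_iff.1 (h.ne_zero i))
  have hd := hle (dirDeriv_mem_jacobianIdeal v _)
  rw [← Finset.mul_prod_erase Finset.univ ℓ (Finset.mem_univ i), Derivation.leibniz,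
    dirDeriv_of_isHomogeneous_one v (h.isHomogeneous i), smul_eq_mul, smul_eq_mul,
    Ideal.add_mem_iff_right _ (Ideal.mul_mem_right _ _ hi),
    Ideal.mul_unit_mem_iff_mem _ ((isUnit_iff_ne_zero.2 hv).map C)] at hd
  obtain ⟨j, hj, hj'⟩ := hp.prod_mem_iff.1 hd
  exact ⟨i, j, (Finset.ne_of_mem_erase hj).symm, Ideal.span_le.2 (Set.pair_subset hi hj')⟩

theorem eq_span_of_height_le (h : IsArrangement ℓ) {p : Ideal (CoordRing k)} (hp : p.IsPrime)
    (hle : jacobianIdeal (∏ i, ℓ i) ≤ p) (hp2 : p.height ≤ 2) :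
    ∃ i j, i ≠ j ∧ p = Ideal.span {ℓ i, ℓ j} := by
  obtain ⟨i, j, hij, hle'⟩ := h.exists_span_le hp hle
  have := h.isPrime_span hij
  exact ⟨i, j, hij, (Ideal.eq_of_le_of_height_le _ hle' (by rwa [h.height_span hij])).symm⟩

theorem two_le_height_jacobianIdeal (h : IsArrangement ℓ) :
    2 ≤ (jacobianIdeal (∏ i, ℓ i)).height := by
  rw [Ideal.height_eq_inf_minimalPrimes]
  refine le_iInf₂ fun p hp => ?_
  obtain ⟨i, j, hij, hle⟩ := h.exists_span_le hp.1.1 hp.1.2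
  exact (h.height_span hij).ge.trans (Ideal.height_mono hle)

theorem mem_topDimPart_jacobianIdeal_iff (h : IsArrangement ℓ) (f : CoordRing k) :
    f ∈ topDimPart (jacobianIdeal (∏ i, ℓ i)) ↔
      Pairwise fun i j => ∃ s ∉ Ideal.span {ℓ i, ℓ j}, s * f ∈ jacobianIdeal (∏ i, ℓ i) := by
  rw [mem_topDimPart_iff h.two_le_height_jacobianIdeal]
  constructor
  · exact fun hf i j hij => hf _ (h.isPrime_span hij) (jacobianIdeal_prod_le_span hij)
      (h.height_span hij)
  · intro hf P hP hle hP2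
    obtain ⟨i, j, hij, rfl⟩ := h.eq_span_of_height_le hP hle hP2.le
    exact hf hij

theorem mem_topCurveIdeal_iff (h : IsArrangement ℓ) (f : CoordRing k) :
    f ∈ topCurveIdeal (∏ i, ℓ i) ↔
      Pairwise fun i j => ∃ s ∉ Ideal.span {ℓ i, ℓ j}, s * f ∈ jacobianIdeal (∏ i, ℓ i) := by
  refine ⟨fun hf i j hij => ?_, fun hf =>
    le_saturation _ ((h.mem_topDimPart_jacobianIdeal_iff f).2 hf)⟩
  have hprime := h.isPrime_span hij
  obtain ⟨s, hs, hsf⟩ :=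
    exists_notMem_mul_mem_of_mem_saturation (h.not_irrelevantIdeal_le_span hij) hf
  obtain ⟨t, ht, htsf⟩ := (h.mem_topDimPart_jacobianIdeal_iff _).1 hsf hij
  exact ⟨t * s, hprime.mul_notMem ht hs, by rwa [mul_assoc]⟩

theorem mem_redCurveIdeal_iff (h : IsArrangement ℓ) (f : CoordRing k) :
    f ∈ redCurveIdeal (∏ i, ℓ i) ↔ Pairwise fun i j => f ∈ Ideal.span {ℓ i, ℓ j} := by
  constructor
  · intro hf i j hij
    have hprime := h.isPrime_span hij
    obtain ⟨s, hs, hsf⟩ :=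
      exists_notMem_mul_mem_of_mem_saturation (h.not_irrelevantIdeal_le_span hij) hf
    exact (hprime.mem_or_mem
      (hprime.radical_le_iff.2 (jacobianIdeal_prod_le_span hij) hsf)).resolve_left hs
  · intro hf
    refine le_saturation _ ?_
    rw [Ideal.radical_eq_sInf, Submodule.mem_sInf]
    rintro p ⟨hle, hp⟩
    obtain ⟨i, j, hij, hle'⟩ := h.exists_span_le hp hle
    exact hle' (hf hij)

theorem exists_mul_mem_jacobianIdeal (h : IsArrangement ℓ) (hij : i ≠ j)
    (hij' : ∀ l, l ≠ i → l ≠ j → ℓ l ∉ Ideal.span {ℓ i, ℓ j}) :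
    ∃ s ∉ Ideal.span {ℓ i, ℓ j}, ∀ f ∈ Ideal.span {ℓ i, ℓ j},
      s * f ∈ jacobianIdeal (∏ i, ℓ i) := by
  classical
  have hprime := h.isPrime_span hij
  have hF := h.prod_mem_jacobianIdeal
  rw [prod_eq_mul_mul_prod_erase_erase ℓ hij] at hF ⊢
  refine ⟨(∏ l ∈ (Finset.univ.erase i).erase j, ℓ l) ^ 2, fun hs => ?_, fun f hf => ?_⟩
  · obtain ⟨l, hl, hl'⟩ := hprime.prod_mem_iff.1 (hprime.mem_of_pow_mem 2 hs)
    simp only [Finset.mem_erase, Finset.mem_univ, and_true] at hl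
    exact hij' l hl.2 hl.1 hl'
  · exact sq_mul_mem_jacobianIdeal hF (span_pair_le_jacobianIdeal (h.isHomogeneous i)
      (h.isHomogeneous j) (h.linearIndependent hij) hf)

theorem prod_mem_topCurveIdeal (h : IsArrangement ℓ) : ∏ i, ℓ i ∈ topCurveIdeal (∏ i, ℓ i) :=
  (h.mem_topCurveIdeal_iff _).2 fun _ _ hij => ⟨1, (h.isPrime_span hij).one_notMem, by
    rw [one_mul]
    exact h.prod_mem_jacobianIdeal⟩

theorem prod_mem_redCurveIdeal (h : IsArrangement ℓ) : ∏ i, ℓ i ∈ redCurveIdeal (∏ i, ℓ i) :=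
  (h.mem_redCurveIdeal_iff _).2 fun _ _ hij =>
    jacobianIdeal_prod_le_span hij h.prod_mem_jacobianIdeal

theorem notMem_span_of_forall_minimalPrimes (h : IsArrangement ℓ) {L : CoordRing k}
    (hL : ∀ p ∈ (redCurveIdeal (∏ i, ℓ i)).minimalPrimes, L ∉ p) :
    Pairwise fun i j => L ∉ Ideal.span {ℓ i, ℓ j} := by
  intro i j hij hmem
  have := h.isPrime_span hij
  obtain ⟨p, hp, hple⟩ := Ideal.exists_minimalPrimes_le
    (fun f hf => (h.mem_redCurveIdeal_iff f).1 hf hij :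
      redCurveIdeal (∏ i, ℓ i) ≤ Ideal.span {ℓ i, ℓ j})
  have hJ : jacobianIdeal (∏ i, ℓ i) ≤ redCurveIdeal (∏ i, ℓ i) :=
    Ideal.le_radical.trans (le_saturation _)
  have hprime := hp.1.1
  obtain ⟨i', j', hij', hle⟩ := h.exists_span_le hp.1.1 (hJ.trans hp.1.2)
  have heq : p = Ideal.span {ℓ i, ℓ j} := Ideal.eq_of_le_of_height_le _ hple <| by
    rw [h.height_span hij, ← h.height_span hij']
    exact Ideal.height_mono hle
  exact hL p hp (heq ▸ hmem)

end

end IsArrangement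

end Arrangement

section DoubleLink

theorem span_mul_add_span_eq_inf {R : Type*} [CommRing R] {I : Ideal R} {F L : R} (hF : F ∈ I)
    (hL : ∀ x, L * x ∈ I → x ∈ I) :
    Ideal.span {L} * I + Ideal.span {F} = I ⊓ Ideal.span {L, F} := by
  have hmul : Ideal.span {L} * I = Ideal.span {L} ⊓ I := by
    refine le_antisymm Ideal.mul_le_inf ?_
    rintro _ ⟨hx, hxI⟩
    obtain ⟨x, rfl⟩ := Ideal.mem_span_singleton.1 hx
    exact Ideal.mul_mem_mul (Ideal.mem_span_singleton_self L) (hL x hxI)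
  rw [Submodule.add_eq_sup, hmul, Ideal.span_insert, sup_comm, inf_comm _ I, inf_comm I,
    ← sup_inf_assoc_of_le _ ((Ideal.span_singleton_le_iff_mem _).2 hF), sup_comm, inf_comm]

theorem iInf_span_pair_eq_span_pair_prod {R ι : Type*} [CommRing R] {L : R} {ℓ : ι → R}
    (hprime : ∀ i, (Ideal.span {L, ℓ i}).IsPrime)
    (hℓ : Pairwise fun i j => ℓ j ∉ Ideal.span {L, ℓ i}) (s : Finset ι) :
    ⨅ i ∈ s, Ideal.span {L, ℓ i} = Ideal.span {L, ∏ i ∈ s, ℓ i} := by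
  classical
  induction s using Finset.induction_on with
  | empty =>
    rw [Finset.prod_empty, eq_comm, Ideal.eq_top_of_isUnit_mem _
      (Ideal.subset_span (by simp : (1 : R) ∈ ({L, 1} : Set R))) isUnit_one]
    simp
  | insert i s hi ih =>
    have hL : ∀ g : R, L ∈ Ideal.span {L, g} := fun g => Ideal.subset_span (by simp)
    rw [Finset.iInf_insert, ih, Finset.prod_insert hi]
    refine le_antisymm ?_ (le_inf ?_ ?_)
    · rintro _ ⟨hf, hf'⟩
      obtain ⟨a, b, rfl⟩ := Ideal.mem_span_pair.1 hf'
      have hb : b * ∏ j ∈ s, ℓ j ∈ Ideal.span {L, ℓ i} :=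
        (Ideal.add_mem_iff_right _ (Ideal.mul_mem_left _ a (hL _))).1 hf
      have hs : ∏ j ∈ s, ℓ j ∉ Ideal.span {L, ℓ i} := fun hmem => by
        obtain ⟨j, hj, hj'⟩ := (hprime i).prod_mem_iff.1 hmem
        exact hℓ (ne_of_mem_of_not_mem hj hi).symm hj'
      obtain ⟨c, d, rfl⟩ := Ideal.mem_span_pair.1 (((hprime i).mem_or_mem hb).resolve_right hs)
      exact Ideal.mem_span_pair.2 ⟨a + c * ∏ l ∈ s, ℓ l, d, by ring⟩
    all_goals
      refine Ideal.span_le.2 (Set.pair_subset (hL _) ?_)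
    · exact Ideal.mul_mem_right _ _ (Ideal.subset_span (by simp))
    · exact Ideal.mul_mem_left _ _ (Ideal.subset_span (by simp))

theorem pairwise_cons_iff {α : Type*} {r : α → α → Prop} (hr : ∀ x y, r x y → r y x) {n : ℕ}
    (a : α) (ℓ : Fin n → α) :
    (Pairwise fun i j => r ((Fin.cons a ℓ : Fin (n + 1) → α) i)
      ((Fin.cons a ℓ : Fin (n + 1) → α) j)) ↔
      (∀ i, r a (ℓ i)) ∧ Pairwise fun i j => r (ℓ i) (ℓ j) := by
  have : Std.Symm fun i j => r ((Fin.cons a ℓ : Fin (n + 1) → α) i)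
      ((Fin.cons a ℓ : Fin (n + 1) → α) j) := ⟨fun _ _ => hr _ _⟩
  exact pairwise_fin_succ_iff_of_isSymm

namespace IsArrangement

variable {k : Type*} [Field k] {n : ℕ} {ℓ : Fin n → CoordRing k} {L : CoordRing k}

theorem cons (h : IsArrangement ℓ) (hL : L.IsHomogeneous 1) (hL₀ : L ≠ 0)
    (hLℓ : ∀ i, LinearIndependent k ![L, ℓ i]) :
    IsArrangement (Fin.cons L ℓ : Fin (n + 1) → CoordRing k) where
  isHomogeneous := Fin.cons hL h.isHomogeneous
  ne_zero := Fin.cons hL₀ h.ne_zero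
  linearIndependent := pairwise_fin_succ_iff.2
    ⟨fun i => LinearIndependent.pair_symm_iff.1 (hLℓ i), hLℓ, h.linearIndependent⟩

theorem tail (h : IsArrangement (Fin.cons L ℓ : Fin (n + 1) → CoordRing k)) :
    IsArrangement ℓ where
  isHomogeneous i := h.isHomogeneous i.succ
  ne_zero i := h.ne_zero i.succ
  linearIndependent := (pairwise_fin_succ_iff.1 h.linearIndependent).2.2

theorem isHomogeneous_head (h : IsArrangement (Fin.cons L ℓ : Fin (n + 1) → CoordRing k)) :
    L.IsHomogeneous 1 :=
  h.isHomogeneous 0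

theorem isPrime_span_head (h : IsArrangement (Fin.cons L ℓ : Fin (n + 1) → CoordRing k))
    (i : Fin n) : (Ideal.span {L, ℓ i}).IsPrime :=
  h.isPrime_span (Fin.succ_ne_zero i).symm

theorem notMem_span_head (h : IsArrangement (Fin.cons L ℓ : Fin (n + 1) → CoordRing k))
    (hL : Pairwise fun i j => L ∉ Ideal.span {ℓ i, ℓ j}) :
    Pairwise fun i j => ℓ j ∉ Ideal.span {L, ℓ i} := by
  intro i j hij hmem
  obtain ⟨α, β, hαβ⟩ := exists_eq_of_mem_span_pair h.isHomogeneous_head (h.tail.isHomogeneous i)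
    (h.tail.isHomogeneous j) hmem
  have hα : α ≠ 0 := by
    rintro rfl
    exact h.tail.not_dvd hij ⟨C β, by rw [← hαβ, C_0]; ring⟩
  refine hL hij ((Ideal.unit_mul_mem_iff_mem _ ((isUnit_iff_ne_zero.2 hα).map C)).1 ?_)
  exact Ideal.mem_span_pair.2 ⟨-C β, 1, by rw [← hαβ]; ring⟩

section

variable [CharZero k] [NeZero n] (h : IsArrangement (Fin.cons L ℓ : Fin (n + 1) → CoordRing k))
  (hL : Pairwise fun i j => L ∉ Ideal.span {ℓ i, ℓ j})

include h hL

theorem mem_topCurveIdeal_of_mul_mem {x : CoordRing k}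
    (hx : L * x ∈ topCurveIdeal (∏ i, ℓ i)) : x ∈ topCurveIdeal (∏ i, ℓ i) := by
  rw [h.tail.mem_topCurveIdeal_iff] at hx ⊢
  intro i j hij
  obtain ⟨s, hs, hsx⟩ := hx hij
  exact ⟨s * L, (h.tail.isPrime_span hij).mul_notMem hs (hL hij), by rwa [mul_assoc]⟩

theorem mem_redCurveIdeal_of_mul_mem {x : CoordRing k}
    (hx : L * x ∈ redCurveIdeal (∏ i, ℓ i)) : x ∈ redCurveIdeal (∏ i, ℓ i) := by
  rw [h.tail.mem_redCurveIdeal_iff] at hx ⊢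
  exact fun i j hij => ((h.tail.isPrime_span hij).mem_or_mem (hx hij)).resolve_left (hL hij)

theorem exists_mul_mem_jacobianIdeal_mul_iff {i j : Fin n} (hij : i ≠ j) (f : CoordRing k) :
    (∃ s ∉ Ideal.span {ℓ i, ℓ j}, s * f ∈ jacobianIdeal (L * ∏ i, ℓ i)) ↔
      ∃ s ∉ Ideal.span {ℓ i, ℓ j}, s * f ∈ jacobianIdeal (∏ i, ℓ i) := by
  have hprime := h.tail.isPrime_span hij
  have hF := h.prod_mem_jacobianIdeal
  rw [Fin.prod_cons] at hF
  constructor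
  · rintro ⟨s, hs, hsf⟩
    exact ⟨s, hs, jacobianIdeal_mul_le h.tail.prod_mem_jacobianIdeal L hsf⟩
  · rintro ⟨s, hs, hsf⟩
    refine ⟨L ^ 2 * s, hprime.mul_notMem (mt (hprime.mem_of_pow_mem 2) (hL hij)) hs, ?_⟩
    rw [mul_assoc]
    exact sq_mul_mem_jacobianIdeal hF hsf

omit [NeZero n] in
theorem exists_mul_mem_jacobianIdeal_mul_head_iff (i : Fin n) (f : CoordRing k) :
    (∃ s ∉ Ideal.span {L, ℓ i}, s * f ∈ jacobianIdeal (L * ∏ i, ℓ i)) ↔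
      f ∈ Ideal.span {L, ℓ i} := by
  have hi : (0 : Fin (n + 1)) ≠ i.succ := (Fin.succ_ne_zero i).symm
  constructor
  · rintro ⟨s, hs, hsf⟩
    have hle := jacobianIdeal_prod_le_span (ℓ := (Fin.cons L ℓ : Fin (n + 1) → CoordRing k)) hi
    rw [Fin.prod_cons, Fin.cons_zero, Fin.cons_succ] at hle
    exact ((h.isPrime_span_head i).mem_or_mem (hle hsf)).resolve_left hs
  · intro hf
    have hother : ∀ l : Fin (n + 1), l ≠ 0 → l ≠ i.succ →
        (Fin.cons L ℓ : Fin (n + 1) → CoordRing k) l ∉ Ideal.span {L, ℓ i} :=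
      Fin.cases (fun h₀ => absurd rfl h₀) fun l _ hl =>
        h.notMem_span_head hL fun hil => hl (congrArg Fin.succ hil.symm)
    have hs := h.exists_mul_mem_jacobianIdeal hi hother
    rw [Fin.prod_cons, Fin.cons_zero, Fin.cons_succ] at hs
    obtain ⟨s, hs, hs'⟩ := hs
    exact ⟨s, hs, hs' f hf⟩

theorem topCurveIdeal_mul_eq_inf : topCurveIdeal (L * ∏ i, ℓ i) =
    topCurveIdeal (∏ i, ℓ i) ⊓ Ideal.span {L, ∏ i, ℓ i} := by
  ext f
  have hmem := h.mem_topCurveIdeal_iff f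
  rw [Fin.prod_cons] at hmem
  rw [hmem, pairwise_cons_iff (r := fun a b => ∃ s ∉ Ideal.span {a, b},
      s * f ∈ jacobianIdeal (L * ∏ i, ℓ i)) fun a b => by rw [Set.pair_comm]; exact id,
    Submodule.mem_inf, h.tail.mem_topCurveIdeal_iff,
    ← iInf_span_pair_eq_span_pair_prod h.isPrime_span_head (h.notMem_span_head hL), and_comm]
  simp only [Submodule.mem_iInf, Finset.mem_univ, true_imp_iff]
  exact and_congr
    (forall₃_congr fun i j hij => h.exists_mul_mem_jacobianIdeal_mul_iff hL hij f)
    (forall_congr' fun i => h.exists_mul_mem_jacobianIdeal_mul_head_iff hL i f)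

theorem redCurveIdeal_mul_eq_inf : redCurveIdeal (L * ∏ i, ℓ i) =
    redCurveIdeal (∏ i, ℓ i) ⊓ Ideal.span {L, ∏ i, ℓ i} := by
  ext f
  have hmem := h.mem_redCurveIdeal_iff f
  rw [Fin.prod_cons] at hmem
  rw [hmem, pairwise_cons_iff (r := fun a b => f ∈ Ideal.span {a, b})
      fun a b => by rw [Set.pair_comm]; exact id,
    Submodule.mem_inf, h.tail.mem_redCurveIdeal_iff,
    ← iInf_span_pair_eq_span_pair_prod h.isPrime_span_head (h.notMem_span_head hL), and_comm]
  simp only [Submodule.mem_iInf, Finset.mem_univ, true_imp_iff]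

theorem topCurveIdeal_mul : topCurveIdeal (L * ∏ i, ℓ i) =
    Ideal.span {L} * topCurveIdeal (∏ i, ℓ i) + Ideal.span {∏ i, ℓ i} := by
  rw [h.topCurveIdeal_mul_eq_inf hL, span_mul_add_span_eq_inf h.tail.prod_mem_topCurveIdeal
    fun _ => h.mem_topCurveIdeal_of_mul_mem hL]

theorem redCurveIdeal_mul : redCurveIdeal (L * ∏ i, ℓ i) =
    Ideal.span {L} * redCurveIdeal (∏ i, ℓ i) + Ideal.span {∏ i, ℓ i} := by
  rw [h.redCurveIdeal_mul_eq_inf hL, span_mul_add_span_eq_inf h.tail.prod_mem_redCurveIdeal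
    fun _ => h.mem_redCurveIdeal_of_mul_mem hL]

end

end IsArrangement

end DoubleLink

section CohenMacaulayDoubleLink

theorem hasUniqueExtension_quotient_iff_of_colon {R : Type*} [CommRing R] {𝔞 I I₀ : Ideal R} {c : R}
    (hc : ∀ x, c * x ∈ I ↔ x ∈ I₀) (h : HasUniqueExtension 𝔞 (R ⧸ (I ⊔ Ideal.span {c}))) :
    HasUniqueExtension 𝔞 (R ⧸ I₀) ↔ HasUniqueExtension 𝔞 (R ⧸ I) := by
  have hker : I₀ = LinearMap.ker (I.mkQ ∘ₗ LinearMap.mulLeft R c) := by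
    ext x
    rw [LinearMap.mem_ker, LinearMap.comp_apply, Submodule.mkQ_apply,
      Submodule.Quotient.mk_eq_zero, LinearMap.mulLeft_apply, hc]
  refine hasUniqueExtension_iff_of_exact (f := I₀.liftQ (I.mkQ ∘ₗ LinearMap.mulLeft R c) hker.le)
    (g := Submodule.factor le_sup_left) ?_ (Submodule.factor_surjective _) ?_ h
  · rw [← LinearMap.ker_eq_bot]
    exact Submodule.ker_liftQ_eq_bot' _ _ hker
  · rw [LinearMap.exact_iff, Submodule.range_liftQ, LinearMap.range_comp]
    refine (Submodule.ker_liftQ _ _ _).trans ?_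
    rw [LinearMap.comp_id, Submodule.ker_mkQ, Submodule.map_sup, Submodule.mkQ_map_self, bot_sup_eq]
    congr 1
    ext x
    rw [Ideal.mem_span_singleton', LinearMap.mem_range]
    exact exists_congr fun a => by rw [LinearMap.mulLeft_apply, mul_comm]

theorem hasUniqueExtension_mul_add_iff {R : Type*} [CommRing R] {𝔞 I : Ideal R} {F L : R}
    (hF : F ∈ I) (hL : ∀ x, L * x ∈ I → x ∈ I)
    (h : HasUniqueExtension 𝔞 (R ⧸ Ideal.span {L, F})) :
    HasUniqueExtension 𝔞 (R ⧸ (Ideal.span {L} * I + Ideal.span {F})) ↔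
      HasUniqueExtension 𝔞 (R ⧸ I) := by
  refine (hasUniqueExtension_quotient_iff_of_colon (c := L) (fun x => ?_) ?_).symm
  · rw [span_mul_add_span_eq_inf hF hL]
    exact ⟨fun hx => hL x hx.1, fun hx =>
      ⟨I.mul_mem_left L hx, Ideal.mul_mem_right _ _ (Ideal.subset_span (by simp))⟩⟩
  · rwa [Submodule.add_eq_sup, sup_right_comm, sup_eq_right.2
      (Ideal.mul_le_left : Ideal.span {L} * I ≤ Ideal.span {L}), ← Ideal.span_insert]

theorem isACM_mul_add_iff {k : Type*} [Field k] {I : Ideal (CoordRing k)} {F L : CoordRing k}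
    (hI : IsLineArrangementIdeal I)
    (hI' : IsLineArrangementIdeal (Ideal.span {L} * I + Ideal.span {F}))
    (hF : F ∈ I) (hL : ∀ x, L * x ∈ I → x ∈ I)
    (h : ∀ 𝔪 : Ideal (CoordRing k), 𝔪.IsMaximal →
      HasUniqueExtension 𝔪 (CoordRing k ⧸ Ideal.span {L, F})) :
    IsACM (Ideal.span {L} * I + Ideal.span {F}) ↔ IsACM I := by
  rw [hI.isACM_iff, hI'.isACM_iff]
  exact forall₂_congr fun 𝔪 h𝔪 => hasUniqueExtension_mul_add_iff hF hL (h 𝔪 h𝔪)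

theorem mul_mem_span_pair_mul_iff {R : Type*} [CommRing R] {p c y : R}
    (hpc : ∀ x, p ∣ c * x → p ∣ x) (x : R) :
    c * x ∈ Ideal.span {p, y * c} ↔ x ∈ Ideal.span {p, y} := by
  simp only [Ideal.mem_span_pair]
  constructor
  · rintro ⟨a, b, hab⟩
    obtain ⟨d, hd⟩ := hpc (x - b * y) ⟨a, by linear_combination -hab⟩
    exact ⟨d, b, by linear_combination -hd⟩
  · rintro ⟨a, b, rfl⟩
    exact ⟨a * c, b, by ring⟩

namespace IsArrangement

variable {k : Type*} [Field k] {n : ℕ} {ℓ : Fin n → CoordRing k} {L : CoordRing k}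

theorem linearIndependent_head (h : IsArrangement (Fin.cons L ℓ : Fin (n + 1) → CoordRing k))
    (i : Fin n) : LinearIndependent k ![L, ℓ i] := by
  simpa only [Fin.cons_zero, Fin.cons_succ] using h.linearIndependent (Fin.succ_ne_zero i).symm

theorem prime_head (h : IsArrangement (Fin.cons L ℓ : Fin (n + 1) → CoordRing k)) : Prime L :=
  prime_of_isHomogeneous_one h.isHomogeneous_head (h.ne_zero 0)

theorem not_dvd_prod_head (h : IsArrangement (Fin.cons L ℓ : Fin (n + 1) → CoordRing k))
    (s : Finset (Fin n)) : ¬ L ∣ ∏ i ∈ s, ℓ i := fun hdvd => by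
  obtain ⟨i, -, hi⟩ := h.prime_head.exists_mem_finset_dvd hdvd
  exact (linearIndependent_pair_iff_not_dvd h.isHomogeneous_head (h.tail.isHomogeneous i)
    h.prime_head.ne_zero).1 (h.linearIndependent_head i) hi

theorem hasUniqueExtension_quotient_span_prod
    (h : IsArrangement (Fin.cons L ℓ : Fin (n + 1) → CoordRing k)) {𝔪 : Ideal (CoordRing k)}
    (h𝔪 : 𝔪.IsMaximal) {s : Finset (Fin n)} (hs : s.Nonempty) :
    HasUniqueExtension 𝔪 (CoordRing k ⧸ Ideal.span {L, ∏ i ∈ s, ℓ i}) := by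
  have hline : ∀ i, HasUniqueExtension 𝔪 (CoordRing k ⧸ Ideal.span {L, ℓ i}) := fun i =>
    hasUniqueExtension_quotient_span_pair le_rfl h.isHomogeneous_head (h.tail.isHomogeneous i)
      (h.linearIndependent_head i) h𝔪
  induction hs using Finset.Nonempty.cons_induction with
  | singleton i =>
    rw [Finset.prod_singleton]
    exact hline i
  | cons i s hi _ ih =>
    rw [Finset.prod_cons]
    refine (hasUniqueExtension_quotient_iff_of_colon (mul_mem_span_pair_mul_iff fun x hx =>
      (h.prime_head.dvd_or_dvd hx).resolve_left (h.not_dvd_prod_head s)) ?_).1 (hline i)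
    rwa [Ideal.span_insert, sup_assoc, (sup_eq_right (b := Ideal.span {∏ j ∈ s, ℓ j})).2
      (Ideal.span_singleton_le_span_singleton.2 (Dvd.intro_left _ rfl)), ← Ideal.span_insert]

section

variable [CharZero k]

theorem isLineArrangementIdeal_of_le {ι : Type*} [Fintype ι] [Nonempty ι] {ℓ : ι → CoordRing k}
    (h : IsArrangement ℓ) {I : Ideal (CoordRing k)} (hJ : jacobianIdeal (∏ i, ℓ i) ≤ I)
    (hI : Pairwise fun i j => I ≤ Ideal.span {ℓ i, ℓ j}) : IsLineArrangementIdeal I := by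
  intro p hp
  obtain ⟨i, j, hij, hle⟩ := h.exists_span_le hp.1.1 (hJ.trans hp.1.2)
  exact ⟨ℓ i, ℓ j, h.isHomogeneous i, h.isHomogeneous j, h.linearIndependent hij,
    le_antisymm (hp.2 ⟨h.isPrime_span hij, hI hij⟩ hle) hle⟩

theorem isLineArrangementIdeal_topCurveIdeal {ι : Type*} [Fintype ι] [Nonempty ι]
    {ℓ : ι → CoordRing k} (h : IsArrangement ℓ) :
    IsLineArrangementIdeal (topCurveIdeal (∏ i, ℓ i)) := by
  refine h.isLineArrangementIdeal_of_le
    (fun f hf => (h.mem_topCurveIdeal_iff f).2 fun i j hij =>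
      ⟨1, (h.isPrime_span hij).one_notMem, by rwa [one_mul]⟩) fun i j hij f hf => ?_
  obtain ⟨s, hs, hsf⟩ := (h.mem_topCurveIdeal_iff f).1 hf hij
  exact ((h.isPrime_span hij).mem_or_mem (jacobianIdeal_prod_le_span hij hsf)).resolve_left hs

theorem isLineArrangementIdeal_redCurveIdeal {ι : Type*} [Fintype ι] [Nonempty ι]
    {ℓ : ι → CoordRing k} (h : IsArrangement ℓ) :
    IsLineArrangementIdeal (redCurveIdeal (∏ i, ℓ i)) :=
  h.isLineArrangementIdeal_of_le
    (fun f hf => (h.mem_redCurveIdeal_iff f).2 fun _ _ hij => jacobianIdeal_prod_le_span hij hf)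
    fun _ _ hij f hf => (h.mem_redCurveIdeal_iff f).1 hf hij

variable [NeZero n] (h : IsArrangement (Fin.cons L ℓ : Fin (n + 1) → CoordRing k))
  (hL : Pairwise fun i j => L ∉ Ideal.span {ℓ i, ℓ j})

include h hL

theorem isACM_topCurveIdeal_mul_iff :
    IsACM (topCurveIdeal (L * ∏ i, ℓ i)) ↔ IsACM (topCurveIdeal (∏ i, ℓ i)) := by
  have hline := h.isLineArrangementIdeal_topCurveIdeal
  rw [Fin.prod_cons] at hline
  rw [h.topCurveIdeal_mul hL] at hline ⊢
  exact isACM_mul_add_iff h.tail.isLineArrangementIdeal_topCurveIdeal hline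
    h.tail.prod_mem_topCurveIdeal (fun _ => h.mem_topCurveIdeal_of_mul_mem hL)
    fun _ h𝔪 => h.hasUniqueExtension_quotient_span_prod h𝔪 Finset.univ_nonempty

theorem isACM_redCurveIdeal_mul_iff :
    IsACM (redCurveIdeal (L * ∏ i, ℓ i)) ↔ IsACM (redCurveIdeal (∏ i, ℓ i)) := by
  have hline := h.isLineArrangementIdeal_redCurveIdeal
  rw [Fin.prod_cons] at hline
  rw [h.redCurveIdeal_mul hL] at hline ⊢
  exact isACM_mul_add_iff h.tail.isLineArrangementIdeal_redCurveIdeal hline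
    h.tail.prod_mem_redCurveIdeal (fun _ => h.mem_redCurveIdeal_of_mul_mem hL)
    fun _ h𝔪 => h.hasUniqueExtension_quotient_span_prod h𝔪 Finset.univ_nonempty

end

end IsArrangement

end CohenMacaulayDoubleLink

section Homogeneity

attribute [local instance] MvPolynomial.gradedAlgebra

variable {k : Type*} [Field k]

theorem decompose_eq_homogeneousComponent (f : CoordRing k) (n : ℕ) :
    (DirectSum.decompose (homogeneousSubmodule (Fin 4) k) f n : CoordRing k) =
      homogeneousComponent n f :=
  decomposition.decompose'_apply f n

theorem homogeneousComponent_add_mul {e : ℕ} {g : CoordRing k} (hg : g.IsHomogeneous e) (d : ℕ)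
    (f : CoordRing k) :
    homogeneousComponent (d + e) (f * g) = homogeneousComponent d f * g := by
  rw [← decompose_eq_homogeneousComponent, ← decompose_eq_homogeneousComponent]
  exact DirectSum.coe_decompose_mul_add_of_right_mem _ hg

theorem isHomogeneous_of_homogeneousComponent_mem {I : Ideal (CoordRing k)}
    (h : ∀ f ∈ I, ∀ n, homogeneousComponent n f ∈ I) :
    I.IsHomogeneous (homogeneousSubmodule (Fin 4) k) := by
  intro n f hf
  rw [decompose_eq_homogeneousComponent]
  exact h f hf n

theorem isHomogeneous_colon {J I : Ideal (CoordRing k)}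
    (hJ : J.IsHomogeneous (homogeneousSubmodule (Fin 4) k))
    (hI : I.IsHomogeneous (homogeneousSubmodule (Fin 4) k)) :
    (J.colon (I : Set (CoordRing k))).IsHomogeneous (homogeneousSubmodule (Fin 4) k) := by
  refine isHomogeneous_of_homogeneousComponent_mem fun f hf n => ?_
  rw [Submodule.mem_colon] at hf ⊢
  intro g hg
  rw [smul_eq_mul, ← sum_homogeneousComponent g, Finset.mul_sum]
  refine Ideal.sum_mem _ fun d _ => ?_
  rw [← homogeneousComponent_add_mul (homogeneousComponent_isHomogeneous d g)]
  exact homogeneousComponent_mem_of_mem hJ (hf _ (homogeneousComponent_mem_of_mem hI hg d)) _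

theorem isHomogeneous_span_singleton {f : CoordRing k} {n : ℕ} (hf : f.IsHomogeneous n) :
    (Ideal.span {f}).IsHomogeneous (homogeneousSubmodule (Fin 4) k) :=
  Ideal.homogeneous_span _ _ fun x hx => ⟨n, by rwa [Set.mem_singleton_iff.1 hx]⟩

theorem isHomogeneous_span_pair {f g : CoordRing k} {m n : ℕ} (hf : f.IsHomogeneous m)
    (hg : g.IsHomogeneous n) :
    (Ideal.span {f, g}).IsHomogeneous (homogeneousSubmodule (Fin 4) k) := by
  rw [Ideal.span_insert]
  exact (isHomogeneous_span_singleton hf).sup (isHomogeneous_span_singleton hg)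

theorem isHomogeneous_jacobianIdeal {F : CoordRing k} {n : ℕ} (hF : F.IsHomogeneous n) :
    (jacobianIdeal F).IsHomogeneous (homogeneousSubmodule (Fin 4) k) := by
  refine Ideal.homogeneous_span _ _ fun x hx => ?_
  obtain ⟨i, rfl⟩ := hx
  exact ⟨n - 1, hF.pderiv⟩

/-- The homomorphism `f ↦ f(t x)` into `k[x][t]`, whose coefficients are the homogeneous components
of `f`. -/
noncomputable def scaleHom : CoordRing k →ₐ[k] Polynomial (CoordRing k) :=
  aeval fun i => Polynomial.C (X i) * Polynomial.X

theorem scaleHom_monomial (e : Fin 4 →₀ ℕ) (c : k) :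
    scaleHom (monomial e c) = Polynomial.monomial e.degree (monomial e c) := by
  rw [scaleHom, aeval_monomial, Finsupp.prod]
  simp only [mul_pow, Finset.prod_mul_distrib, Finset.prod_pow_eq_pow_sum]
  rw [← Polynomial.C_mul_X_pow_eq_monomial, monomial_eq, Finsupp.prod, ← mul_assoc, map_mul,
    map_prod]
  simp only [map_pow]
  rfl

theorem coeff_scaleHom (f : CoordRing k) (d : ℕ) :
    (scaleHom f).coeff d = homogeneousComponent d f := by
  induction f using MvPolynomial.induction_on' with
  | monomial e c =>
    rw [scaleHom_monomial, Polynomial.coeff_monomial]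
    split_ifs with h
    · exact (homogeneousComponent_of_mem (isHomogeneous_monomial c h)).symm ▸ (if_pos rfl).symm
    · rw [homogeneousComponent_of_mem (isHomogeneous_monomial c rfl), if_neg (Ne.symm h)]
  | add p q hp hq => rw [map_add, map_add, Polynomial.coeff_add, hp, hq]

theorem mk_mem_nonZeroDivisors_of_notMem {R : Type*} [CommRing R] {J p I : Ideal R} [p.IsPrime]
    (hI : ∀ f, f ∈ I ↔ ∃ s ∉ p, s * f ∈ J) {s : R} (hs : s ∉ p) :
    Ideal.Quotient.mk I s ∈ nonZeroDivisors (R ⧸ I) := by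
  rw [mem_nonZeroDivisors_iff_right]
  intro x hx
  obtain ⟨f, rfl⟩ := Ideal.Quotient.mk_surjective x
  rw [← map_mul, Ideal.Quotient.eq_zero_iff_mem, hI] at hx
  obtain ⟨u, hu, hmem⟩ := hx
  rw [Ideal.Quotient.eq_zero_iff_mem, hI]
  exact ⟨u * s, Ideal.IsPrime.mul_notMem ‹_› hu hs, by rwa [mul_assoc, mul_comm s]⟩

theorem exists_ringHom_coeff_eq_mk_homogeneousComponent (I : Ideal (CoordRing k)) :
    ∃ φ : CoordRing k →+* Polynomial (CoordRing k ⧸ I), ∀ f d,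
      (φ f).coeff d = Ideal.Quotient.mk I (homogeneousComponent d f) := by
  refine ⟨(Polynomial.mapRingHom (Ideal.Quotient.mk I)).comp (scaleHom (k := k)).toRingHom,
    fun f d => ?_⟩
  rw [← coeff_scaleHom]
  exact Polynomial.coeff_map _ _

theorem polynomial_eq_zero_of_mul_eq_zero {A : Type*} [CommRing A] {p q : Polynomial A} {e : ℕ}
    (hq : q.coeff e ∈ nonZeroDivisors A) (hpq : p * q = 0) : p = 0 :=
  (mul_right_mem_nonZeroDivisors_eq_zero_iff
    (Polynomial.mem_nonzeroDivisors_of_coeff_mem e hq)).1 hpq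

theorem isHomogeneous_of_mem_iff_exists_mul_mem {J p I : Ideal (CoordRing k)} [p.IsPrime]
    (hJ : J.IsHomogeneous (homogeneousSubmodule (Fin 4) k))
    (hI : ∀ f, f ∈ I ↔ ∃ s ∉ p, s * f ∈ J) :
    I.IsHomogeneous (homogeneousSubmodule (Fin 4) k) := by
  refine isHomogeneous_of_homogeneousComponent_mem fun f hf d => ?_
  obtain ⟨s, hs, hsf⟩ := (hI f).1 hf
  obtain ⟨e, he⟩ : ∃ e, homogeneousComponent e s ∉ p := by
    by_contra! hmem
    rw [← sum_homogeneousComponent s] at hs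
    exact hs (p.sum_mem fun e _ => hmem e)
  obtain ⟨φ, hφ⟩ := exists_ringHom_coeff_eq_mk_homogeneousComponent I
  have hs₀ : (φ s).coeff e ∈ nonZeroDivisors (CoordRing k ⧸ I) := by
    rw [hφ]
    exact mk_mem_nonZeroDivisors_of_notMem hI he
  have hmul : φ f * φ s = 0 := by
    rw [← map_mul, mul_comm]
    refine Polynomial.ext fun e => ?_
    rw [hφ, Polynomial.coeff_zero, Ideal.Quotient.eq_zero_iff_mem]
    exact (hI _).2 ⟨1, Ideal.one_notMem p, by
      rw [one_mul]
      exact homogeneousComponent_mem_of_mem hJ hsf e⟩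
  have hd := hφ f d
  rw [polynomial_eq_zero_of_mul_eq_zero hs₀ hmul, Polynomial.coeff_zero] at hd
  exact Ideal.Quotient.eq_zero_iff_mem.1 hd.symm

namespace IsArrangement

variable {ι : Type*} [Fintype ι] [Nonempty ι] [CharZero k] {ℓ : ι → CoordRing k}

theorem isHomogeneous_topCurveIdeal (h : IsArrangement ℓ) :
    (topCurveIdeal (∏ i, ℓ i)).IsHomogeneous (homogeneousSubmodule (Fin 4) k) := by
  refine isHomogeneous_of_homogeneousComponent_mem fun f hf d => ?_
  rw [h.mem_topCurveIdeal_iff] at hf ⊢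
  intro i j hij
  have hprime := h.isPrime_span hij
  have hI := IsLocalization.algebraMap_mem_map_algebraMap_iff
    (Ideal.span {ℓ i, ℓ j}).primeCompl (Localization.AtPrime (Ideal.span {ℓ i, ℓ j}))
    (jacobianIdeal (∏ i, ℓ i))
  have hhom := isHomogeneous_of_mem_iff_exists_mul_mem
    (isHomogeneous_jacobianIdeal h.isHomogeneous_prod) fun f => Ideal.mem_comap.trans (hI f)
  exact (hI _).1 (homogeneousComponent_mem_of_mem hhom ((hI f).2 (hf hij)) d)

theorem isHomogeneous_redCurveIdeal (h : IsArrangement ℓ) :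
    (redCurveIdeal (∏ i, ℓ i)).IsHomogeneous (homogeneousSubmodule (Fin 4) k) := by
  refine isHomogeneous_of_homogeneousComponent_mem fun f hf d => ?_
  rw [h.mem_redCurveIdeal_iff] at hf ⊢
  exact fun i j hij => homogeneousComponent_mem_of_mem
    (isHomogeneous_span_pair (h.isHomogeneous i) (h.isHomogeneous j)) (hf hij) d

end IsArrangement

end Homogeneity

section Liaison

attribute [local instance] MvPolynomial.gradedAlgebra

section Colon

variable {R : Type*} [CommRing R] {I K : Ideal R} {F G L : R}

theorem span_pair_le_iff : Ideal.span {F, G} ≤ I ↔ F ∈ I ∧ G ∈ I := by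
  rw [Ideal.span_le, Set.pair_subset_iff, SetLike.mem_coe, SetLike.mem_coe]

theorem mem_span_mul_add_span_iff {y : R} :
    y ∈ Ideal.span {L} * I + Ideal.span {F} ↔ ∃ i ∈ I, ∃ r, L * i + r * F = y := by
  simp only [Submodule.add_eq_sup, Submodule.mem_sup, Ideal.mem_span_singleton_mul,
    Ideal.mem_span_singleton', exists_exists_and_eq_and, exists_exists_eq_and]

theorem colon_span_mul_add_span (hFL : ∀ x, F ∣ L * x → F ∣ x)
    (hI : (Ideal.span {F, G}).colon (I : Set R) = K) :
    (Ideal.span {F, G * L}).colon ((Ideal.span {L} * I + Ideal.span {F} : Ideal R) : Set R) =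
      K := by
  ext x
  simp only [← hI, Submodule.mem_colon, SetLike.mem_coe, mem_span_mul_add_span_iff, smul_eq_mul]
  constructor
  · intro hx i hi
    refine (mul_mem_span_pair_mul_iff hFL _).1 ?_
    simpa only [zero_mul, add_zero, mul_left_comm] using hx _ ⟨i, hi, 0, rfl⟩
  · rintro hx _ ⟨i, hi, r, rfl⟩
    rw [mul_add, mul_left_comm, ← mul_assoc x r]
    exact Ideal.add_mem _ ((mul_mem_span_pair_mul_iff hFL _).2 (hx i hi))
      (Ideal.mul_mem_left _ _ (Ideal.subset_span (Set.mem_insert _ _)))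

theorem colon_span_pair_mul (hFG : ∀ x, F ∣ G * x → F ∣ x) (hFL : ∀ x, F ∣ L * x → F ∣ x)
    (hK : (Ideal.span {F, G}).colon (K : Set R) = I) (hG : G ∈ K) :
    (Ideal.span {F, G * L}).colon (K : Set R) = Ideal.span {L} * I + Ideal.span {F} := by
  ext x
  simp only [← hK, Submodule.mem_colon, SetLike.mem_coe, mem_span_mul_add_span_iff, smul_eq_mul]
  have hF : F ∈ Ideal.span {F, G * L} := Ideal.subset_span (by simp)
  constructor
  · intro hx
    obtain ⟨p, q, hpq⟩ := Ideal.mem_span_pair.1 (hx G hG)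
    obtain ⟨r, hr⟩ := hFG (x - q * L) ⟨p, by linear_combination -hpq⟩
    refine ⟨q, fun y hy => (mul_mem_span_pair_mul_iff hFL _).1 ?_, r, by linear_combination -hr⟩
    have hxy : L * (q * y) = x * y - r * y * F := by linear_combination -y * hr
    rw [hxy]
    exact Ideal.sub_mem _ (hx y hy) (Ideal.mul_mem_left _ _ hF)
  · rintro ⟨q, hq, r, rfl⟩ y hy
    rw [add_mul, mul_assoc, mul_right_comm]
    exact Ideal.add_mem _ ((mul_mem_span_pair_mul_iff hFL _).2 (hq y hy))
      (Ideal.mul_mem_left _ _ hF)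

theorem isRegular_pair [IsDomain R] (hF : F ≠ 0) (hG : ∀ x, F ∣ G * x → F ∣ x)
    (htop : Ideal.span {F, G} ≠ ⊤) : RingTheory.Sequence.IsRegular R [F, G] := by
  refine ⟨(RingTheory.Sequence.isWeaklyRegular_cons_iff ..).2 ⟨fun x y => mul_left_cancel₀ hF,
    (RingTheory.Sequence.isWeaklyRegular_singleton_iff ..).2 ?_⟩, fun h => htop ?_⟩
  · simp only [isSMulRegular_quotient_iff_mem_of_smul_mem, smul_eq_mul,
      Submodule.mem_smul_pointwise_iff_exists, Submodule.mem_top, true_and]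
    exact fun x ⟨y, hy⟩ => (hG x ⟨y, hy.symm⟩).imp fun _ => Eq.symm
  · rw [smul_eq_mul, Ideal.mul_top, Ideal.ofList_cons, Ideal.ofList_singleton] at h
    rw [Ideal.span_insert, h]

end Colon

-- `(F, G)` links `I` to its residual `(F, G) : I`, and `(F, G L)` links the latter to `L I + (F)`.
theorem isEvenlyLinked_mul_add {k : Type*} [Field k] {I : Ideal (CoordRing k)}
    (hI : I.IsHomogeneous (homogeneousSubmodule (Fin 4) k)) {F G L : CoordRing k} {a b c : ℕ}
    (hF : F.IsHomogeneous a) (hG : G.IsHomogeneous b) (hL : L.IsHomogeneous c) (hF₀ : F ≠ 0)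
    (hFG : ∀ x, F ∣ G * x → F ∣ x) (hFL : ∀ x, F ∣ L * x → F ∣ x) (htop : Ideal.span {F, G} ≠ ⊤)
    (hle : Ideal.span {F, G} ≤ I)
    (hdual : (Ideal.span {F, G}).colon ((Ideal.span {F, G}).colon (I : Set (CoordRing k)) :
      Set (CoordRing k)) = I) :
    IsEvenlyLinked I (Ideal.span {L} * I + Ideal.span {F}) := by
  have hG_mem : G ∈ Ideal.span {F, G} := Ideal.subset_span (by simp)
  have hle_K : Ideal.span {F, G} ≤ (Ideal.span {F, G}).colon (I : Set (CoordRing k)) :=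
    Ideal.le_colon
  have hle_mul : Ideal.span {F, G * L} ≤ Ideal.span {F, G} :=
    span_pair_le_iff.2 ⟨Ideal.subset_span (by simp), Ideal.mul_mem_right _ _ hG_mem⟩
  have hle' : Ideal.span {F, G * L} ≤ Ideal.span {L} * I + Ideal.span {F} :=
    span_pair_le_iff.2 ⟨mem_span_mul_add_span_iff.2 ⟨0, I.zero_mem, 1, by ring⟩,
      mem_span_mul_add_span_iff.2 ⟨G, hle hG_mem, 0, by ring⟩⟩
  have hK := isHomogeneous_colon (isHomogeneous_span_pair hF hG) hI
  have hI' := ((isHomogeneous_span_singleton hL).mul hI).sup (isHomogeneous_span_singleton hF)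
  have hreg : RingTheory.Sequence.IsRegular (CoordRing k) [F, G * L] :=
    isRegular_pair hF₀ (fun x hx => hFL x (hFG _ (by rwa [← mul_assoc])))
      fun h => htop (top_le_iff.1 (h ▸ hle_mul))
  exact Relation.ReflTransGen.single ⟨_,
    ⟨hI, hK, F, G, a, b, hF, hG, isRegular_pair hF₀ hFG htop, le_inf hle hle_K, rfl, hdual⟩,
    ⟨hK, hI', F, G * L, a, b + c, hF, hG.mul hL, hreg, le_inf (hle_mul.trans hle_K) hle',
      colon_span_pair_mul hFG hFL hdual (hle_K hG_mem), colon_span_mul_add_span hFL rfl⟩⟩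

end Liaison

section Polar

theorem exists_notMem_forall_mul_mem {R : Type*} [CommRing R] {I J p : Ideal R} (hI : I.FG)
    (hp : p.IsPrime) (h : ∀ f ∈ I, ∃ s ∉ p, s * f ∈ J) : ∃ s ∉ p, ∀ f ∈ I, s * f ∈ J := by
  obtain ⟨S, rfl⟩ := hI
  choose! t ht ht' using fun f (hf : f ∈ S) => h f (Ideal.subset_span hf)
  refine ⟨∏ f ∈ S, t f, fun hmem => ?_, fun f hf => ?_⟩
  · obtain ⟨f, hf, hf'⟩ := hp.prod_mem_iff.1 hmem
    exact ht f hf hf'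
  · have hle : Ideal.span S ≤ J.colon {∏ f ∈ S, t f} := by
      refine Ideal.span_le.2 fun f hf => ?_
      rw [SetLike.mem_coe, Submodule.mem_colon_singleton, smul_eq_mul, mul_comm]
      exact J.mem_of_dvd (mul_dvd_mul_right (Finset.dvd_prod_of_mem t hf) f) (ht' f hf)
    rw [mul_comm]
    exact Submodule.mem_colon_singleton.1 (hle hf)

theorem derivation_prod_of_eigen {k A ι : Type*} [CommRing k] [CommRing A] [Algebra k A]
    (D : Derivation k A A) (c : A) (s : Finset ι) (f : ι → A) (h : ∀ i ∈ s, D (f i) = c * f i) :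
    D (∏ i ∈ s, f i) = s.card * c * ∏ i ∈ s, f i := by
  induction s using Finset.cons_induction with
  | empty => simp
  | cons i s hi ih =>
    rw [Finset.prod_cons, Derivation.leibniz, ih fun j hj => h j (Finset.mem_cons_of_mem hj),
      h i (Finset.mem_cons_self i s), Finset.card_cons, smul_eq_mul, smul_eq_mul]
    push_cast
    ring

variable {k : Type*} [Field k] {a b P H F : CoordRing k} {v w : Fin 4 → k}

theorem dirDeriv_single (i : Fin 4) :
    dirDeriv (Pi.single i (1 : k)) = (pderiv i : Derivation k (CoordRing k) (CoordRing k)) :=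
  derivation_ext fun j => by
    rcases eq_or_ne j i with rfl | hj <;> simp [dirDeriv, *]

theorem isHomogeneous_dirDeriv {n : ℕ} (hF : F.IsHomogeneous n) (v : Fin 4 → k) :
    (dirDeriv v F).IsHomogeneous (n - 1) := by
  rw [dirDeriv_eq_sum]
  refine IsHomogeneous.sum _ _ _ fun i _ => ?_
  simpa using (isHomogeneous_C (Fin 4) (v i)).mul (hF.pderiv (i := i))

/-- A multiple of an Euler vector field transversal to the line `a = b = 0`: if `b` vanishes at `v`,
it acts on the linear forms vanishing on this line as multiplication by the constant
`a(v) b(w)`. -/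
noncomputable def localEuler (a b : CoordRing k) (v w : Fin 4 → k) :
    Derivation k (CoordRing k) (CoordRing k) :=
  (C (eval v a) * b) • dirDeriv w - (C (eval w a) * b - C (eval w b) * a) • dirDeriv v

theorem localEuler_apply (a b : CoordRing k) (v w : Fin 4 → k) (f : CoordRing k) :
    localEuler a b v w f =
      C (eval v a) * b * dirDeriv w f - (C (eval w a) * b - C (eval w b) * a) * dirDeriv v f :=
  rfl

theorem localEuler_of_mem_span_pair (ha : a.IsHomogeneous 1) (hb : b.IsHomogeneous 1)
    (hvb : eval v b = 0) {l : CoordRing k} (hl : l.IsHomogeneous 1) (hmem : l ∈ Ideal.span {a, b}) :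
    localEuler a b v w l = C (eval v a * eval w b) * l := by
  obtain ⟨β, γ, rfl⟩ := exists_eq_of_mem_span_pair ha hb hl hmem
  rw [localEuler_apply, dirDeriv_of_isHomogeneous_one w hl, dirDeriv_of_isHomogeneous_one v hl]
  simp only [map_add, map_mul, eval_C, hvb, mul_zero, add_zero]
  ring

theorem localEuler_prod_of_mem_span_pair (ha : a.IsHomogeneous 1) (hb : b.IsHomogeneous 1)
    (hvb : eval v b = 0) {ι : Type*} (s : Finset ι) {ℓ : ι → CoordRing k}
    (hℓ : ∀ i ∈ s, (ℓ i).IsHomogeneous 1) (hmem : ∀ i ∈ s, ℓ i ∈ Ideal.span {a, b})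
    (w : Fin 4 → k) :
    localEuler a b v w (∏ i ∈ s, ℓ i) = C (s.card * (eval v a * eval w b)) * ∏ i ∈ s, ℓ i := by
  rw [derivation_prod_of_eigen _ _ s ℓ fun i hi =>
    localEuler_of_mem_span_pair ha hb hvb (hℓ i hi) (hmem i hi), ← C_eq_coe_nat, ← C_mul]

theorem localEuler_mem_span_pair (a b : CoordRing k) (v w : Fin 4 → k) (f : CoordRing k) :
    localEuler a b v w f ∈ Ideal.span {a, b} := by
  rw [localEuler_apply]
  exact Ideal.mem_span_pair.2 ⟨C (eval w b) * dirDeriv v f,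
    C (eval v a) * dirDeriv w f - C (eval w a) * dirDeriv v f, by ring⟩

section

variable {m : k} (hP : ∀ w, localEuler a b v w P = C (m * (eval v a * eval w b)) * P)

include hP

theorem mul_localEuler_mul (H : CoordRing k) (w : Fin 4 → k) :
    H * localEuler a b v w (P * H) =
      (C (m * (eval v a * eval w b)) * H + localEuler a b v w H) * (P * H) := by
  rw [Derivation.leibniz, hP, smul_eq_mul, smul_eq_mul]
  ring

theorem mul_mem_span_pair_dirDeriv (hva : eval v a ≠ 0) {f : CoordRing k}
    (hf : f ∈ jacobianIdeal (P * H)) : H * b * f ∈ Ideal.span {P * H, dirDeriv v (P * H)} := by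
  have hα : (C (eval v a)⁻¹ * C (eval v a) : CoordRing k) = 1 := by
    rw [← C_mul, inv_mul_cancel₀ hva, C_1]
  have hle : jacobianIdeal (P * H) ≤
      (Ideal.span {P * H, dirDeriv v (P * H)}).colon {H * b} := by
    rw [jacobianIdeal_le_iff]
    intro i
    have hE := mul_localEuler_mul hP H (Pi.single i 1)
    rw [localEuler_apply, dirDeriv_single] at hE
    rw [Submodule.mem_colon_singleton, smul_eq_mul]
    exact Ideal.mem_span_pair.2
      ⟨C (eval v a)⁻¹ *
          (C (m * (eval v a * eval (Pi.single i 1) b)) * H + localEuler a b v (Pi.single i 1) H),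
        C (eval v a)⁻¹ * H * (C (eval (Pi.single i 1) a) * b - C (eval (Pi.single i 1) b) * a), by
        linear_combination -C (eval v a)⁻¹ * hE + H * b * pderiv i (P * H) * hα⟩
  rw [mul_comm (H * b)]
  exact Submodule.mem_colon_singleton.1 (hle hf)

theorem exists_mul_mem_jacobianIdeal_of_mul_mem (hp : (Ideal.span {a, b}).IsPrime)
    (hb : Prime b) (hbF : ¬ b ∣ P * H) (hH : H ∉ Ideal.span {a, b}) (hm : m ≠ 0)
    (hva : eval v a ≠ 0) (hwb : eval w b ≠ 0) {f : CoordRing k}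
    (hf : H * b * f ∈ Ideal.span {P * H, dirDeriv v (P * H)}) :
    ∃ u ∉ Ideal.span {a, b}, u * f ∈ jacobianIdeal (P * H) := by
  have hE := mul_localEuler_mul hP H w
  set U := C (m * (eval v a * eval w b)) * H + localEuler a b v w H with hU_def
  rw [localEuler_apply] at hE
  have hU : U ∉ Ideal.span {a, b} := fun hmem => hH <|
    (Ideal.unit_mul_mem_iff_mem _
      ((isUnit_iff_ne_zero.2 (mul_ne_zero hm (mul_ne_zero hva hwb))).map C)).1
      ((Ideal.add_mem_iff_left _ (localEuler_mem_span_pair a b v w H)).1 hmem)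
  have hbU : ¬ b ∣ U := fun hd => hU (Ideal.mem_of_dvd _ hd (Ideal.subset_span (by simp)))
  have hbG : ¬ b ∣ dirDeriv v (P * H) := fun ⟨c, hc⟩ => by
    have hd : b ∣ U * (P * H) := ⟨H * (C (eval v a) * dirDeriv w (P * H) -
      (C (eval w a) * b - C (eval w b) * a) * c), by
        rw [← hE, hc]
        ring⟩
    exact (hb.dvd_or_dvd hd).elim hbU hbF
  obtain ⟨r, q, hrq⟩ := Ideal.mem_span_pair.1 hf
  obtain ⟨c, hc⟩ := (hb.dvd_or_dvd (a := dirDeriv v (P * H))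
    (b := q * U - r * H * (C (eval w a) * b - C (eval w b) * a))
    ⟨U * f * H - r * H * C (eval v a) * dirDeriv w (P * H), by
      linear_combination U * hrq + r * hE⟩).resolve_left hbG
  refine ⟨U * H, hp.mul_notMem hU hH, ?_⟩
  have hUHf : U * H * f =
      r * H * C (eval v a) * dirDeriv w (P * H) + c * dirDeriv v (P * H) :=
    mul_left_cancel₀ hb.ne_zero (by
      linear_combination -U * hrq - r * hE + dirDeriv v (P * H) * hc)
  rw [hUHf]
  exact Ideal.add_mem _ (Ideal.mul_mem_left _ _ (dirDeriv_mem_jacobianIdeal w _))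
    (Ideal.mul_mem_left _ _ (dirDeriv_mem_jacobianIdeal v _))

end

end Polar

namespace IsArrangement

variable {k ι : Type*} [Field k] {ℓ : ι → CoordRing k}

theorem prime (h : IsArrangement ℓ) (i : ι) : Prime (ℓ i) :=
  prime_of_isHomogeneous_one (h.isHomogeneous i) (h.ne_zero i)

theorem not_dvd_prod (h : IsArrangement ℓ) {i : ι} {s : Finset ι} (hi : i ∉ s) :
    ¬ ℓ i ∣ ∏ j ∈ s, ℓ j := fun hdvd =>
  have ⟨_, hj, hd⟩ := (h.prime i).exists_mem_finset_dvd hdvd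
  h.not_dvd (ne_of_mem_of_not_mem hj hi).symm hd

theorem isRelPrime_prod (h : IsArrangement ℓ) {G : CoordRing k} (s : Finset ι)
    (hG : ∀ i, ¬ ℓ i ∣ G) : IsRelPrime (∏ i ∈ s, ℓ i) G :=
  IsRelPrime.prod_left fun i _ => (h.prime i).irreducible.isRelPrime_iff_not_dvd.2 (hG i)

theorem exists_linearForm_span_pair_eq (h : IsArrangement ℓ) {v : Fin 4 → k}
    {i j : ι} (hv : eval v (ℓ i) ≠ 0) (hij : i ≠ j) :
    ∃ b : CoordRing k, b.IsHomogeneous 1 ∧ eval v b = 0 ∧ b ≠ 0 ∧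
      Ideal.span {ℓ i, b} = Ideal.span {ℓ i, ℓ j} := by
  have hα : (C (eval v (ℓ i))⁻¹ * C (eval v (ℓ i)) : CoordRing k) = 1 := by
    rw [← C_mul, inv_mul_cancel₀ hv, C_1]
  refine ⟨C (eval v (ℓ j)) * ℓ i - C (eval v (ℓ i)) * ℓ j,
    ((h.isHomogeneous i).C_mul _).sub ((h.isHomogeneous j).C_mul _), ?_, fun h₀ => ?_,
    le_antisymm (span_pair_le_iff.2 ⟨Ideal.subset_span (by simp), ?_⟩)
      (span_pair_le_iff.2 ⟨Ideal.subset_span (by simp), ?_⟩)⟩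
  · simp only [map_sub, map_mul, eval_C]
    ring
  · exact h.not_dvd hij ⟨C (eval v (ℓ i))⁻¹ * C (eval v (ℓ j)), by
      linear_combination - (C (eval v (ℓ i))⁻¹) * h₀ - ℓ j * hα⟩
  · exact Ideal.mem_span_pair.2 ⟨C (eval v (ℓ j)), -C (eval v (ℓ i)), by ring⟩
  · exact Ideal.mem_span_pair.2 ⟨C (eval v (ℓ i))⁻¹ * C (eval v (ℓ j)), -C (eval v (ℓ i))⁻¹, by
      linear_combination ℓ j * hα⟩

variable [Fintype ι]

theorem prod_ne_zero (h : IsArrangement ℓ) : ∏ i, ℓ i ≠ 0 :=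
  Finset.prod_ne_zero_iff.2 fun i _ => h.ne_zero i

omit [Fintype ι] in
theorem exists_eval_ne_zero [Finite ι] [Infinite k] (h : IsArrangement ℓ) :
    ∃ v : Fin 4 → k, ∀ i, eval v (ℓ i) ≠ 0 := by
  cases nonempty_fintype ι
  obtain ⟨v, hv⟩ : ∃ v : Fin 4 → k, eval v (∏ i, ℓ i) ≠ 0 := by
    by_contra! hcon
    exact h.prod_ne_zero (MvPolynomial.funext fun v => by rw [hcon v, map_zero])
  rw [map_prod] at hv
  exact ⟨v, fun i => Finset.prod_ne_zero_iff.1 hv i (Finset.mem_univ i)⟩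

variable [DecidableEq ι] {v : Fin 4 → k}

theorem dirDeriv_prod (h : IsArrangement ℓ) (v : Fin 4 → k) (i : ι) : dirDeriv v (∏ j, ℓ j) =
    C (eval v (ℓ i)) * (∏ j ∈ Finset.univ.erase i, ℓ j) +
      ℓ i * dirDeriv v (∏ j ∈ Finset.univ.erase i, ℓ j) := by
  rw [← Finset.mul_prod_erase Finset.univ ℓ (Finset.mem_univ i), Derivation.leibniz,
    dirDeriv_of_isHomogeneous_one v (h.isHomogeneous i), smul_eq_mul, smul_eq_mul]
  ring

omit [DecidableEq ι] in
theorem not_dvd_dirDeriv_prod (h : IsArrangement ℓ) (hv : ∀ i, eval v (ℓ i) ≠ 0) (i : ι) :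
    ¬ ℓ i ∣ dirDeriv v (∏ j, ℓ j) := by
  classical
  rw [h.dirDeriv_prod v i, dvd_add_left (dvd_mul_right _ _)]
  intro hd
  rcases (h.prime i).dvd_or_dvd hd with hd | hd
  · exact (h.prime i).not_isUnit (isUnit_of_dvd_unit hd ((isUnit_iff_ne_zero.2 (hv i)).map C))
  · exact h.not_dvd_prod (Finset.notMem_erase i _) hd

end IsArrangement

namespace IsArrangement

variable {k ι : Type*} [Field k] [Fintype ι] {ℓ : ι → CoordRing k}

section Residual

variable {v : Fin 4 → k} {i j : ι} (h : IsArrangement ℓ) (hv : ∀ i, eval v (ℓ i) ≠ 0)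

include h hv

theorem exists_colon_eq_span (hij : i ≠ j) : ∃ Δ : CoordRing k,
    (Ideal.span {∏ i, ℓ i, dirDeriv v (∏ i, ℓ i)}).colon {Δ} = Ideal.span {ℓ i, ℓ j} := by
  classical
  have hrel : IsRelPrime (∏ l ∈ Finset.univ.erase i, ℓ l) (dirDeriv v (∏ l, ℓ l)) :=
    h.isRelPrime_prod _ (h.not_dvd_dirDeriv_prod hv)
  have hnd : ¬ ℓ i ∣ ∏ l ∈ (Finset.univ.erase i).erase j, ℓ l := h.not_dvd_prod (by simp)
  have hH₀ : ∏ l ∈ Finset.univ.erase i, ℓ l ≠ 0 :=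
    Finset.prod_ne_zero_iff.2 fun l _ => h.ne_zero l
  have hα : (C (eval v (ℓ i))⁻¹ * C (eval v (ℓ i)) : CoordRing k) = 1 := by
    rw [← C_mul, inv_mul_cancel₀ (hv i), C_1]
  have hF := Finset.mul_prod_erase Finset.univ ℓ (Finset.mem_univ i)
  have hH := Finset.mul_prod_erase _ ℓ (Finset.mem_erase.2 ⟨hij.symm, Finset.mem_univ j⟩)
  have hG := h.dirDeriv_prod v i
  set H := ∏ l ∈ Finset.univ.erase i, ℓ l
  set H' := ∏ l ∈ (Finset.univ.erase i).erase j, ℓ l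
  refine ⟨H * H', le_antisymm (fun f hf => ?_) (span_pair_le_iff.2 ⟨?_, ?_⟩)⟩
  · obtain ⟨r, q, hrq⟩ := Ideal.mem_span_pair.1 (Submodule.mem_colon_singleton.1 hf)
    rw [smul_eq_mul] at hrq
    obtain ⟨e, rfl⟩ : H ∣ q := hrel.dvd_of_dvd_mul_left (z := q) ⟨f * H' - r * ℓ i, by
      linear_combination hrq + r * hF⟩
    have hfH : f * H' - r * ℓ i = e * dirDeriv v (∏ l, ℓ l) := mul_left_cancel₀ hH₀ (by
      linear_combination - hrq - r * hF)
    obtain ⟨c, hc⟩ := ((h.prime i).dvd_or_dvd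
      (⟨r + e * dirDeriv v H, by
        linear_combination hfH + e * hG - e * C (eval v (ℓ i)) * hH⟩ :
        ℓ i ∣ H' * (f - e * C (eval v (ℓ i)) * ℓ j))).resolve_left hnd
    exact Ideal.mem_span_pair.2 ⟨c, e * C (eval v (ℓ i)), by linear_combination - hc⟩
  · rw [Submodule.mem_colon_singleton, smul_eq_mul]
    exact Ideal.mem_span_pair.2 ⟨H', 0, by linear_combination -H' * hF⟩
  · rw [Submodule.mem_colon_singleton, smul_eq_mul, hG]
    exact Ideal.mem_span_pair.2 ⟨-C (eval v (ℓ i))⁻¹ * dirDeriv v H, C (eval v (ℓ i))⁻¹ * H, by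
      rw [← hF]
      linear_combination H * H * hα - H * hH⟩

theorem exists_residual_topCurveIdeal [CharZero k] (hij : i ≠ j) : ∃ Δ : CoordRing k,
    (∀ f ∈ topCurveIdeal (∏ i, ℓ i),
      Δ * f ∈ Ideal.span {∏ i, ℓ i, dirDeriv v (∏ i, ℓ i)}) ∧
    ∀ f, Δ * f ∈ Ideal.span {∏ i, ℓ i, dirDeriv v (∏ i, ℓ i)} →
      ∃ s ∉ Ideal.span {ℓ i, ℓ j}, s * f ∈ jacobianIdeal (∏ i, ℓ i) := by
  classical
  have : Nonempty ι := ⟨i⟩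
  have hp := h.isPrime_span hij
  obtain ⟨s, hs, hsJ⟩ := exists_notMem_forall_mul_mem
    (IsNoetherian.noetherian (topCurveIdeal (∏ i, ℓ i))) hp
    fun f hf => (h.mem_topCurveIdeal_iff f).1 hf hij
  obtain ⟨b, hb, hvb, hb₀, hspan⟩ := h.exists_linearForm_span_pair_eq (hv i) hij
  obtain ⟨w, -, hwb⟩ := exists_eval_eq_zero_of_not_dvd (isHomogeneous_zero _ _ _) hb
    (mt zero_dvd_iff.1 hb₀)
  have hbprime := prime_of_isHomogeneous_one hb hb₀
  have hbF : ¬ b ∣ ∏ l, ℓ l := fun hd => by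
    obtain ⟨l, -, c, hc⟩ := hbprime.exists_mem_finset_dvd hd
    exact hv l (by rw [hc, map_mul, hvb, zero_mul])
  rw [← hspan] at hp hs ⊢
  set S := Finset.univ.filter fun l => ℓ l ∈ Ideal.span {ℓ i, b} with hS
  have hcard : (S.card : k) ≠ 0 := Nat.cast_ne_zero.2 (Finset.card_ne_zero_of_mem
    (Finset.mem_filter.2 ⟨Finset.mem_univ i, Ideal.subset_span (by simp)⟩))
  have hP := localEuler_prod_of_mem_span_pair (h.isHomogeneous i) hb hvb S
    (fun l _ => h.isHomogeneous l) fun l hl => (Finset.mem_filter.1 hl).2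
  have hH : ∏ l with ℓ l ∉ Ideal.span {ℓ i, b}, ℓ l ∉ Ideal.span {ℓ i, b} := fun hmem => by
    obtain ⟨l, hl, hl'⟩ := hp.prod_mem_iff.1 hmem
    exact (Finset.mem_filter.1 hl).2 hl'
  rw [← Finset.prod_filter_mul_prod_filter_not Finset.univ (fun l => ℓ l ∈ Ideal.span {ℓ i, b}) ℓ,
    ← hS] at hbF hsJ ⊢
  refine ⟨(∏ l with ℓ l ∉ Ideal.span {ℓ i, b}, ℓ l) * b * s, fun f hf => ?_, fun f hf => ?_⟩
  · rw [mul_assoc]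
    exact mul_mem_span_pair_dirDeriv hP (hv i) (hsJ f hf)
  · rw [mul_assoc] at hf
    obtain ⟨u, hu, huf⟩ :=
      exists_mul_mem_jacobianIdeal_of_mul_mem hP hp hbprime hbF hH hcard (hv i) hwb hf
    exact ⟨u * s, hp.mul_notMem hu hs, by rwa [mul_assoc]⟩

theorem colon_colon_topCurveIdeal_le [CharZero k] [Nonempty ι] :
    (Ideal.span {∏ i, ℓ i, dirDeriv v (∏ i, ℓ i)}).colon
      ((Ideal.span {∏ i, ℓ i, dirDeriv v (∏ i, ℓ i)}).colon
        (topCurveIdeal (∏ i, ℓ i) : Set (CoordRing k)) : Set (CoordRing k)) ≤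
      topCurveIdeal (∏ i, ℓ i) := fun f hf =>
  (h.mem_topCurveIdeal_iff f).2 fun _ _ hij =>
    have ⟨Δ, hΔ, hΔ'⟩ := h.exists_residual_topCurveIdeal hv hij
    hΔ' f (mul_comm f Δ ▸ Submodule.mem_colon.1 hf Δ (Submodule.mem_colon.2 hΔ))

theorem colon_colon_redCurveIdeal_le [CharZero k] [Nonempty ι] :
    (Ideal.span {∏ i, ℓ i, dirDeriv v (∏ i, ℓ i)}).colon
      ((Ideal.span {∏ i, ℓ i, dirDeriv v (∏ i, ℓ i)}).colon
        (redCurveIdeal (∏ i, ℓ i) : Set (CoordRing k)) : Set (CoordRing k)) ≤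
      redCurveIdeal (∏ i, ℓ i) := fun f hf => by
  refine (h.mem_redCurveIdeal_iff f).2 fun i j hij => ?_
  obtain ⟨Δ, hΔ⟩ := h.exists_colon_eq_span hv hij
  rw [← hΔ, Submodule.mem_colon_singleton]
  refine Submodule.mem_colon.1 hf Δ (Submodule.mem_colon.2 fun g hg => ?_)
  rw [smul_eq_mul, mul_comm]
  exact Submodule.mem_colon_singleton.1 (hΔ.ge ((h.mem_redCurveIdeal_iff g).1 hg hij))

end Residual

attribute [local instance] MvPolynomial.gradedAlgebra

section Liaison

variable (h : IsArrangement ℓ) {L : CoordRing k} (hL : L.IsHomogeneous 1) (hLℓ : ∀ i, ¬ ℓ i ∣ L)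

include h hL hLℓ

theorem isEvenlyLinked_mul_add_of_colon_colon_le [CharZero k] [Nontrivial ι]
    {I : Ideal (CoordRing k)} (hI : I.IsHomogeneous (homogeneousSubmodule (Fin 4) k))
    (hJ : jacobianIdeal (∏ i, ℓ i) ≤ I)
    (hdual : ∀ v, (∀ i, eval v (ℓ i) ≠ 0) → (Ideal.span {∏ i, ℓ i, dirDeriv v (∏ i, ℓ i)}).colon
      ((Ideal.span {∏ i, ℓ i, dirDeriv v (∏ i, ℓ i)}).colon (I : Set (CoordRing k)) :
        Set (CoordRing k)) ≤ I) :
    IsEvenlyLinked I (Ideal.span {L} * I + Ideal.span {∏ i, ℓ i}) := by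
  obtain ⟨i, j, hij⟩ := exists_pair_ne ι
  obtain ⟨v, hv⟩ := h.exists_eval_ne_zero
  have hle : Ideal.span {∏ i, ℓ i, dirDeriv v (∏ i, ℓ i)} ≤ jacobianIdeal (∏ i, ℓ i) :=
    span_pair_le_iff.2 ⟨h.prod_mem_jacobianIdeal, dirDeriv_mem_jacobianIdeal v _⟩
  refine isEvenlyLinked_mul_add hI h.isHomogeneous_prod
    (isHomogeneous_dirDeriv h.isHomogeneous_prod v) hL h.prod_ne_zero
    (fun _ => (h.isRelPrime_prod _ (h.not_dvd_dirDeriv_prod hv)).dvd_of_dvd_mul_left)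
    (fun _ => (h.isRelPrime_prod _ hLℓ).dvd_of_dvd_mul_left)
    (ne_top_of_le_ne_top (h.isPrime_span hij).ne_top (hle.trans (jacobianIdeal_prod_le_span hij)))
    (hle.trans hJ) (le_antisymm (hdual v hv) fun f hf => Submodule.mem_colon.2 fun Δ hΔ => ?_)
  rw [smul_eq_mul, mul_comm]
  exact Submodule.mem_colon.1 hΔ f hf

theorem isEvenlyLinked_top [Nonempty ι] :
    IsEvenlyLinked (⊤ : Ideal (CoordRing k)) (Ideal.span {L} * ⊤ + Ideal.span {∏ i, ℓ i}) := by
  have hrel : ∀ x, ∏ i, ℓ i ∣ L * x → ∏ i, ℓ i ∣ x := fun _ =>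
    (h.isRelPrime_prod _ hLℓ).dvd_of_dvd_mul_left
  obtain ⟨i⟩ := ‹Nonempty ι›
  have hprime := isPrime_span_pair (h.isHomogeneous i) hL
    ((linearIndependent_pair_iff_not_dvd (h.isHomogeneous i) hL (h.ne_zero i)).2 (hLℓ i))
  refine isEvenlyLinked_mul_add (Ideal.IsHomogeneous.top _) h.isHomogeneous_prod hL hL
    h.prod_ne_zero hrel hrel (ne_top_of_le_ne_top hprime.ne_top (span_pair_le_iff.2 ⟨?_, ?_⟩))
    le_top ?_
  · exact Ideal.mem_of_dvd _ (Finset.dvd_prod_of_mem ℓ (Finset.mem_univ i))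
      (Ideal.subset_span (by simp))
  · exact Ideal.subset_span (by simp)
  · rw [Submodule.top_coe, Submodule.colon_univ, Submodule.colon_eq_top_iff_subset]

variable [CharZero k] [Nonempty ι]

theorem isEvenlyLinked_topCurveIdeal : IsEvenlyLinked (topCurveIdeal (∏ i, ℓ i))
    (Ideal.span {L} * topCurveIdeal (∏ i, ℓ i) + Ideal.span {∏ i, ℓ i}) := by
  rcases subsingleton_or_nontrivial ι with hι | hι
  · have htop : topCurveIdeal (∏ i, ℓ i) = ⊤ := eq_top_iff.2 fun f _ =>
      (h.mem_topCurveIdeal_iff f).2 fun i j hij => absurd (Subsingleton.elim i j) hij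
    rw [htop]
    exact h.isEvenlyLinked_top hL hLℓ
  · exact h.isEvenlyLinked_mul_add_of_colon_colon_le hL hLℓ h.isHomogeneous_topCurveIdeal
      (fun f hf => (h.mem_topCurveIdeal_iff f).2 fun i j hij =>
        ⟨1, (h.isPrime_span hij).one_notMem, by rwa [one_mul]⟩)
      fun v hv => h.colon_colon_topCurveIdeal_le hv

theorem isEvenlyLinked_redCurveIdeal : IsEvenlyLinked (redCurveIdeal (∏ i, ℓ i))
    (Ideal.span {L} * redCurveIdeal (∏ i, ℓ i) + Ideal.span {∏ i, ℓ i}) := by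
  rcases subsingleton_or_nontrivial ι with hι | hι
  · have htop : redCurveIdeal (∏ i, ℓ i) = ⊤ := eq_top_iff.2 fun f _ =>
      (h.mem_redCurveIdeal_iff f).2 fun i j hij => absurd (Subsingleton.elim i j) hij
    rw [htop]
    exact h.isEvenlyLinked_top hL hLℓ
  · exact h.isEvenlyLinked_mul_add_of_colon_colon_le hL hLℓ h.isHomogeneous_redCurveIdeal
      (fun f hf => (h.mem_redCurveIdeal_iff f).2 fun i j hij => jacobianIdeal_prod_le_span hij hf)
      fun v hv => h.colon_colon_redCurveIdeal_le hv

end Liaison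

end IsArrangement

section IdealAway

variable {k : Type*} [Field k] {I J : Ideal (CoordRing k)} {w : CoordRing k}

theorem mem_idealAway_iff {f : Frac k} :
    f ∈ idealAway I w ↔ ∃ n : ℕ, ∃ g ∈ I, algebraMap _ (Frac k) w ^ n * f = algebraMap _ _ g := by
  simp only [← map_pow, ← Algebra.smul_def]
  rfl

theorem algebraMap_frac_injective : Function.Injective (algebraMap (CoordRing k) (Frac k)) :=
  IsFractionRing.injective (CoordRing k) (Frac k)

theorem algebraMap_frac_ne_zero (hw : w ≠ 0) : algebraMap _ (Frac k) w ≠ 0 :=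
  (map_ne_zero_iff _ algebraMap_frac_injective).2 hw

theorem idealAway_mono (h : I ≤ J) (w : CoordRing k) : idealAway I w ≤ idealAway J w :=
  fun _ ⟨n, g, hg, hf⟩ => ⟨n, g, h hg, hf⟩

theorem idealAway_le_of_dvd_pow {w' : CoordRing k} {m : ℕ} (h : w ∣ w' ^ m) :
    idealAway I w ≤ idealAway I w' := by
  intro f hf
  rw [mem_idealAway_iff] at hf ⊢
  obtain ⟨n, g, hg, hf⟩ := hf
  obtain ⟨c, hc⟩ := h
  refine ⟨m * n, c ^ n * g, I.mul_mem_left _ hg, ?_⟩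
  rw [pow_mul, ← map_pow, hc, map_mul, mul_pow, map_mul, ← hf, map_pow]
  ring

theorem mul_mem_idealAway {a : CoordRing k} (h : ∀ x ∈ I, a * x ∈ J) {f : Frac k}
    (hf : f ∈ idealAway I w) : algebraMap _ (Frac k) a * f ∈ idealAway J w := by
  rw [mem_idealAway_iff] at hf ⊢
  obtain ⟨n, g, hg, hf⟩ := hf
  refine ⟨n, a * g, h g hg, ?_⟩
  rw [map_mul, ← hf]
  ring

theorem div_mem_idealAway {g : CoordRing k} (hw : w ≠ 0) (hg : g ∈ I) (n : ℕ) :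
    algebraMap _ (Frac k) g / algebraMap _ (Frac k) w ^ n ∈ idealAway I w :=
  mem_idealAway_iff.2 ⟨n, g, hg, mul_div_cancel₀ _ (pow_ne_zero _ (algebraMap_frac_ne_zero hw))⟩

end IdealAway

section Laurent

variable {k : Type*} [Field k]

/-- The Laurent monomial `∏ xₚ ^ eₚ` in the function field. -/
noncomputable def laurentMonomial (k : Type*) [Field k] (e : Fin 4 → ℤ) : Frac k :=
  ∏ p, algebraMap (CoordRing k) (Frac k) (X p) ^ e p

theorem laurentMonomial_add (e e' : Fin 4 → ℤ) :
    laurentMonomial k (e + e') = laurentMonomial k e * laurentMonomial k e' := by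
  rw [laurentMonomial, laurentMonomial, laurentMonomial, ← Finset.prod_mul_distrib]
  exact Finset.prod_congr rfl fun p _ => zpow_add₀ (algebraMap_frac_ne_zero (X_ne_zero p)) _ _

theorem laurentMonomial_natCast (e : Fin 4 →₀ ℕ) :
    laurentMonomial k (fun p => (e p : ℤ)) = algebraMap _ _ (monomial e (1 : k)) := by
  rw [monomial_eq, C_1, one_mul, Finsupp.prod_fintype _ _ fun p => pow_zero _, map_prod]
  exact Finset.prod_congr rfl fun p _ => by rw [zpow_natCast, map_pow]

theorem laurentMonomial_ite (S : Finset (Fin 4)) (n : ℤ) :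
    laurentMonomial k (fun p => if p ∈ S then n else 0) =
      algebraMap (CoordRing k) (Frac k) (∏ p ∈ S, X p) ^ n := by
  simp only [laurentMonomial, map_prod, ← Finset.prod_zpow, apply_ite, zpow_zero,
    Finset.prod_ite_mem, Finset.univ_inter]

theorem algebraMap_frac_eq_sum (g : CoordRing k) :
    algebraMap (CoordRing k) (Frac k) g =
      ∑ e ∈ g.support, coeff e g • laurentMonomial k (fun p => (e p : ℤ)) := by
  conv_lhs => rw [g.as_sum, map_sum (algebraMap (CoordRing k) (Frac k))]
  refine Finset.sum_congr rfl fun e _ => ?_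
  rw [laurentMonomial_natCast, ← algebraMap_smul (CoordRing k) (coeff e g), algebraMap_eq,
    Algebra.smul_def, ← map_mul, C_mul_monomial, mul_one]

theorem algebraMap_monomial_toNat {e : Fin 4 → ℤ} (he : 0 ≤ e) :
    algebraMap _ (Frac k) (monomial (Finsupp.equivFunOnFinite.symm fun p => (e p).toNat) (1 : k)) =
      laurentMonomial k e := by
  rw [← laurentMonomial_natCast]
  congr 1
  ext p
  exact Int.toNat_of_nonneg (he p)

theorem linearIndependent_laurentMonomial : LinearIndependent k (laurentMonomial k) := by
  rw [linearIndependent_iff_finset_linearIndependent]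
  intro s
  -- multiplying by a large power of `x₀x₁x₂x₃` turns the monomials in `s` into polynomials
  let N : Fin 4 → ℤ := fun p => ∑ e ∈ s, |e p|
  have hN (e : s) : 0 ≤ N + e.1 := fun p => by
    have := Finset.single_le_sum (f := fun e : Fin 4 → ℤ => |e p|) (fun e _ => abs_nonneg (e p)) e.2
    have := neg_abs_le (e.1 p)
    simp only [Pi.zero_apply, Pi.add_apply, N]
    linarith
  have hinj : Function.Injective fun e : s =>
      Finsupp.equivFunOnFinite.symm fun p => ((N + e.1) p).toNat := fun e e' h =>
    Subtype.ext <| funext fun p => by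
      have h1 := DFunLike.congr_fun h p
      have h2 := hN e p
      have h3 := hN e' p
      simp only [Finsupp.equivFunOnFinite_symm_apply_apply, Pi.add_apply, Pi.zero_apply] at h1 h2 h3
      omega
  have hli := (((basisMonomials (Fin 4) k).linearIndependent.comp _ hinj).map'
    ((IsScalarTower.toAlgHom k (CoordRing k) (Frac k)).toLinearMap)
    (LinearMap.ker_eq_bot.2 algebraMap_frac_injective))
  refine LinearIndependent.of_comp (LinearMap.mulLeft k (laurentMonomial k N)) ?_
  have hcomp : LinearMap.mulLeft k (laurentMonomial k N) ∘ (fun e : s => laurentMonomial k e) =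
      (IsScalarTower.toAlgHom k (CoordRing k) (Frac k)).toLinearMap ∘ basisMonomials (Fin 4) k ∘
        fun e : s => Finsupp.equivFunOnFinite.symm fun p => ((N + e.1) p).toNat := by
    ext e
    simp only [Function.comp_apply, LinearMap.mulLeft_apply, ← laurentMonomial_add,
      coe_basisMonomials, AlgHom.toLinearMap_apply, IsScalarTower.coe_toAlgHom']
    exact (algebraMap_monomial_toNat (hN e)).symm
  exact hcomp ▸ hli

theorem laurentMonomial_mem_idealAway {S : Finset (Fin 4)} {e : Fin 4 → ℤ}
    (he : ∀ p ∉ S, 0 ≤ e p) : laurentMonomial k e ∈ idealAway ⊤ (∏ p ∈ S, X p : CoordRing k) := by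
  set n := ∑ p, (e p).natAbs
  have hn : 0 ≤ (fun p => if p ∈ S then (n : ℤ) else 0) + e := fun p => by
    have := Finset.single_le_sum (f := fun p => (e p).natAbs) (fun p _ => Nat.zero_le _)
      (Finset.mem_univ p)
    by_cases hp : p ∈ S
    · simp only [Pi.zero_apply, Pi.add_apply, if_pos hp]
      omega
    · simpa only [Pi.zero_apply, Pi.add_apply, if_neg hp, zero_add] using he p hp
  refine mem_idealAway_iff.2 ⟨n, monomial (Finsupp.equivFunOnFinite.symm fun p =>
    (((fun p => if p ∈ S then (n : ℤ) else 0) + e) p).toNat) 1, Submodule.mem_top, ?_⟩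
  rw [← zpow_natCast, ← laurentMonomial_ite, ← laurentMonomial_add, algebraMap_monomial_toNat hn]

theorem idealAway_top_induction {S : Finset (Fin 4)} {f : Frac k}
    (hf : f ∈ idealAway ⊤ (∏ p ∈ S, X p : CoordRing k)) {M : Submodule k (Frac k)}
    (hM : ∀ e : Fin 4 → ℤ, (∀ p ∉ S, 0 ≤ e p) → laurentMonomial k e ∈ M) : f ∈ M := by
  obtain ⟨n, g, -, hg⟩ := mem_idealAway_iff.1 hf
  have hS : algebraMap _ (Frac k) (∏ p ∈ S, X p : CoordRing k) ≠ 0 :=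
    algebraMap_frac_ne_zero (Finset.prod_ne_zero_iff.2 fun p _ => X_ne_zero p)
  have hfg : f = laurentMonomial k (fun p => if p ∈ S then -(n : ℤ) else 0) *
      algebraMap _ (Frac k) g := by
    rw [laurentMonomial_ite, zpow_neg, zpow_natCast, ← hg, inv_mul_cancel_left₀ (pow_ne_zero _ hS)]
  rw [hfg, algebraMap_frac_eq_sum, Finset.mul_sum]
  refine Submodule.sum_mem _ fun e _ => ?_
  rw [mul_smul_comm, ← laurentMonomial_add]
  refine M.smul_mem _ (hM _ fun p hp => ?_)
  simp [hp]

/-- A `k`-linear projection of the function field which maps a Laurent polynomial to the part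
with exponents satisfying `P`; its values elsewhere are arbitrary. -/
noncomputable def laurentProj (k : Type*) [Field k] (P : (Fin 4 → ℤ) → Prop) [DecidablePred P] :
    Frac k →ₗ[k] Frac k :=
  Finsupp.linearCombination k (fun e => if P e then laurentMonomial k e else 0) ∘ₗ
    Classical.choose (LinearMap.exists_leftInverse_of_injective
      (Finsupp.linearCombination k (laurentMonomial k))
      (LinearMap.ker_eq_bot.2 linearIndependent_laurentMonomial))

theorem laurentProj_laurentMonomial (P : (Fin 4 → ℤ) → Prop) [DecidablePred P] (e : Fin 4 → ℤ) :
    laurentProj k P (laurentMonomial k e) = if P e then laurentMonomial k e else 0 := by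
  have h := LinearMap.congr_fun (Classical.choose_spec (LinearMap.exists_leftInverse_of_injective
    (Finsupp.linearCombination k (laurentMonomial k))
    (LinearMap.ker_eq_bot.2 linearIndependent_laurentMonomial))) (Finsupp.single e 1)
  rw [LinearMap.comp_apply, Finsupp.linearCombination_single, one_smul, LinearMap.id_apply] at h
  rw [laurentProj, LinearMap.comp_apply, h, Finsupp.linearCombination_single, one_smul]

theorem laurentProj_mem {P : (Fin 4 → ℤ) → Prop} [DecidablePred P] {S : Finset (Fin 4)}
    {M : Submodule k (Frac k)}
    (hM : ∀ e : Fin 4 → ℤ, (∀ p ∉ S, 0 ≤ e p) → P e → laurentMonomial k e ∈ M) {f : Frac k}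
    (hf : f ∈ idealAway ⊤ (∏ p ∈ S, X p : CoordRing k)) : laurentProj k P f ∈ M := by
  refine idealAway_top_induction (M := M.comap (laurentProj k P)) hf fun e he => ?_
  rw [Submodule.mem_comap, laurentProj_laurentMonomial]
  split_ifs with hP
  exacts [hM e he hP, M.zero_mem]

theorem exists_contraction (k : Type*) [Field k] :
    ∃ ρ : Fin 4 → Frac k →ₗ[k] Frac k,
      (∀ S : Finset (Fin 4), ∀ f ∈ idealAway ⊤ (∏ p ∈ S, X p : CoordRing k), ∑ p, ρ p f = f) ∧
      ∀ (p : Fin 4) (S : Finset (Fin 4)), S.card ≤ 2 →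
        ∀ f ∈ idealAway ⊤ (∏ q ∈ insert p S, X q : CoordRing k),
          ρ p f ∈ idealAway ⊤ (∏ q ∈ S, X q : CoordRing k) := by
  classical
  obtain ⟨π, hπ⟩ : ∃ π : (Fin 4 → ℤ) → Fin 4, ∀ e : Fin 4 → ℤ, (∃ q, 0 ≤ e q) →
      0 ≤ e (π e) :=
    ⟨fun e => if h : ∃ q, 0 ≤ e q then h.choose else 0, fun e h => by
      simpa only [dif_pos h] using h.choose_spec⟩
  refine ⟨fun p => laurentProj k (π · = p), fun S f hf => ?_, fun p S hS f hf => ?_⟩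
  · have := idealAway_top_induction hf
      (M := LinearMap.eqLocus (∑ p, laurentProj k (π · = p)) LinearMap.id) fun e _ => by
        simp only [LinearMap.mem_eqLocus, LinearMap.sum_apply, laurentProj_laurentMonomial,
          Finset.sum_ite_eq, Finset.mem_univ, if_true, LinearMap.id_apply]
    rwa [LinearMap.mem_eqLocus, LinearMap.sum_apply] at this
  · refine laurentProj_mem (M := (idealAway ⊤ _).restrictScalars k) (fun e he hp => ?_) hf
    refine laurentMonomial_mem_idealAway fun q hq => ?_
    by_cases hqp : q = p
    · obtain ⟨r, -, hr⟩ := Finset.exists_mem_notMem_of_card_lt_card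
        (s := insert p S) (t := Finset.univ) (by
          have := Finset.card_insert_le p S
          rw [Finset.card_univ, Fintype.card_fin]
          omega)
      rw [hqp, ← hp]
      exact hπ e ⟨r, he r hr⟩
    · exact he q (by simp only [Finset.mem_insert, hqp, hq, or_self, not_false_eq_true])

end Laurent

section Cech

variable {k : Type*} [Field k]

theorem idealAway_X (I : Ideal (CoordRing k)) (i : Fin 4) :
    idealAway I (X i) = idealAway I (∏ p ∈ {i}, X p) := by
  rw [Finset.prod_singleton]

theorem idealAway_prod_X_mono (I : Ideal (CoordRing k)) {S T : Finset (Fin 4)} (h : S ⊆ T) :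
    idealAway I (∏ p ∈ S, X p) ≤ idealAway I (∏ p ∈ T, X p) :=
  idealAway_le_of_dvd_pow (m := 1) <| by
    rw [pow_one]
    exact Finset.prod_dvd_prod_of_subset _ _ _ h

theorem idealAway_X_mul_X (I : Ideal (CoordRing k)) (i j : Fin 4) :
    idealAway I (X i * X j) = idealAway I (∏ p ∈ {i, j}, X p) := by
  by_cases h : i = j
  · rw [← h, Finset.pair_eq_singleton, Finset.prod_singleton]
    exact le_antisymm (idealAway_le_of_dvd_pow (m := 2) (sq (X i : CoordRing k)).symm.dvd)
      (idealAway_le_mul I _ _)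
  · rw [Finset.prod_pair h]

theorem idealAway_X_le_mul_X (I : Ideal (CoordRing k)) (i j : Fin 4) :
    idealAway I (X j) ≤ idealAway I (X i * X j) := by
  rw [mul_comm]
  exact idealAway_le_mul I _ _

theorem exists_cochain_of_cocycle_one {r : Fin 4 → Fin 4 → Frac k}
    (hr : ∀ i j, r i j ∈ idealAway ⊤ (X i * X j : CoordRing k))
    (hr' : ∀ i j l, r j l - r i l + r i j = 0) :
    ∃ t : Fin 4 → Frac k, (∀ i, t i ∈ idealAway ⊤ (X i : CoordRing k)) ∧
      ∀ i j, r i j = t j - t i := by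
  simp only [idealAway_X_mul_X, idealAway_X] at hr ⊢
  obtain ⟨ρ, hρ, hρS⟩ := exists_contraction k
  refine ⟨fun i => ∑ p, ρ p (r p i), fun i => Submodule.sum_mem _ fun p _ =>
    hρS p {i} (by simp) _ (hr p i), fun i j => ?_⟩
  rw [← hρ _ _ (hr i j), ← Finset.sum_sub_distrib]
  refine Finset.sum_congr rfl fun p _ => ?_
  rw [← map_sub]
  congr 1
  linear_combination hr' p i j

theorem exists_cochain_of_cocycle_two {s : Fin 4 → Fin 4 → Fin 4 → Frac k}
    (hs : ∀ i j l, s i j l ∈ idealAway ⊤ (∏ p ∈ {i, j, l}, X p : CoordRing k))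
    (hs' : ∀ i j l p, s j l p - s i l p + s i j p - s i j l = 0) :
    ∃ t : Fin 4 → Fin 4 → Frac k, (∀ i j, t i j ∈ idealAway ⊤ (X i * X j : CoordRing k)) ∧
      ∀ i j l, s i j l = t j l - t i l + t i j := by
  simp only [idealAway_X_mul_X]
  obtain ⟨ρ, hρ, hρS⟩ := exists_contraction k
  refine ⟨fun i j => ∑ p, ρ p (s p i j), fun i j => Submodule.sum_mem _ fun p _ =>
    hρS p {i, j} Finset.card_le_two _ (hs p i j), fun i j l => ?_⟩
  rw [← hρ _ _ (hs i j l), ← Finset.sum_sub_distrib, ← Finset.sum_add_distrib]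
  refine Finset.sum_congr rfl fun p _ => ?_
  rw [← map_sub, ← map_add]
  congr 1
  linear_combination hs' p i j l

end Cech

section Grading

attribute [local instance] MvPolynomial.gradedAlgebra

variable {k : Type*} [Field k]

theorem laurentMonomial_mem_fracDegree (e : Fin 4 → ℤ) :
    laurentMonomial k e ∈ fracDegree k (∑ p, e p) := by
  have hmon (f : Fin 4 → ℕ) : (monomial (Finsupp.equivFunOnFinite.symm f) (1 : k)).IsHomogeneous
      (∑ p, f p) :=
    isHomogeneous_monomial _ (Finsupp.degree_eq_sum _)
  have he : e + (fun p => ((-e p).toNat : ℤ)) = fun p => ((e p).toNat : ℤ) := by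
    ext p
    simp only [Pi.add_apply]
    omega
  refine ⟨_, _, _, _, hmon fun p => (e p).toNat, hmon fun p => (-e p).toNat,
    by rw [Ne, monomial_eq_zero]; exact one_ne_zero, ?_, ?_⟩
  · rw [eq_div_iff (algebraMap_frac_ne_zero (by rw [Ne, monomial_eq_zero]; exact one_ne_zero)),
      ← laurentMonomial_natCast, ← laurentMonomial_natCast, ← laurentMonomial_add]
    exact congrArg _ he
  · rw [Nat.cast_sum, Nat.cast_sum, ← Finset.sum_sub_distrib]
    exact Finset.sum_congr rfl fun p _ => by omega

/-- The projection of Laurent polynomials onto their part of degree `t`. -/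
noncomputable def degreeProj (k : Type*) [Field k] (t : ℤ) : Frac k →ₗ[k] Frac k :=
  laurentProj k fun e => ∑ p, e p = t

theorem degreeProj_mem_fracDegree (t : ℤ) {f : Frac k}
    (hf : f ∈ idealAway ⊤ (∏ p, X p : CoordRing k)) : degreeProj k t f ∈ fracDegree k t :=
  laurentProj_mem (fun e _ he => he ▸ laurentMonomial_mem_fracDegree e) hf

theorem degreeProj_algebraMap_mul {w : CoordRing k} {d : ℕ} (hw : w.IsHomogeneous d) (t : ℤ)
    {f : Frac k} (hf : f ∈ idealAway ⊤ (∏ p, X p : CoordRing k)) :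
    degreeProj k (t + d) (algebraMap _ (Frac k) w * f) =
      algebraMap _ (Frac k) w * degreeProj k t f := by
  refine idealAway_top_induction hf (M := LinearMap.eqLocus
    (degreeProj k (t + d) ∘ₗ LinearMap.mulLeft k (algebraMap _ (Frac k) w))
    (LinearMap.mulLeft k (algebraMap _ (Frac k) w) ∘ₗ degreeProj k t)) fun e _ => ?_
  simp only [LinearMap.mem_eqLocus, LinearMap.comp_apply, LinearMap.mulLeft_apply]
  rw [algebraMap_frac_eq_sum, Finset.sum_mul, Finset.sum_mul, map_sum]
  refine Finset.sum_congr rfl fun a ha => ?_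
  have had : ∑ p, (a p : ℤ) = d := by
    rw [← Nat.cast_sum, ← Finsupp.degree_eq_sum, Finsupp.degree_eq_weight_one]
    exact congrArg _ (hw (mem_support_iff.1 ha))
  rw [smul_mul_assoc, smul_mul_assoc, map_smul, ← laurentMonomial_add, degreeProj, degreeProj,
    laurentProj_laurentMonomial, laurentProj_laurentMonomial, mul_ite, mul_zero,
    ← laurentMonomial_add]
  simp only [Pi.add_apply, Finset.sum_add_distrib, had, add_comm (d : ℤ), add_left_inj]

theorem one_mem_idealAway_top (w : CoordRing k) : (1 : Frac k) ∈ idealAway ⊤ w :=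
  mem_idealAway_iff.2 ⟨0, 1, Submodule.mem_top, by rw [pow_zero, one_mul, map_one]⟩

theorem degreeProj_algebraMap {g : CoordRing k} {d : ℕ} (hg : g.IsHomogeneous d) (t : ℤ) :
    degreeProj k t (algebraMap _ (Frac k) g) =
      if (d : ℤ) = t then algebraMap _ (Frac k) g else 0 := by
  have h := degreeProj_algebraMap_mul hg (t - d) (one_mem_idealAway_top (k := k) (∏ p, X p))
  have h1 : (1 : Frac k) = laurentMonomial k 0 := by
    simp only [laurentMonomial, Pi.zero_apply, zpow_zero, Finset.prod_const_one]
  rw [mul_one, sub_add_cancel, h1, degreeProj, degreeProj, laurentProj_laurentMonomial, ← h1] at h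
  rw [degreeProj, h, mul_ite, mul_one, mul_zero]
  simp only [Pi.zero_apply, Finset.sum_const_zero, eq_sub_iff_add_eq, zero_add]

theorem exists_degreeProj_algebraMap_eq {I : Ideal (CoordRing k)}
    (hI : I.IsHomogeneous (homogeneousSubmodule (Fin 4) k)) {g : CoordRing k} (hg : g ∈ I) (t : ℤ) :
    ∃ g' ∈ I, degreeProj k t (algebraMap _ (Frac k) g) = algebraMap _ (Frac k) g' := by
  refine ⟨∑ i ∈ Finset.range (g.totalDegree + 1),
    if (i : ℤ) = t then homogeneousComponent i g else 0, I.sum_mem fun i _ => ?_, ?_⟩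
  · split_ifs
    exacts [homogeneousComponent_mem_of_mem hI hg i, I.zero_mem]
  · conv_lhs => rw [← sum_homogeneousComponent g]
    rw [map_sum, map_sum, map_sum]
    refine Finset.sum_congr rfl fun i _ => ?_
    rw [degreeProj_algebraMap (homogeneousComponent_isHomogeneous i g)]
    split_ifs
    exacts [rfl, (map_zero _).symm]

theorem degreeProj_mem_idealAway {I : Ideal (CoordRing k)}
    (hI : I.IsHomogeneous (homogeneousSubmodule (Fin 4) k)) {w : CoordRing k} {d : ℕ}
    (hw : w.IsHomogeneous d) (t : ℤ) {f : Frac k} (hf : f ∈ idealAway I w)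
    (hf' : f ∈ idealAway ⊤ (∏ p, X p : CoordRing k)) : degreeProj k t f ∈ idealAway I w := by
  obtain ⟨n, g, hg, hfg⟩ := mem_idealAway_iff.1 hf
  obtain ⟨g', hg', h⟩ := exists_degreeProj_algebraMap_eq hI hg (t + (d * n : ℕ))
  refine mem_idealAway_iff.2 ⟨n, g', hg', ?_⟩
  rw [← h, ← hfg, ← map_pow, degreeProj_algebraMap_mul (hw.pow n) t hf']

theorem degreeProj_eq_self {t : ℤ} {f : Frac k} (hf : f ∈ fracDegree k t)
    (hf' : f ∈ idealAway ⊤ (∏ p, X p : CoordRing k)) : degreeProj k t f = f := by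
  obtain ⟨p, q, a, b, hp, hq, hq₀, rfl, hab⟩ := hf
  have hq' := algebraMap_frac_ne_zero hq₀
  apply mul_left_cancel₀ hq'
  rw [← degreeProj_algebraMap_mul hq t hf', mul_div_cancel₀ _ hq', degreeProj_algebraMap hp,
    if_pos (by omega)]

theorem algebraMap_mul_mem_fracDegree {L : CoordRing k} {d : ℕ} (hL : L.IsHomogeneous d) {t : ℤ}
    {f : Frac k} (hf : f ∈ fracDegree k t) :
    algebraMap _ (Frac k) L * f ∈ fracDegree k (t + d) := by
  obtain ⟨p, q, a, b, hp, hq, hq₀, rfl, hab⟩ := hf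
  refine ⟨L * p, q, d + a, b, hL.mul hp, hq, hq₀, ?_, by push_cast; omega⟩
  rw [map_mul, mul_div_assoc]

theorem idealAway_X_le_prod (I : Ideal (CoordRing k)) (i : Fin 4) :
    idealAway I (X i) ≤ idealAway ⊤ (∏ p, X p) := by
  rw [idealAway_X]
  exact (idealAway_prod_X_mono I (Finset.subset_univ _)).trans (idealAway_mono le_top _)

theorem idealAway_X_mul_X_le_prod (I : Ideal (CoordRing k)) (i j : Fin 4) :
    idealAway I (X i * X j) ≤ idealAway ⊤ (∏ p, X p) := by
  rw [idealAway_X_mul_X]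
  exact (idealAway_prod_X_mono I (Finset.subset_univ _)).trans (idealAway_mono le_top _)

theorem exists_homogeneous_cocycle {I J : Ideal (CoordRing k)}
    (hI : I.IsHomogeneous (homogeneousSubmodule (Fin 4) k))
    (hJ : J.IsHomogeneous (homogeneousSubmodule (Fin 4) k)) {L : CoordRing k} {d : ℕ}
    (hL : L.IsHomogeneous d) {t : ℤ} {c c' : Fin 4 → Fin 4 → Frac k} (hc : c ∈ cocycles I)
    (hc' : c' ∈ cocycles J) (hct : ∀ i j, c' i j ∈ fracDegree k (t + d))
    (h : L • c - c' ∈ coboundaries J) :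
    ∃ x ∈ cocycles I, (∀ i j, x i j ∈ fracDegree k t) ∧ L • x - c' ∈ coboundaries J := by
  obtain ⟨b, hb, hcb⟩ := h
  have hcU i j := idealAway_X_mul_X_le_prod I i j (hc.1 i j)
  refine ⟨fun i j => degreeProj k t (c i j),
    ⟨fun i j => degreeProj_mem_idealAway hI ((isHomogeneous_X k i).mul (isHomogeneous_X k j)) t
      (hc.1 i j) (hcU i j), fun i j l => ?_⟩,
    fun i j => degreeProj_mem_fracDegree t (hcU i j),
    fun i => degreeProj k (t + d) (b i),
    fun i => degreeProj_mem_idealAway hJ (isHomogeneous_X k i) _ (hb i)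
      (idealAway_X_le_prod J i (hb i)), fun i j => ?_⟩
  · rw [← map_sub, ← map_add, hc.2, map_zero]
  · rw [← map_sub, ← hcb]
    change L • degreeProj k t (c i j) - c' i j = degreeProj k (t + d) (L • c i j - c' i j)
    rw [map_sub, Algebra.smul_def, Algebra.smul_def, degreeProj_algebraMap_mul hL t (hcU i j),
      degreeProj_eq_self (hct i j) (idealAway_X_mul_X_le_prod J i j (hc'.1 i j))]

end Grading

section HRShift

attribute [local instance] MvPolynomial.gradedAlgebra

variable {k : Type*} [Field k] {I : Ideal (CoordRing k)} {F L w : CoordRing k}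

theorem exists_of_mem_idealAway_mul_add (hw : w ≠ 0) {x : Frac k}
    (hx : x ∈ idealAway (Ideal.span {L} * I + Ideal.span {F}) w) :
    ∃ a ∈ idealAway I w, ∃ r ∈ idealAway ⊤ w,
      x = algebraMap _ (Frac k) L * a + algebraMap _ (Frac k) F * r := by
  obtain ⟨n, g, hg, hx⟩ := mem_idealAway_iff.1 hx
  obtain ⟨a, ha, r, rfl⟩ := mem_span_mul_add_span_iff.1 hg
  refine ⟨_, div_mem_idealAway hw ha n, _, div_mem_idealAway hw (Submodule.mem_top (x := r)) n, ?_⟩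
  have hw' := pow_ne_zero n (algebraMap_frac_ne_zero hw)
  field_simp
  rw [mul_comm x, hx, map_add, map_mul, map_mul, mul_comm (algebraMap _ _ r)]

theorem mem_idealAway_of_mul_mem (hL₀ : L ≠ 0) (hFL : ∀ x, L ∣ F * x → L ∣ x) {s : Frac k}
    (hLs : algebraMap _ (Frac k) L * s ∈ idealAway ⊤ w)
    (hFs : algebraMap _ (Frac k) F * s ∈ idealAway ⊤ w) : s ∈ idealAway ⊤ w := by
  obtain ⟨n, y, -, hy⟩ := mem_idealAway_iff.1 hLs
  obtain ⟨m, z, -, hz⟩ := mem_idealAway_iff.1 hFs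
  have hyz : F * (w ^ m * y) = L * (w ^ n * z) := by
    apply algebraMap_frac_injective
    simp only [map_mul, map_pow, ← hy, ← hz]
    ring
  obtain ⟨x, hx⟩ := hFL _ ⟨_, hyz⟩
  refine mem_idealAway_iff.2 ⟨m + n, x, Submodule.mem_top, ?_⟩
  apply mul_left_cancel₀ (algebraMap_frac_ne_zero hL₀)
  rw [← map_mul, ← hx, map_mul, ← hy, map_pow]
  ring

theorem mem_coboundaries_of_smul_mem (hF : F ∈ I) (hL₀ : L ≠ 0) (hFL : ∀ x, L ∣ F * x → L ∣ x)
    {c : Fin 4 → Fin 4 → Frac k} (hc : c ∈ cocycles I)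
    (h : L • c ∈ coboundaries (Ideal.span {L} * I + Ideal.span {F})) : c ∈ coboundaries I := by
  obtain ⟨b, hb, hcb⟩ := h
  replace hcb (i j) : algebraMap _ (Frac k) L * c i j = b j - b i :=
    (Algebra.smul_def L (c i j)).symm.trans (hcb i j)
  choose a ha r hr hbr using fun i => exists_of_mem_idealAway_mul_add (X_ne_zero i) (hb i)
  have hL' := algebraMap_frac_ne_zero hL₀
  have hc_eq (i j) : c i j = a j - a i +
      algebraMap _ _ F * ((r j - r i) / algebraMap _ (Frac k) L) := by
    apply mul_left_cancel₀ hL'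
    field_simp
    linear_combination hcb i j + hbr j - hbr i
  have hs (i j) : (r j - r i) / algebraMap _ (Frac k) L ∈ idealAway ⊤ (X i * X j) := by
    apply mem_idealAway_of_mul_mem hL₀ hFL
    · rw [mul_div_cancel₀ _ hL']
      exact Submodule.sub_mem _ (idealAway_X_le_mul_X _ i j (hr j)) (idealAway_le_mul _ _ _ (hr i))
    · rw [← sub_eq_of_eq_add' (hc_eq i j)]
      exact idealAway_mono le_top _ (Submodule.sub_mem _ (hc.1 i j)
        (Submodule.sub_mem _ (idealAway_X_le_mul_X _ i j (ha j)) (idealAway_le_mul _ _ _ (ha i))))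
  obtain ⟨t, ht, hst⟩ := exists_cochain_of_cocycle_one hs fun i j l => by ring
  refine ⟨fun i => a i + algebraMap _ _ F * t i, fun i => Submodule.add_mem _ (ha i)
    (mul_mem_idealAway (fun x _ => I.mul_mem_right _ hF) (ht i)), fun i j => ?_⟩
  rw [hc_eq, hst]
  ring

theorem cochain_add_mem_idealAway (I : Ideal (CoordRing k)) {x : Fin 4 → Fin 4 → Frac k}
    (hx : ∀ i j, x i j ∈ idealAway I (X i * X j)) (i j l : Fin 4) :
    x j l - x i l + x i j ∈ idealAway ⊤ (∏ p ∈ {i, j, l}, X p : CoordRing k) := by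
  have hmem {i' j' : Fin 4} (h : {i', j'} ⊆ ({i, j, l} : Finset (Fin 4))) :
      x i' j' ∈ idealAway I (∏ p ∈ {i, j, l}, X p) :=
    idealAway_prod_X_mono I h (idealAway_X_mul_X I i' j' ▸ hx i' j')
  refine idealAway_mono le_top _ (Submodule.add_mem _ (Submodule.sub_mem _ (hmem ?_) (hmem ?_))
    (hmem ?_)) <;> simp [Finset.insert_subset_iff]

theorem exists_cocycles_eq_add (hF : F ∈ I) (hL₀ : L ≠ 0) (hFL : ∀ x, L ∣ F * x → L ∣ x)
    {c : Fin 4 → Fin 4 → Frac k} (hc : c ∈ cocycles (Ideal.span {L} * I + Ideal.span {F})) :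
    ∃ a ∈ cocycles I, ∃ r ∈ cocycles (⊤ : Ideal (CoordRing k)), ∀ i j,
      c i j = algebraMap _ (Frac k) L * a i j + algebraMap _ (Frac k) F * r i j := by
  choose a ha r hr hcr using fun i j =>
    exists_of_mem_idealAway_mul_add (mul_ne_zero (X_ne_zero i) (X_ne_zero j)) (hc.1 i j)
  have hL' := algebraMap_frac_ne_zero hL₀
  -- `L δa + F δr = δc = 0`, so `δr = -L s` and `δa = F s` for a 2-cocycle `s`
  set s : Fin 4 → Fin 4 → Fin 4 → Frac k :=
    fun i j l => -(r j l - r i l + r i j) / algebraMap _ (Frac k) L with hs_def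
  have hrs (i j l) : r j l - r i l + r i j = -(algebraMap _ _ L * s i j l) := by
    rw [hs_def]
    field_simp
  have has (i j l) : a j l - a i l + a i j = algebraMap _ _ F * s i j l := by
    apply mul_left_cancel₀ hL'
    linear_combination hc.2 i j l - hcr j l + hcr i l - hcr i j - algebraMap _ _ F * hrs i j l
  have hs (i j l) : s i j l ∈ idealAway ⊤ (∏ p ∈ {i, j, l}, X p) := by
    apply mem_idealAway_of_mul_mem hL₀ hFL
    · rw [← neg_eq_iff_eq_neg.2 (hrs i j l)]
      exact Submodule.neg_mem _ (cochain_add_mem_idealAway _ hr i j l)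
    · rw [← has]
      exact cochain_add_mem_idealAway _ ha i j l
  obtain ⟨t, ht, hst⟩ := exists_cochain_of_cocycle_two hs fun i j l p => by
    rw [hs_def]
    ring
  refine ⟨fun i j => a i j - algebraMap _ _ F * t i j, ⟨fun i j => Submodule.sub_mem _ (ha i j)
      (mul_mem_idealAway (fun x _ => I.mul_mem_right _ hF) (ht i j)), fun i j l => ?_⟩,
    fun i j => r i j + algebraMap _ _ L * t i j, ⟨fun i j => Submodule.add_mem _ (hr i j)
      (mul_mem_idealAway (fun _ _ => Submodule.mem_top) (ht i j)), fun i j l => ?_⟩,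
    fun i j => ?_⟩
  · linear_combination has i j l + algebraMap _ (Frac k) F * hst i j l
  · linear_combination hrs i j l - algebraMap _ (Frac k) L * hst i j l
  · linear_combination hcr i j

theorem exists_sub_smul_mem_coboundaries (hF : F ∈ I) (hL₀ : L ≠ 0)
    (hFL : ∀ x, L ∣ F * x → L ∣ x) {c : Fin 4 → Fin 4 → Frac k}
    (hc : c ∈ cocycles (Ideal.span {L} * I + Ideal.span {F})) :
    ∃ c' ∈ cocycles I, L • c' - c ∈ coboundaries (Ideal.span {L} * I + Ideal.span {F}) := by
  obtain ⟨a, ha, r, hr, hcr⟩ := exists_cocycles_eq_add hF hL₀ hFL hc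
  obtain ⟨t, ht, hrt⟩ := exists_cochain_of_cocycle_one hr.1 hr.2
  refine ⟨a, ha, fun i => -(algebraMap _ _ F * t i), fun i => Submodule.neg_mem _
    (mul_mem_idealAway (fun x _ => Submodule.mem_sup_right
      (Ideal.mul_mem_right x _ (Ideal.mem_span_singleton_self F))) (ht i)), fun i j => ?_⟩
  rw [Pi.sub_apply, Pi.sub_apply, Pi.smul_apply, Pi.smul_apply, Algebra.smul_def]
  linear_combination -hcr i j - algebraMap _ (Frac k) F * hrt i j

/-- Multiplication by `L` on Hartshorne–Rao modules, for `L I ⊆ J`. -/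
noncomputable def mulHR {I J : Ideal (CoordRing k)} (L : CoordRing k) (h : ∀ x ∈ I, L * x ∈ J) :
    HRModule I →ₗ[CoordRing k] HRModule J :=
  Submodule.mapQ _ _
    ((LinearMap.lsmul (CoordRing k) (Fin 4 → Fin 4 → Frac k) L).restrict
      (p := cocycles I) (q := cocycles J) fun c hc =>
        ⟨fun i j => Set.mem_of_eq_of_mem (Algebra.smul_def L (c i j))
          (mul_mem_idealAway h (hc.1 i j)),
          ((cocycles I).smul_mem L hc).2⟩)
    (by
      rintro c ⟨b, hb, hcb⟩
      exact ⟨L • b, fun i => Set.mem_of_eq_of_mem (Algebra.smul_def L (b i))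
        (mul_mem_idealAway h (hb i)),
        fun i j => (congrArg (L • ·) (hcb i j)).trans (smul_sub L _ _)⟩)

theorem mkQ_eq_iff {c d : cocycles I} :
    ((coboundaries I).submoduleOf (cocycles I)).mkQ c =
      ((coboundaries I).submoduleOf (cocycles I)).mkQ d ↔ c.1 - d.1 ∈ coboundaries I :=
  Submodule.Quotient.eq _

theorem exists_mulHR_mkQ_eq {J : Ideal (CoordRing k)} (h : ∀ x ∈ I, L * x ∈ J) (c : cocycles I) :
    ∃ c' : cocycles J, c'.1 = L • c.1 ∧
      mulHR L h (((coboundaries I).submoduleOf (cocycles I)).mkQ c) =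
        ((coboundaries J).submoduleOf (cocycles J)).mkQ c' :=
  ⟨_, rfl, rfl⟩

theorem mulHR_mkQ_eq_iff {J : Ideal (CoordRing k)} (h : ∀ x ∈ I, L * x ∈ J) {c : cocycles I}
    {d : cocycles J} :
    mulHR L h (((coboundaries I).submoduleOf (cocycles I)).mkQ c) =
      ((coboundaries J).submoduleOf (cocycles J)).mkQ d ↔ L • c.1 - d.1 ∈ coboundaries J :=
  mkQ_eq_iff

theorem bijective_mulHR (hF : F ∈ I) (hL₀ : L ≠ 0) (hFL : ∀ x, L ∣ F * x → L ∣ x)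
    (h : ∀ x ∈ I, L * x ∈ Ideal.span {L} * I + Ideal.span {F}) :
    Function.Bijective (mulHR L h) := by
  constructor
  · rw [injective_iff_map_eq_zero]
    intro m hm
    obtain ⟨c, rfl⟩ := Submodule.mkQ_surjective _ m
    rw [← map_zero (Submodule.mkQ _), mulHR_mkQ_eq_iff, Submodule.coe_zero, sub_zero] at hm
    rw [← map_zero (Submodule.mkQ _), mkQ_eq_iff, Submodule.coe_zero, sub_zero]
    exact mem_coboundaries_of_smul_mem hF hL₀ hFL c.2 hm
  · intro m
    obtain ⟨c, rfl⟩ := Submodule.mkQ_surjective _ m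
    obtain ⟨c', hc', hcc'⟩ := exists_sub_smul_mem_coboundaries hF hL₀ hFL c.2
    exact ⟨_, (mulHR_mkQ_eq_iff h (c := ⟨c', hc'⟩)).2 hcc'⟩

theorem mem_HRDegree_iff {t : ℤ} {m : HRModule I} :
    m ∈ HRDegree I t ↔ ∃ c : cocycles I, (∀ i j, c.1 i j ∈ fracDegree k t) ∧
      ((coboundaries I).submoduleOf (cocycles I)).mkQ c = m :=
  Iff.rfl

theorem mulHR_mem_HRDegree {J : Ideal (CoordRing k)} (h : ∀ x ∈ I, L * x ∈ J) {d : ℕ}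
    (hL : L.IsHomogeneous d) {t : ℤ} {m : HRModule I} (hm : m ∈ HRDegree I t) :
    mulHR L h m ∈ HRDegree J (t + d) := by
  obtain ⟨c, hc, rfl⟩ := mem_HRDegree_iff.1 hm
  obtain ⟨c', hc', hcc'⟩ := exists_mulHR_mkQ_eq h c
  refine mem_HRDegree_iff.2 ⟨c', fun i j => ?_, hcc'.symm⟩
  rw [hc', Pi.smul_apply, Pi.smul_apply, Algebra.smul_def]
  exact algebraMap_mul_mem_fracDegree hL (hc i j)

theorem mulHR_mem_HRDegree_iff {J : Ideal (CoordRing k)}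
    (hI : I.IsHomogeneous (homogeneousSubmodule (Fin 4) k))
    (hJ : J.IsHomogeneous (homogeneousSubmodule (Fin 4) k)) (h : ∀ x ∈ I, L * x ∈ J) {d : ℕ}
    (hL : L.IsHomogeneous d) (hinj : Function.Injective (mulHR L h)) {t : ℤ} {m : HRModule I} :
    mulHR L h m ∈ HRDegree J (t + d) ↔ m ∈ HRDegree I t := by
  refine ⟨fun hm => ?_, mulHR_mem_HRDegree h hL⟩
  obtain ⟨c, rfl⟩ := Submodule.mkQ_surjective _ m
  obtain ⟨c', hct', hc'⟩ := mem_HRDegree_iff.1 hm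
  obtain ⟨x, hx, hxt, hxc'⟩ := exists_homogeneous_cocycle hI hJ hL c.2 c'.2 hct'
    ((mulHR_mkQ_eq_iff h).1 hc'.symm)
  refine mem_HRDegree_iff.2 ⟨⟨x, hx⟩, hxt, hinj ?_⟩
  exact ((mulHR_mkQ_eq_iff h).2 hxc').trans hc'

theorem hrShiftIso_mul_add (hI : I.IsHomogeneous (homogeneousSubmodule (Fin 4) k)) {n d : ℕ}
    (hFn : F.IsHomogeneous n) (hF : F ∈ I) (hL : L.IsHomogeneous d) (hL₀ : L ≠ 0)
    (hFL : ∀ x, L ∣ F * x → L ∣ x) :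
    HRShiftIso (Ideal.span {L} * I + Ideal.span {F}) I (-d) := by
  have hJ : (Ideal.span {L} * I + Ideal.span {F}).IsHomogeneous
      (homogeneousSubmodule (Fin 4) k) :=
    ((isHomogeneous_span_singleton hL).mul hI).sup (isHomogeneous_span_singleton hFn)
  have hLI : ∀ x ∈ I, L * x ∈ Ideal.span {L} * I + Ideal.span {F} := fun x hx =>
    Submodule.mem_sup_left (Ideal.mul_mem_mul (Ideal.mem_span_singleton_self L) hx)
  have hbij := bijective_mulHR hF hL₀ hFL hLI
  refine ⟨(LinearEquiv.ofBijective _ hbij).symm, fun t m => ?_⟩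
  obtain ⟨m, rfl⟩ := (LinearEquiv.ofBijective _ hbij).surjective m
  rw [LinearEquiv.symm_apply_apply, LinearEquiv.ofBijective_apply,
    ← mulHR_mem_HRDegree_iff hI hJ hLI hL hbij.injective, neg_add_cancel_right]

end HRShift

namespace IsArrangement

variable {k : Type*} [Field k] {L : CoordRing k}

theorem not_dvd_of_notMem_span {ι : Type*} [Nontrivial ι] {ℓ : ι → CoordRing k}
    (hL : Pairwise fun i j => L ∉ Ideal.span {ℓ i, ℓ j}) (i : ι) : ¬ ℓ i ∣ L := fun hdvd => by
  obtain ⟨j, hj⟩ := exists_ne i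
  exact hL hj.symm (Ideal.mem_of_dvd _ hdvd (Ideal.subset_span (Set.mem_insert _ _)))

theorem dvd_of_dvd_prod_mul {n : ℕ} {ℓ : Fin n → CoordRing k}
    (h : IsArrangement (Fin.cons L ℓ : Fin (n + 1) → CoordRing k)) {x : CoordRing k}
    (hx : L ∣ (∏ i, ℓ i) * x) : L ∣ x :=
  (h.prime_head.dvd_or_dvd hx).resolve_left (h.not_dvd_prod_head _)

end IsArrangement

end ArrCurve

theorem proposition2p8 {k : Type*} [Field k] [CharZero k]
    -- an arrangement of `m ≥ 1` distinct planes `ℓ i = 0`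
    (m : ℕ) (hm : 1 ≤ m) (ℓ : Fin m → ArrCurve.CoordRing k)
    (hℓ : ∀ i, (ℓ i).IsHomogeneous 1) (hℓ₀ : ∀ i, ℓ i ≠ 0)
    (hind : Pairwise fun i j => LinearIndependent k ![ℓ i, ℓ j])
    (F : ArrCurve.CoordRing k) (hF : F = ∏ i, ℓ i)
    -- a linear form vanishing on no component of `C_F^red`
    (L : ArrCurve.CoordRing k) (hL : L.IsHomogeneous 1)
    (hLC : ∀ p ∈ (ArrCurve.redCurveIdeal F).minimalPrimes, L ∉ p)
    -- for a single plane `C_F^red` is empty, and `L F` has to define an arrangement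
    (hL₁ : m = 1 → ∀ i, LinearIndependent k ![ℓ i, L]) :
    -- (i)
    ArrCurve.HRShiftIso (ArrCurve.topCurveIdeal (L * F)) (ArrCurve.topCurveIdeal F) (-1) ∧
    ArrCurve.HRShiftIso (ArrCurve.redCurveIdeal (L * F)) (ArrCurve.redCurveIdeal F) (-1) ∧
    -- (ii)
    ArrCurve.topCurveIdeal (L * F) =
      Ideal.span {L} * ArrCurve.topCurveIdeal F + Ideal.span {F} ∧
    ArrCurve.redCurveIdeal (L * F) =
      Ideal.span {L} * ArrCurve.redCurveIdeal F + Ideal.span {F} ∧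
    -- (iii)
    (ArrCurve.IsACM (ArrCurve.topCurveIdeal (L * F)) ↔
      ArrCurve.IsACM (ArrCurve.topCurveIdeal F)) ∧
    (ArrCurve.IsACM (ArrCurve.redCurveIdeal (L * F)) ↔
      ArrCurve.IsACM (ArrCurve.redCurveIdeal F)) ∧
    ArrCurve.IsEvenlyLinked (ArrCurve.topCurveIdeal F) (ArrCurve.topCurveIdeal (L * F)) ∧
    ArrCurve.IsEvenlyLinked (ArrCurve.redCurveIdeal F) (ArrCurve.redCurveIdeal (L * F)) := by
  subst hF
  have hA : ArrCurve.IsArrangement ℓ := ⟨hℓ, hℓ₀, hind⟩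
  have : NeZero m := ⟨by omega⟩
  have hLs := hA.notMem_span_of_forall_minimalPrimes hLC
  have hLℓ : ∀ i, ¬ ℓ i ∣ L := by
    intro i
    rcases eq_or_ne m 1 with hm₁ | hm₁
    · exact (ArrCurve.linearIndependent_pair_iff_not_dvd (hℓ i) hL (hℓ₀ i)).1 (hL₁ hm₁ i)
    · have : Nontrivial (Fin m) := Fin.nontrivial_iff_two_le.2 (by omega)
      exact ArrCurve.IsArrangement.not_dvd_of_notMem_span hLs i
  have hLi i := (ArrCurve.linearIndependent_pair_iff_not_dvd (hℓ i) hL (hℓ₀ i)).2 (hLℓ i)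
  have hL₀ : L ≠ 0 := (hLi 0).ne_zero 1
  have h := hA.cons hL hL₀ fun i => LinearIndependent.pair_symm_iff.1 (hLi i)
  have hdvd := fun x => h.dvd_of_dvd_prod_mul (x := x)
  refine ⟨?_, ?_, h.topCurveIdeal_mul hLs, h.redCurveIdeal_mul hLs,
    h.isACM_topCurveIdeal_mul_iff hLs, h.isACM_redCurveIdeal_mul_iff hLs, ?_, ?_⟩
  · rw [h.topCurveIdeal_mul hLs]
    exact ArrCurve.hrShiftIso_mul_add hA.isHomogeneous_topCurveIdeal hA.isHomogeneous_prod
      hA.prod_mem_topCurveIdeal hL hL₀ hdvd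
  · rw [h.redCurveIdeal_mul hLs]
    exact ArrCurve.hrShiftIso_mul_add hA.isHomogeneous_redCurveIdeal hA.isHomogeneous_prod
      hA.prod_mem_redCurveIdeal hL hL₀ hdvd
  · exact h.topCurveIdeal_mul hLs ▸ hA.isEvenlyLinked_topCurveIdeal hL hLℓ
  · exact h.redCurveIdeal_mul hLs ▸ hA.isEvenlyLinked_redCurveIdeal hL hLℓ
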